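/- Let $k$ be a field, let $Q=k[x_1,\dots,x_n]$ be graded with each $|x_i|$ a positive integer, and let $f\in Q$ be nonzero and homogeneous of degree $d$. Write $M(t)$ for the twist of a graded module, $M(t)_j=M_{j+t}$. For a homogeneous element $f$ of degree $d$ of a $\mathbb Z$-graded polynomial ring $Q$ over $k$, let $MF^{\mathbb Z}(f)$ be the following $k$-linear dg category. An object is a pair of graded free $Q$-modules $F_0,F_1$ of finite rank with a $Q$-linear map $s_0:F_0\to F_1$ of degree $d$ and a $Q$-linear map $s_1:F_1\to F_0$ of degree $0$ such that $s_0s_1=f\cdot\mathrm{id}_{F_1}$ and $s_1s_0=f\cdot\mathrm{id}_{F_0}$. The morphism complex from $F$ to $F'$ is $\mathrm{Hom}_{\mathrm{gr}\,Q}(F_0,F_0'(jd))\oplus\mathrm{Hom}_{\mathrm{gr}\,Q}(F_1,F_1'(jd))$ in degree $2j$ and $\mathrm{Hom}_{\mathrm{gr}\,Q}(F_0,F_1'((j+1)d))\oplus\mathrm{Hom}_{\mathrm{gr}\,Q}(F_1,F_0'(jd))$ in degree $2j+1$, with differential $\partial\alpha=(s_0'+s_1')\alpha-(-1)^{|\alpha|}\alpha(s_0+s_1)$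 and with composition of $Q$-linear maps. Let $l$ be an integer with $1\le l\le d$, let $k[u,v]$ be the polynomial ring graded by $|u|=l$, $|v|=d-l$, and let $X=(X_0\rightleftarrows X_1)$ be the object $k[u,v]\underset{v}{\overset{u}{\rightleftarrows}}k[u,v](l-d)$ of $MF^{\mathbb Z}(uv)$, i.e. $X_0=k[u,v]$, $X_1=k[u,v](l-d)$, and the maps $s_0:X_0\to X_1$, $s_1:X_1\to X_0$ are multiplication by $u$ and by $v$. For $F=(F_0\rightleftarrows F_1)$ in $MF^{\mathbb Z}(f)$ let $F\otimes_{MF}X$ be the object of $MF^{\mathbb Z}(f+uv)$ over $Q[u,v]=Q\otimes_k k[u,v]$ with even part $(F_0\otimes_k X_0)\oplus(F_1\otimes_k X_1)(d)$, odd part $(F_0\otimes_k X_1)\oplus(F_1\otimes_k X_0)$, and maps $$\begin{pmatrix}\mathrm{id}\otimes u& s_1\otimes\mathrm{id}\\-s_0\otimes\mathrm{id}&\mathrm{id}\otimes v\end{pmatrix}\ (\text{even}\to\text{odd}),\qquad \begin{pmatrix}\mathrm{id}\otimes v&-s_1\otimes\mathrm{id}\\s_0\otimes\mathrm{id}&\mathrm{id}\otimes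 u\end{pmatrix}\ (\text{odd}\to\text{even}).$$ Let $K:MF^{\mathbb Z}(f)\to MF^{\mathbb Z}(f+uv)$ be the dg functor given on objects by $F\mapsto F\otimes_{MF}X$ and on morphisms by $\alpha\mapsto\alpha\otimes\mathrm{id}_X$, where, for $y\in X_i$, $(\alpha\otimes\mathrm{id}_X)(x\otimes y)=(-1)^{|\alpha|(i+1)}\alpha(x)\otimes y$. Then $K$ is a quasi-equivalence of dg categories: for all objects $F,G$ of $MF^{\mathbb Z}(f)$ the map of complexes $\mathrm{Hom}(F,G)\to\mathrm{Hom}(K(F),K(G))$ is a quasi-isomorphism, and the induced functor $[K]:[MF^{\mathbb Z}(f)]\to[MF^{\mathbb Z}(f+uv)]$ on homotopy categories (same objects, morphisms $H^0\mathrm{Hom}$) is essentially surjective. -/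

import Mathlib

open CategoryTheory
open scoped TensorProduct

universe u v w

noncomputable section

/-! ### Differential graded categories -/

/-- A `k`-linear dg category: cochain complexes of morphisms, together with an associative and
unital composition satisfying the graded Leibniz rule. `comp h g f` is the composite
`g ∘ f` of `f : X → Y` of degree `n` and `g : Y → Z` of degree `m`. -/
structure DGCategory (k : Type u) [Field k] where
  Obj : Type v
  hom : Obj → Obj → CochainComplex (ModuleCat.{w} k) ℤ
  id : ∀ X : Obj, (hom X X).X 0
  comp : ∀ {X Y Z : Obj} {m n p : ℤ}, m + n = p →
    ((hom Y Z).X m →ₗ[k] (hom X Y).X n →ₗ[k] (hom X Z).X p)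
  d_id : ∀ X : Obj, (hom X X).d 0 1 (id X) = 0
  leibniz : ∀ {X Y Z : Obj} {m n p : ℤ} (h : m + n = p)
    (g : (hom Y Z).X m) (f : (hom X Y).X n),
    (hom X Z).d p (p + 1) (comp h g f) =
      comp (show (m + 1) + n = p + 1 by omega) ((hom Y Z).d m (m + 1) g) f +
        m.negOnePow • comp (show m + (n + 1) = p + 1 by omega) g ((hom X Y).d n (n + 1) f)
  id_comp : ∀ {X Y : Obj} {n : ℤ} (f : (hom X Y).X n), comp (zero_add n) (id Y) f = f
  comp_id : ∀ {X Y : Obj} {n : ℤ} (f : (hom X Y).X n), comp (add_zero n) f (id X) = f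
  assoc : ∀ {W X Y Z : Obj} {a b c ab bc abc : ℤ} (hab : a + b = ab) (hbc : b + c = bc)
    (h : ab + c = abc) (h' : a + bc = abc)
    (p : (hom Y Z).X a) (q : (hom X Y).X b) (r : (hom W X).X c),
    comp h (comp hab p q) r = comp h' p (comp hbc q r)

/-- A dg functor: a map on objects and morphisms of complexes, compatible with units and
compositions. -/
structure DGFunctor {k : Type u} [Field k] (C D : DGCategory.{u, v, w} k) where
  obj : C.Obj → D.Obj
  map : ∀ X Y : C.Obj, C.hom X Y ⟶ D.hom (obj X) (obj Y)
  map_id : ∀ X : C.Obj, (map X X).f 0 (C.id X) = D.id (obj X)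
  map_comp : ∀ {X Y Z : C.Obj} {m n p : ℤ} (h : m + n = p)
    (g : (C.hom Y Z).X m) (f : (C.hom X Y).X n),
    (map X Z).f p (C.comp h g f) = D.comp h ((map Y Z).f m g) ((map X Y).f n f)

namespace DGCategory

variable {k : Type u} [Field k] (C : DGCategory.{u, v, w} k)

/-- Closed morphisms of degree `0`. -/
def cocycles (X Y : C.Obj) : Submodule k ((C.hom X Y).X 0) :=
  LinearMap.ker ((C.hom X Y).d 0 1).hom

/-- Exact morphisms of degree `0`. -/
def coboundaries (X Y : C.Obj) : Submodule k ((C.hom X Y).X 0) :=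
  LinearMap.range ((C.hom X Y).d (-1) 0).hom

/-- `H⁰` of the morphism complex. -/
abbrev H0Hom (X Y : C.Obj) : Type w :=
  C.cocycles X Y ⧸ (C.coboundaries X Y).submoduleOf (C.cocycles X Y)

variable {C}

theorem comp_mem_cocycles {X Y Z : C.Obj} {g : (C.hom Y Z).X 0} {f : (C.hom X Y).X 0}
    (hg : g ∈ C.cocycles Y Z) (hf : f ∈ C.cocycles X Y) :
    C.comp (add_zero 0) g f ∈ C.cocycles X Z := by
  have h := C.leibniz (add_zero 0) g f
  have hg' : (C.hom Y Z).d 0 (0 + 1) g = 0 := hg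
  have hf' : (C.hom X Y).d 0 (0 + 1) f = 0 := hf
  rw [hg', hf'] at h
  change (C.hom X Z).d 0 1 _ = 0
  simpa using h

theorem comp_left_mem_coboundaries {X Y Z : C.Obj} {g : (C.hom Y Z).X 0} {f : (C.hom X Y).X 0}
    (hg : g ∈ C.coboundaries Y Z) (hf : f ∈ C.cocycles X Y) :
    C.comp (add_zero 0) g f ∈ C.coboundaries X Z := by
  obtain ⟨e, rfl⟩ := hg
  refine ⟨C.comp (add_zero (-1)) e f, ?_⟩
  have h := C.leibniz (add_zero (-1)) e f
  have hf' : (C.hom X Y).d 0 (0 + 1) f = 0 := hf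
  rw [hf'] at h
  simpa using h

theorem comp_right_mem_coboundaries {X Y Z : C.Obj} {g : (C.hom Y Z).X 0}
    {f : (C.hom X Y).X 0} (hg : g ∈ C.cocycles Y Z) (hf : f ∈ C.coboundaries X Y) :
    C.comp (add_zero 0) g f ∈ C.coboundaries X Z := by
  obtain ⟨e, rfl⟩ := hf
  refine ⟨C.comp (zero_add (-1)) g e, ?_⟩
  have h := C.leibniz (zero_add (-1)) g e
  have hg' : (C.hom Y Z).d 0 (0 + 1) g = 0 := hg
  rw [hg'] at h
  simpa using h

/-- Composition on `H⁰`. -/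
def H0comp {X Y Z : C.Obj} : C.H0Hom X Y → C.H0Hom Y Z → C.H0Hom X Z :=
  Quotient.map₂ (fun f g => ⟨C.comp (add_zero 0) g.1 f.1, comp_mem_cocycles g.2 f.2⟩) (by
    intro f f' hf g g' hg
    have hf1 := (Submodule.quotientRel_def _).1 hf
    have hg1 := (Submodule.quotientRel_def _).1 hg
    refine (Submodule.quotientRel_def _).2 ?_
    rw [Submodule.submoduleOf, Submodule.mem_comap] at hf1 hg1 ⊢
    have h1 := comp_left_mem_coboundaries hg1 f.2
    have h2 := comp_right_mem_coboundaries g'.2 hf1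
    have h3 := Submodule.add_mem _ h1 h2
    simpa using h3)

/-- The objects of the homotopy category `[C]`. -/
structure H0 (C : DGCategory.{u, v, w} k) where
  as : C.Obj

/-- The homotopy category `[C]`: the objects of `C`, with morphisms the `H⁰` of the morphism
complexes. -/
instance : Category (H0 C) where
  Hom X Y := C.H0Hom X.as Y.as
  id X := Submodule.Quotient.mk ⟨C.id X.as, C.d_id X.as⟩
  comp f g := H0comp f g
  id_comp f := by
    induction f using Quotient.inductionOn
    exact congrArg Submodule.Quotient.mk (Subtype.ext (C.comp_id _))
  comp_id f := by
    induction f using Quotient.inductionOn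
    exact congrArg Submodule.Quotient.mk (Subtype.ext (C.id_comp _))
  assoc f g h := by
    induction f using Quotient.inductionOn
    induction g using Quotient.inductionOn
    induction h using Quotient.inductionOn
    exact congrArg Submodule.Quotient.mk (Subtype.ext (C.assoc _ _ _ _ _ _ _).symm)

end DGCategory

namespace DGFunctor

variable {k : Type u} [Field k] {C D : DGCategory.{u, v, w} k} (F : DGFunctor C D)

theorem map_mem_cocycles {X Y : C.Obj} {f : (C.hom X Y).X 0} (hf : f ∈ C.cocycles X Y) :
    (F.map X Y).f 0 f ∈ D.cocycles (F.obj X) (F.obj Y) := by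
  have h := congrArg (fun t => t.hom f) ((F.map X Y).comm 0 1)
  have hf' : (C.hom X Y).d 0 1 f = 0 := hf
  change (D.hom _ _).d 0 1 ((F.map X Y).f 0 f) = (F.map X Y).f 1 ((C.hom X Y).d 0 1 f) at h
  rw [hf', map_zero] at h
  exact h

theorem map_mem_coboundaries {X Y : C.Obj} {f : (C.hom X Y).X 0}
    (hf : f ∈ C.coboundaries X Y) :
    (F.map X Y).f 0 f ∈ D.coboundaries (F.obj X) (F.obj Y) := by
  obtain ⟨e, rfl⟩ := hf
  exact ⟨(F.map X Y).f (-1) e, congrArg (fun t => t.hom e) ((F.map X Y).comm (-1) 0)⟩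

/-- The functor `[F] : [C] ⥤ [D]` induced by a dg functor `F`. -/
def mapH0 : DGCategory.H0 C ⥤ DGCategory.H0 D where
  obj X := ⟨F.obj X.as⟩
  map {X Y} := Quotient.map (fun f => ⟨(F.map X.as Y.as).f 0 f.1, F.map_mem_cocycles f.2⟩) (by
    intro f f' hf
    have hf1 := (Submodule.quotientRel_def _).1 hf
    refine (Submodule.quotientRel_def _).2 ?_
    rw [Submodule.submoduleOf, Submodule.mem_comap] at hf1 ⊢
    simpa using F.map_mem_coboundaries hf1)
  map_id X := congrArg Submodule.Quotient.mk (Subtype.ext (F.map_id X.as))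
  map_comp f g := by
    induction f using Quotient.inductionOn
    induction g using Quotient.inductionOn
    exact congrArg Submodule.Quotient.mk (Subtype.ext (F.map_comp _ _ _))

/-- A dg functor is a quasi-equivalence if it is a quasi-isomorphism on all morphism complexes
and essentially surjective on homotopy categories. -/
def IsQuasiEquivalence : Prop :=
  (∀ X Y : C.Obj, QuasiIso (F.map X Y)) ∧ F.mapH0.EssSurj

end DGFunctor

/-! ### Graded free modules -/

section Graded

variable {k : Type u} [Field k] {A : Type u} [CommRing A] [Algebra k A]

/-- A graded free module of finite rank over a commutative `k`-algebra `A` with a `ℤ`-grading `𝓐`: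
an `A`-module with subspaces of elements of degree `n` for all `n : ℤ`, which has a finite
`A`-basis `b` of homogeneous elements, `b i` of degree `a i`, such that the elements of degree `n`
are exactly the `∑ cᵢ bᵢ` with `cᵢ` homogeneous of degree `n - a i`. In other words, it is a graded
`A`-module isomorphic to a finite direct sum `⨁ᵢ A(-aᵢ)`. -/
structure GradedFree (𝓐 : ℤ → Submodule k A) where
  carrier : Type u
  [addCommGroup : AddCommGroup carrier]
  [moduleBase : Module k carrier]
  [module : Module A carrier]
  [isScalarTower : IsScalarTower k A carrier]
  deg : ℤ → Submodule k carrier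
  exists_basis : ∃ (ι : Type) (_ : Finite ι) (b : Module.Basis ι A carrier) (a : ι → ℤ),
    ∀ n x, x ∈ deg n ↔ ∀ i, b.repr x i ∈ 𝓐 (n - a i)

namespace GradedFree

variable {𝓐 : ℤ → Submodule k A}

instance : CoeSort (GradedFree 𝓐) (Type u) := ⟨carrier⟩

attribute [instance] addCommGroup moduleBase module isScalarTower

/-- `Hom_{gr A}(M, N(t))`: the `A`-linear maps that raise degrees by `t`. -/
def gr (M N : GradedFree 𝓐) (t : ℤ) : Submodule k (M →ₗ[A] N) where
  carrier := {φ | ∀ n, ∀ x ∈ M.deg n, φ x ∈ N.deg (n + t)}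
  add_mem' h h' n x hx := add_mem (h n x hx) (h' n x hx)
  zero_mem' _ _ _ := zero_mem _
  smul_mem' c _ h n x hx := Submodule.smul_mem _ c (h n x hx)

theorem gr_comp {M N P : GradedFree 𝓐} {s t r : ℤ} (h : s + t = r) {g : N →ₗ[A] P}
    {f : M →ₗ[A] N} (hg : g ∈ gr N P s) (hf : f ∈ gr M N t) : g ∘ₗ f ∈ gr M P r := by
  intro n x hx
  have := hg _ _ (hf n x hx)
  rwa [add_assoc, add_comm t s, h] at this

theorem id_mem_gr (M : GradedFree 𝓐) : (LinearMap.id : M →ₗ[A] M) ∈ gr M M 0 := by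
  intro n x hx
  simpa using hx

/-- The twist `M(t)`, with `M(t)ₙ = Mₙ₊ₜ`. -/
abbrev twist (M : GradedFree 𝓐) (t : ℤ) : GradedFree 𝓐 where
  carrier := M
  deg n := M.deg (n + t)
  exists_basis := by
    obtain ⟨ι, hι, b, a, h⟩ := M.exists_basis
    refine ⟨ι, hι, b, fun i => a i - t, fun n x => ?_⟩
    rw [h]
    simp only [sub_sub_eq_add_sub]

/-- The direct sum of two graded free modules. -/
abbrev prod (M N : GradedFree 𝓐) : GradedFree 𝓐 where
  carrier := M × N
  deg n := (M.deg n).prod (N.deg n)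
  exists_basis := by
    obtain ⟨ι, hι, b, a, h⟩ := M.exists_basis
    obtain ⟨ι', hι', b', a', h'⟩ := N.exists_basis
    refine ⟨ι ⊕ ι', inferInstance, b.prod b', Sum.elim a a', fun n x => ?_⟩
    rw [Submodule.mem_prod, h, h', Sum.forall]
    simp

/-- The ring itself as a graded free module of rank one. -/
abbrev self (𝓐 : ℤ → Submodule k A) : GradedFree 𝓐 where
  carrier := A
  deg := 𝓐
  exists_basis := ⟨Unit, inferInstance, Module.Basis.singleton Unit A, fun _ => 0, by simp⟩

/-- The tensor product over `A`: its elements of degree `n` are the sums of `x ⊗ y` with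
`deg x + deg y = n`. -/
def tensor [SetLike.GradedMonoid 𝓐] (M N : GradedFree 𝓐) : GradedFree 𝓐 where
  carrier := M ⊗[A] N
  deg n := Submodule.span k
    {z | ∃ i j, i + j = n ∧ ∃ x ∈ M.deg i, ∃ y ∈ N.deg j, z = x ⊗ₜ[A] y}
  exists_basis := by
    obtain ⟨ι, hι, b, a, h⟩ := M.exists_basis
    obtain ⟨ι', hι', b', a', h'⟩ := N.exists_basis
    refine ⟨ι × ι', inferInstance, b.tensorProduct b', fun i => a i.1 + a' i.2, fun n z => ?_⟩
    constructor
    · intro hz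
      induction hz using Submodule.span_induction with
      | mem z hz =>
        obtain ⟨i, j, rfl, x, hx, y, hy, rfl⟩ := hz
        rintro ⟨p, q⟩
        rw [Module.Basis.tensorProduct_repr_tmul_apply]
        have := SetLike.mul_mem_graded ((h' _ _).1 hy q) ((h _ _).1 hx p)
        simpa [sub_add_sub_comm, add_comm] using this
      | zero => intro i; simp
      | add z z' _ _ hz hz' => intro i; simpa using add_mem (hz i) (hz' i)
      | smul c z _ hz =>
        intro i
        rw [← algebraMap_smul A c z, map_smul, Finsupp.smul_apply, algebraMap_smul]
        exact Submodule.smul_mem _ c (hz i)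
    · intro hz
      cases nonempty_fintype ι
      cases nonempty_fintype ι'
      rw [← (b.tensorProduct b').sum_repr z]
      refine Submodule.sum_mem _ fun i _ => Submodule.subset_span ?_
      refine ⟨n - a' i.2, a' i.2, by omega, ((b.tensorProduct b').repr z i) • b i.1, ?_, b' i.2,
        ?_, ?_⟩
      · rw [h]
        intro p
        rw [map_smul, Finsupp.smul_apply, b.repr_self, smul_eq_mul]
        by_cases hp : i.1 = p
        · subst hp
          have := hz i
          rw [Finsupp.single_eq_same, mul_one]
          convert this using 2
          simp only
          omega
        · rw [Finsupp.single_eq_of_ne' hp, mul_zero]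
          exact zero_mem _
      · rw [h']
        intro p
        rw [b'.repr_self]
        by_cases hp : i.2 = p
        · subst hp
          rw [Finsupp.single_eq_same, sub_self]
          exact SetLike.one_mem_graded 𝓐
        · rw [Finsupp.single_eq_of_ne' hp]
          exact zero_mem _
      · rw [Module.Basis.tensorProduct_apply', TensorProduct.smul_tmul']

/-- The map `g ⊗ g'` of tensor products over `A`. -/
def tensorHom [SetLike.GradedMonoid 𝓐] {M M' N N' : GradedFree 𝓐} (g : M →ₗ[A] N)
    (g' : M' →ₗ[A] N') : tensor M M' →ₗ[A] tensor N N' :=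
  TensorProduct.map g g'

theorem tensorHom_mem_gr [SetLike.GradedMonoid 𝓐] {M M' N N' : GradedFree 𝓐} {s t r : ℤ}
    (h : s + t = r) {g : M →ₗ[A] N} {g' : M' →ₗ[A] N'} (hg : g ∈ gr M N s)
    (hg' : g' ∈ gr M' N' t) : tensorHom g g' ∈ gr (tensor M M') (tensor N N') r := by
  intro n
  have key : (tensor M M').deg n ≤
      ((tensor N N').deg (n + r)).comap ((tensorHom g g').restrictScalars k) := by
    refine Submodule.span_le.2 ?_
    rintro _ ⟨i, j, rfl, x, hx, y, hy, rfl⟩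
    exact Submodule.subset_span ⟨i + s, j + t, by omega, g x, hg i x hx, g' y, hg' j y hy, rfl⟩
  exact fun x hx => key hx

end GradedFree

/-- The algebra structure `A → B` respects the gradings. -/
def IsGradedAlgebraMap {B : Type u} [CommRing B] [Algebra k B] [Algebra A B]
    (𝓐 : ℤ → Submodule k A) (𝓑 : ℤ → Submodule k B) : Prop :=
  ∀ i, ∀ a ∈ 𝓐 i, algebraMap A B a ∈ 𝓑 i

namespace GradedFree

variable {𝓐 : ℤ → Submodule k A} [SetLike.GradedMonoid 𝓐]
  {B : Type u} [CommRing B] [Algebra k B] [Algebra A B] [IsScalarTower k A B]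
  {𝓑 : ℤ → Submodule k B} [SetLike.GradedMonoid 𝓑]

/-- Extension of scalars along a graded algebra map `A → B`. -/
def baseChange (hB : IsGradedAlgebraMap 𝓐 𝓑) (M : GradedFree 𝓐) : GradedFree 𝓑 where
  carrier := B ⊗[A] M
  deg n := Submodule.span k
    {z | ∃ i j, i + j = n ∧ ∃ c ∈ 𝓑 i, ∃ x ∈ M.deg j, z = c ⊗ₜ[A] x}
  exists_basis := by
    obtain ⟨ι, hι, b, a, h⟩ := M.exists_basis
    refine ⟨ι, hι, b.baseChange B, a, fun n z => ?_⟩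
    constructor
    · intro hz
      induction hz using Submodule.span_induction with
      | mem z hz =>
        obtain ⟨i, j, rfl, c, hc, x, hx, rfl⟩ := hz
        intro p
        rw [Module.Basis.baseChange_repr_tmul, Algebra.smul_def, mul_comm, add_sub_assoc]
        exact SetLike.mul_mem_graded hc (hB _ _ ((h _ _).1 hx p))
      | zero => intro i; simp
      | add z z' _ _ hz hz' => intro i; simpa using add_mem (hz i) (hz' i)
      | smul c z _ hz =>
        intro i
        rw [← algebraMap_smul B c z, map_smul, Finsupp.smul_apply, algebraMap_smul]
        exact Submodule.smul_mem _ c (hz i)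
    · intro hz
      cases nonempty_fintype ι
      rw [← (b.baseChange B).sum_repr z]
      refine Submodule.sum_mem _ fun i _ => Submodule.subset_span ?_
      refine ⟨n - a i, a i, by omega, (b.baseChange B).repr z i, hz i, b i, ?_, ?_⟩
      · rw [h]
        intro p
        rw [b.repr_self]
        by_cases hp : i = p
        · subst hp
          rw [Finsupp.single_eq_same, sub_self]
          exact SetLike.one_mem_graded 𝓐
        · rw [Finsupp.single_eq_of_ne' hp]
          exact zero_mem _
      · rw [Module.Basis.baseChange_apply, TensorProduct.smul_tmul', smul_eq_mul, mul_one]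

/-- The extension of scalars of a linear map. -/
def baseChangeHom (hB : IsGradedAlgebraMap 𝓐 𝓑) {M N : GradedFree 𝓐} (g : M →ₗ[A] N) :
    baseChange hB M →ₗ[B] baseChange hB N :=
  g.baseChange B

theorem baseChangeHom_mem_gr (hB : IsGradedAlgebraMap 𝓐 𝓑) {M N : GradedFree 𝓐} {t : ℤ}
    {g : M →ₗ[A] N} (hg : g ∈ gr M N t) :
    baseChangeHom hB g ∈ gr (baseChange hB M) (baseChange hB N) t := by
  intro n
  have key : (baseChange hB M).deg n ≤
      ((baseChange hB N).deg (n + t)).comap ((baseChangeHom hB g).restrictScalars k) := by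
    refine Submodule.span_le.2 ?_
    rintro _ ⟨i, j, rfl, c, hc, x, hx, rfl⟩
    exact Submodule.subset_span ⟨i, j + t, by omega, c, hc, g x, hg j x hx, rfl⟩
  exact fun x hx => key hx

end GradedFree

/-! ### The dg category of graded matrix factorizations -/

open GradedFree

/-- A graded matrix factorization of `f`: graded free modules `F0`, `F1`, a map
`s0 : F0 → F1` of degree `d` and a map `s1 : F1 → F0` of degree `0` such that both composites are
multiplication by `f`. -/
structure GradedMF (𝓐 : ℤ → Submodule k A) (f : A) (d : ℤ) where
  F0 : GradedFree 𝓐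
  F1 : GradedFree 𝓐
  s0 : F0 →ₗ[A] F1
  s1 : F1 →ₗ[A] F0
  s0_mem : s0 ∈ gr F0 F1 d
  s1_mem : s1 ∈ gr F1 F0 0
  s0_s1 : s0 ∘ₗ s1 = f • LinearMap.id
  s1_s0 : s1 ∘ₗ s0 = f • LinearMap.id

namespace GradedMF

variable {𝓐 : ℤ → Submodule k A} {f : A} {d : ℤ}

/-- The total module `F0 ⊕ F1`. -/
abbrev Total (F : GradedMF 𝓐 f d) : Type u := F.F0 × F.F1

/-- The endomorphism `s0 + s1` of `F0 ⊕ F1`. -/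
def s (F : GradedMF 𝓐 f d) : F.Total →ₗ[A] F.Total :=
  (F.s1 ∘ₗ LinearMap.snd A F.F0 F.F1).prod (F.s0 ∘ₗ LinearMap.fst A F.F0 F.F1)

variable {F G H : GradedMF 𝓐 f d}

/-- The component `F0 → G0`. -/
def c00 (φ : F.Total →ₗ[A] G.Total) : F.F0 →ₗ[A] G.F0 :=
  LinearMap.fst A G.F0 G.F1 ∘ₗ φ ∘ₗ LinearMap.inl A F.F0 F.F1

/-- The component `F1 → G1`. -/
def c11 (φ : F.Total →ₗ[A] G.Total) : F.F1 →ₗ[A] G.F1 :=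
  LinearMap.snd A G.F0 G.F1 ∘ₗ φ ∘ₗ LinearMap.inr A F.F0 F.F1

/-- The component `F0 → G1`. -/
def c10 (φ : F.Total →ₗ[A] G.Total) : F.F0 →ₗ[A] G.F1 :=
  LinearMap.snd A G.F0 G.F1 ∘ₗ φ ∘ₗ LinearMap.inl A F.F0 F.F1

/-- The component `F1 → G0`. -/
def c01 (φ : F.Total →ₗ[A] G.Total) : F.F1 →ₗ[A] G.F0 :=
  LinearMap.fst A G.F0 G.F1 ∘ₗ φ ∘ₗ LinearMap.inr A F.F0 F.F1

theorem apply_eq (φ : F.Total →ₗ[A] G.Total) (x : F.Total) :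
    φ x = (c00 φ x.1 + c01 φ x.2, c10 φ x.1 + c11 φ x.2) := by
  have : x = (x.1, 0) + (0, x.2) := by simp
  conv_lhs => rw [this, map_add]
  rfl

/-- Morphisms of degree `m`, as `A`-linear maps `F0 ⊕ F1 → G0 ⊕ G1`: for `m = 2l` these are
`Hom(F0, G0(ld)) ⊕ Hom(F1, G1(ld))`, and for `m = 2l + 1` these are
`Hom(F0, G1((l+1)d)) ⊕ Hom(F1, G0(ld))`. -/
def homDeg (F G : GradedMF 𝓐 f d) (m : ℤ) : Submodule k (F.Total →ₗ[A] G.Total) where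
  carrier := {φ |
    (∀ l, m = 2 * l → c00 φ ∈ gr F.F0 G.F0 (l * d) ∧ c11 φ ∈ gr F.F1 G.F1 (l * d) ∧
      c10 φ = 0 ∧ c01 φ = 0) ∧
    (∀ l, m = 2 * l + 1 → c10 φ ∈ gr F.F0 G.F1 ((l + 1) * d) ∧ c01 φ ∈ gr F.F1 G.F0 (l * d) ∧
      c00 φ = 0 ∧ c11 φ = 0)}
  zero_mem' := ⟨fun _ _ => ⟨zero_mem _, zero_mem _, rfl, rfl⟩,
    fun _ _ => ⟨zero_mem _, zero_mem _, rfl, rfl⟩⟩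
  add_mem' {φ ψ} h h' := by
    have e00 : c00 (φ + ψ) = c00 φ + c00 ψ := rfl
    have e01 : c01 (φ + ψ) = c01 φ + c01 ψ := rfl
    have e10 : c10 (φ + ψ) = c10 φ + c10 ψ := rfl
    have e11 : c11 (φ + ψ) = c11 φ + c11 ψ := rfl
    constructor
    · intro l hl
      obtain ⟨h1, h2, h3, h4⟩ := h.1 l hl
      obtain ⟨h1', h2', h3', h4'⟩ := h'.1 l hl
      rw [e00, e01, e10, e11, h3, h4, h3', h4']
      exact ⟨add_mem h1 h1', add_mem h2 h2', add_zero _, add_zero _⟩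
    · intro l hl
      obtain ⟨h1, h2, h3, h4⟩ := h.2 l hl
      obtain ⟨h1', h2', h3', h4'⟩ := h'.2 l hl
      rw [e00, e01, e10, e11, h3, h4, h3', h4']
      exact ⟨add_mem h1 h1', add_mem h2 h2', add_zero _, add_zero _⟩
  smul_mem' c φ h := by
    have e00 : c00 (c • φ) = c • c00 φ := rfl
    have e01 : c01 (c • φ) = c • c01 φ := rfl
    have e10 : c10 (c • φ) = c • c10 φ := rfl
    have e11 : c11 (c • φ) = c • c11 φ := rfl
    constructor
    · intro l hl
      obtain ⟨h1, h2, h3, h4⟩ := h.1 l hl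
      rw [e00, e01, e10, e11, h3, h4]
      exact ⟨Submodule.smul_mem _ c h1, Submodule.smul_mem _ c h2, smul_zero _, smul_zero _⟩
    · intro l hl
      obtain ⟨h1, h2, h3, h4⟩ := h.2 l hl
      rw [e00, e01, e10, e11, h3, h4]
      exact ⟨Submodule.smul_mem _ c h1, Submodule.smul_mem _ c h2, smul_zero _, smul_zero _⟩

theorem mem_homDeg_even {φ : F.Total →ₗ[A] G.Total} (l : ℤ) :
    φ ∈ homDeg F G (2 * l) ↔ c00 φ ∈ gr F.F0 G.F0 (l * d) ∧ c11 φ ∈ gr F.F1 G.F1 (l * d) ∧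
      c10 φ = 0 ∧ c01 φ = 0 := by
  refine ⟨fun h => h.1 l rfl, fun h => ⟨fun l' hl => ?_, fun l' hl => by omega⟩⟩
  obtain rfl : l = l' := by omega
  exact h

theorem mem_homDeg_odd {φ : F.Total →ₗ[A] G.Total} (l : ℤ) :
    φ ∈ homDeg F G (2 * l + 1) ↔ c10 φ ∈ gr F.F0 G.F1 ((l + 1) * d) ∧
      c01 φ ∈ gr F.F1 G.F0 (l * d) ∧ c00 φ = 0 ∧ c11 φ = 0 := by
  refine ⟨fun h => h.2 l rfl, fun h => ⟨fun l' hl => by omega, fun l' hl => ?_⟩⟩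
  obtain rfl : l = l' := by omega
  exact h

theorem c00_comp (ψ : G.Total →ₗ[A] H.Total) (φ : F.Total →ₗ[A] G.Total) :
    c00 (ψ ∘ₗ φ) = c00 ψ ∘ₗ c00 φ + c01 ψ ∘ₗ c10 φ :=
  LinearMap.ext fun x => congrArg Prod.fst (apply_eq ψ (φ (x, 0)))

theorem c01_comp (ψ : G.Total →ₗ[A] H.Total) (φ : F.Total →ₗ[A] G.Total) :
    c01 (ψ ∘ₗ φ) = c00 ψ ∘ₗ c01 φ + c01 ψ ∘ₗ c11 φ :=
  LinearMap.ext fun x => congrArg Prod.fst (apply_eq ψ (φ (0, x)))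

theorem c10_comp (ψ : G.Total →ₗ[A] H.Total) (φ : F.Total →ₗ[A] G.Total) :
    c10 (ψ ∘ₗ φ) = c10 ψ ∘ₗ c00 φ + c11 ψ ∘ₗ c10 φ :=
  LinearMap.ext fun x => congrArg Prod.snd (apply_eq ψ (φ (x, 0)))

theorem c11_comp (ψ : G.Total →ₗ[A] H.Total) (φ : F.Total →ₗ[A] G.Total) :
    c11 (ψ ∘ₗ φ) = c10 ψ ∘ₗ c01 φ + c11 ψ ∘ₗ c11 φ :=
  LinearMap.ext fun x => congrArg Prod.snd (apply_eq ψ (φ (0, x)))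

theorem comp_mem_homDeg {m n p : ℤ} (h : m + n = p) {ψ : G.Total →ₗ[A] H.Total}
    {φ : F.Total →ₗ[A] G.Total} (hψ : ψ ∈ homDeg G H m) (hφ : φ ∈ homDeg F G n) :
    ψ ∘ₗ φ ∈ homDeg F H p := by
  subst h
  obtain ⟨a, rfl | rfl⟩ := Int.even_or_odd' m <;> obtain ⟨b, rfl | rfl⟩ := Int.even_or_odd' n
  · obtain ⟨h1, h2, h3, h4⟩ := (mem_homDeg_even a).1 hψ
    obtain ⟨k1, k2, k3, k4⟩ := (mem_homDeg_even b).1 hφ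
    rw [← mul_add, mem_homDeg_even, c00_comp, c01_comp, c10_comp, c11_comp, h3, h4, k3, k4]
    simp only [LinearMap.comp_zero, LinearMap.zero_comp, add_zero, zero_add]
    exact ⟨gr_comp (by ring) h1 k1, gr_comp (by ring) h2 k2, trivial, trivial⟩
  · obtain ⟨h1, h2, h3, h4⟩ := (mem_homDeg_even a).1 hψ
    obtain ⟨k1, k2, k3, k4⟩ := (mem_homDeg_odd b).1 hφ
    rw [← add_assoc, ← mul_add, mem_homDeg_odd, c00_comp, c01_comp, c10_comp, c11_comp, h3, h4,
      k3, k4]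
    simp only [LinearMap.comp_zero, LinearMap.zero_comp, add_zero, zero_add]
    exact ⟨gr_comp (by ring) h2 k1, gr_comp (by ring) h1 k2, trivial, trivial⟩
  · obtain ⟨h1, h2, h3, h4⟩ := (mem_homDeg_odd a).1 hψ
    obtain ⟨k1, k2, k3, k4⟩ := (mem_homDeg_even b).1 hφ
    rw [add_right_comm, ← mul_add, mem_homDeg_odd, c00_comp, c01_comp, c10_comp, c11_comp, h3, h4,
      k3, k4]
    simp only [LinearMap.comp_zero, LinearMap.zero_comp, add_zero, zero_add]
    exact ⟨gr_comp (by ring) h1 k1, gr_comp (by ring) h2 k2, trivial, trivial⟩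
  · obtain ⟨h1, h2, h3, h4⟩ := (mem_homDeg_odd a).1 hψ
    obtain ⟨k1, k2, k3, k4⟩ := (mem_homDeg_odd b).1 hφ
    rw [show 2 * a + 1 + (2 * b + 1) = 2 * (a + b + 1) by ring, mem_homDeg_even, c00_comp,
      c01_comp, c10_comp, c11_comp, h3, h4, k3, k4]
    simp only [LinearMap.comp_zero, LinearMap.zero_comp, add_zero, zero_add]
    exact ⟨gr_comp (by ring) h2 k1, gr_comp (by ring) h1 k2, trivial, trivial⟩

theorem id_mem_homDeg (F : GradedMF 𝓐 f d) : LinearMap.id ∈ homDeg F F 0 := by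
  rw [← mul_zero 2, mem_homDeg_even, zero_mul]
  exact ⟨id_mem_gr _, id_mem_gr _, rfl, rfl⟩

theorem s_mem_homDeg (F : GradedMF 𝓐 f d) : F.s ∈ homDeg F F 1 := by
  have : c00 F.s = 0 ∧ c11 F.s = 0 ∧ c10 F.s = F.s0 ∧ c01 F.s = F.s1 :=
    ⟨by ext; simp [c00, s], by ext; simp [c11, s], rfl, rfl⟩
  obtain ⟨h1, h2, h3, h4⟩ := this
  rw [show (1 : ℤ) = 2 * 0 + 1 by norm_num, mem_homDeg_odd, h1, h2, h3, h4, zero_add, one_mul,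
    zero_mul]
  exact ⟨F.s0_mem, F.s1_mem, rfl, rfl⟩

theorem s_comp_s (F : GradedMF 𝓐 f d) : F.s ∘ₗ F.s = f • LinearMap.id := by
  refine LinearMap.ext fun x => Prod.ext ?_ ?_
  · exact LinearMap.congr_fun F.s1_s0 x.1
  · exact LinearMap.congr_fun F.s0_s1 x.2

theorem negOnePow_smul_mem {m : ℤ} (e : ℤ) {φ : F.Total →ₗ[A] G.Total}
    (hφ : φ ∈ homDeg F G m) : e.negOnePow • φ ∈ homDeg F G m := by
  obtain h | h := Int.even_or_odd e
  · rwa [Int.negOnePow_even e h, one_smul]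
  · rw [Int.negOnePow_odd e h, Units.neg_smul, one_smul]
    exact neg_mem hφ

/-- The differential `∂ α = s ∘ α - (-1)^|α| α ∘ s`. -/
def diff (F G : GradedMF 𝓐 f d) (i j : ℤ) (h : i + 1 = j) : homDeg F G i →ₗ[k] homDeg F G j where
  toFun α := ⟨G.s ∘ₗ α.1 - i.negOnePow • (α.1 ∘ₗ F.s),
    sub_mem (comp_mem_homDeg (by omega) G.s_mem_homDeg α.2)
      (negOnePow_smul_mem i (comp_mem_homDeg h α.2 F.s_mem_homDeg))⟩
  map_add' α β := Subtype.ext (by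
    simp only [Submodule.coe_add, LinearMap.comp_add, LinearMap.add_comp, smul_add]
    abel)
  map_smul' c α := Subtype.ext (by
    refine LinearMap.ext fun x => ?_
    have h1 : G.s (c • α.1 x) = c • G.s (α.1 x) := by
      rw [← algebraMap_smul A c, map_smul, algebraMap_smul]
    simp only [Submodule.coe_smul, LinearMap.sub_apply, LinearMap.comp_apply,
      LinearMap.smul_apply, RingHom.id_apply, smul_sub, h1, Units.smul_def]
    rw [smul_comm])

theorem diff_diff (F G : GradedMF 𝓐 f d) (i j l : ℤ) (h : i + 1 = j) (h' : j + 1 = l)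
    (α : homDeg F G i) : diff F G j l h' (diff F G i j h α) = 0 := by
  subst h h'
  refine Subtype.ext ?_
  change G.s ∘ₗ (G.s ∘ₗ α.1 - i.negOnePow • (α.1 ∘ₗ F.s)) -
    (i + 1).negOnePow • ((G.s ∘ₗ α.1 - i.negOnePow • (α.1 ∘ₗ F.s)) ∘ₗ F.s) = 0
  refine LinearMap.ext fun x => ?_
  have hF : F.s (F.s x) = f • x := LinearMap.congr_fun F.s_comp_s x
  have hG : G.s (G.s (α.1 x)) = f • α.1 x := LinearMap.congr_fun G.s_comp_s (α.1 x)
  obtain hi | hi := Int.even_or_odd i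
  · rw [Int.negOnePow_succ, Int.negOnePow_even i hi]
    simp [hF, hG]
  · rw [Int.negOnePow_succ, Int.negOnePow_odd i hi]
    simp [hF, hG]
    abel

/-- The morphism complex. -/
def homComplex (F G : GradedMF 𝓐 f d) : CochainComplex (ModuleCat.{u} k) ℤ where
  X m := ModuleCat.of k (homDeg F G m)
  d i j := if h : i + 1 = j then ModuleCat.ofHom (diff F G i j h) else 0
  shape i j h := dif_neg h
  d_comp_d' i j l h h' := by
    have e : i + 1 = j := h
    have e' : j + 1 = l := h'
    rw [dif_pos e, dif_pos e']
    exact ModuleCat.hom_ext (LinearMap.ext fun α => diff_diff F G i j l e e' α)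

theorem homComplex_d_apply (F G : GradedMF 𝓐 f d) (i j : ℤ) (h : i + 1 = j)
    (α : homDeg F G i) : (homComplex F G).d i j α = diff F G i j h α := by
  simp only [homComplex, dif_pos h]
  rfl

/-- Composition of morphisms, as a bilinear map. -/
def compMap {m n p : ℤ} (h : m + n = p) :
    homDeg G H m →ₗ[k] homDeg F G n →ₗ[k] homDeg F H p :=
  LinearMap.mk₂ k (fun ψ φ => ⟨ψ.1 ∘ₗ φ.1, comp_mem_homDeg h ψ.2 φ.2⟩)
    (fun _ _ _ => rfl) (fun _ _ _ => rfl)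
    (fun ψ _ _ => Subtype.ext (LinearMap.comp_add _ _ ψ.1))
    (fun c ψ φ => Subtype.ext (LinearMap.ext fun x => by
      change ψ.1 (c • φ.1 x) = c • ψ.1 (φ.1 x)
      rw [← algebraMap_smul A c, map_smul, algebraMap_smul]))

theorem diff_compMap {m n p : ℤ} (h : m + n = p) (ψ : homDeg G H m) (φ : homDeg F G n) :
    diff F H p (p + 1) rfl (compMap h ψ φ) =
      compMap (by omega) (diff G H m (m + 1) rfl ψ) φ +
        m.negOnePow • compMap (by omega) ψ (diff F G n (n + 1) rfl φ) := by
  subst h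
  refine Subtype.ext ?_
  change H.s ∘ₗ (ψ.1 ∘ₗ φ.1) - (m + n).negOnePow • ((ψ.1 ∘ₗ φ.1) ∘ₗ F.s) =
    (H.s ∘ₗ ψ.1 - m.negOnePow • (ψ.1 ∘ₗ G.s)) ∘ₗ φ.1 +
      ((m.negOnePow • compMap (by omega) ψ (diff F G n (n + 1) rfl φ) :
        homDeg F H (m + n + 1)) : F.Total →ₗ[A] H.Total)
  have e : ((m.negOnePow • compMap (by omega) ψ (diff F G n (n + 1) rfl φ) :
      homDeg F H (m + n + 1)) : F.Total →ₗ[A] H.Total) =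
      m.negOnePow • (ψ.1 ∘ₗ (G.s ∘ₗ φ.1 - n.negOnePow • (φ.1 ∘ₗ F.s))) := rfl
  rw [e]
  refine LinearMap.ext fun x => ?_
  rw [Int.negOnePow_add]
  obtain hm | hm := Int.even_or_odd m <;> obtain hn | hn := Int.even_or_odd n <;>
  simp [Int.negOnePow_even, Int.negOnePow_odd, hm, hn] <;> abel

variable (𝓐 f d) in
/-- The dg category `MF^ℤ(f)` of graded matrix factorizations. -/
def dgCategory : DGCategory.{u, u + 1, u} k where
  Obj := GradedMF 𝓐 f d
  hom := homComplex
  id F := (⟨LinearMap.id, F.id_mem_homDeg⟩ : homDeg F F 0)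
  comp h := compMap h
  d_id F := by
    refine (homComplex_d_apply F F 0 1 rfl _).trans (Subtype.ext ?_)
    change F.s ∘ₗ LinearMap.id - (0 : ℤ).negOnePow • (LinearMap.id ∘ₗ F.s) = 0
    simp
  leibniz {F G H m n p} h ψ φ :=
    (homComplex_d_apply F H p (p + 1) rfl (compMap h ψ φ)).trans
      ((diff_compMap h ψ φ).trans (congrArg₂ (· + ·)
        (congrArg (fun t => compMap (F := F) (show m + 1 + n = p + 1 by omega) t φ)
          (homComplex_d_apply G H m (m + 1) rfl ψ).symm)
        (congrArg (fun t => m.negOnePow •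
            compMap (H := H) (show m + (n + 1) = p + 1 by omega) ψ t)
          (homComplex_d_apply F G n (n + 1) rfl φ).symm)))
  id_comp _ := rfl
  comp_id _ := rfl
  assoc _ _ _ _ _ _ _ := rfl

end GradedMF

/-! ### Tensor products of graded matrix factorizations -/

section Tensor

variable {𝓐 : ℤ → Submodule k A} [SetLike.GradedMonoid 𝓐]
  {A' : Type u} [CommRing A'] [Algebra k A'] {𝓐' : ℤ → Submodule k A'}
  [SetLike.GradedMonoid 𝓐']
  {B : Type u} [CommRing B] [Algebra k B] [Algebra A B] [IsScalarTower k A B]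
  [Algebra A' B] [IsScalarTower k A' B] {𝓑 : ℤ → Submodule k B} [SetLike.GradedMonoid 𝓑]

namespace GradedFree

/-- The external tensor product `(B ⊗ M) ⊗_B (B ⊗ M')` of modules over `A` and `A'`. If
`B = A ⊗ₖ A'`, this is the tensor product of `M` and `M'` over `k`. -/
abbrev ext (hB : IsGradedAlgebraMap 𝓐 𝓑) (hB' : IsGradedAlgebraMap 𝓐' 𝓑)
    (M : GradedFree 𝓐) (M' : GradedFree 𝓐') : GradedFree 𝓑 :=
  tensor (baseChange hB M) (baseChange hB' M')

variable (hB : IsGradedAlgebraMap 𝓐 𝓑) (hB' : IsGradedAlgebraMap 𝓐' 𝓑)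
  {M N P : GradedFree 𝓐} {M' N' P' : GradedFree 𝓐'}

/-- The map `g ⊗ g'` of external tensor products. -/
def extMap (g : M →ₗ[A] N) (g' : M' →ₗ[A'] N') : ext hB hB' M M' →ₗ[B] ext hB hB' N N' :=
  tensorHom (baseChangeHom hB g) (baseChangeHom hB' g')

theorem extMap_mem_gr {g : M →ₗ[A] N} {g' : M' →ₗ[A'] N'} {s t r : ℤ} (h : s + t = r)
    (hg : g ∈ gr M N s) (hg' : g' ∈ gr M' N' t) :
    extMap hB hB' g g' ∈ gr (ext hB hB' M M') (ext hB hB' N N') r :=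
  tensorHom_mem_gr h (baseChangeHom_mem_gr hB hg) (baseChangeHom_mem_gr hB' hg')

theorem extMap_apply (g : N →ₗ[A] P) (g' : N' →ₗ[A'] P') (h : M →ₗ[A] N) (h' : M' →ₗ[A'] N')
    (x : ext hB hB' M M') :
    extMap hB hB' g g' (extMap hB hB' h h' x) = extMap hB hB' (g ∘ₗ h) (g' ∘ₗ h') x := by
  have e1 : baseChangeHom hB (g ∘ₗ h) = baseChangeHom hB g ∘ₗ baseChangeHom hB h :=
    LinearMap.baseChange_comp h g
  have e2 : baseChangeHom hB' (g' ∘ₗ h') = baseChangeHom hB' g' ∘ₗ baseChangeHom hB' h' :=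
    LinearMap.baseChange_comp h' g'
  rw [extMap, extMap, extMap, e1, e2]
  exact (LinearMap.congr_fun (TensorProduct.map_comp (baseChangeHom hB g)
    (baseChangeHom hB' g') (baseChangeHom hB h) (baseChangeHom hB' h')) x).symm

theorem extMap_id : extMap hB hB' (LinearMap.id : M →ₗ[A] M) (LinearMap.id : M' →ₗ[A'] M') =
    LinearMap.id := by
  have e1 : baseChangeHom hB (LinearMap.id : M →ₗ[A] M) = LinearMap.id :=
    LinearMap.baseChange_id
  have e2 : baseChangeHom hB' (LinearMap.id : M' →ₗ[A'] M') = LinearMap.id :=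
    LinearMap.baseChange_id
  rw [extMap, e1, e2]
  exact TensorProduct.map_id

theorem extMap_add_left (g h : M →ₗ[A] N) (g' : M' →ₗ[A'] N') :
    extMap hB hB' (g + h) g' = extMap hB hB' g g' + extMap hB hB' h g' := by
  have e1 : baseChangeHom hB (g + h) = baseChangeHom hB g + baseChangeHom hB h :=
    LinearMap.baseChange_add g h
  rw [extMap, e1]
  exact TensorProduct.map_add_left _ _ _

theorem extMap_smul_left (c : A) (g : M →ₗ[A] N) (g' : M' →ₗ[A'] N') :
    extMap hB hB' (c • g) g' = algebraMap A B c • extMap hB hB' g g' := by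
  have e1 : baseChangeHom hB (c • g) = algebraMap A B c • baseChangeHom hB g :=
    (LinearMap.baseChange_smul c g).trans (algebraMap_smul B c (g.baseChange B)).symm
  rw [extMap, e1]
  exact TensorProduct.map_smul_left _ _ _

theorem extMap_smul_right (c : A') (g : M →ₗ[A] N) (g' : M' →ₗ[A'] N') :
    extMap hB hB' g (c • g') = algebraMap A' B c • extMap hB hB' g g' := by
  have e1 : baseChangeHom hB' (c • g') = algebraMap A' B c • baseChangeHom hB' g' :=
    (LinearMap.baseChange_smul c g').trans (algebraMap_smul B c (g'.baseChange B)).symm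
  rw [extMap, e1]
  exact TensorProduct.map_smul_right _ _ _

theorem extMap_zero_left (g' : M' →ₗ[A'] N') :
    extMap hB hB' (0 : M →ₗ[A] N) g' = 0 := by
  have h := extMap_smul_left hB hB' (0 : A) (0 : M →ₗ[A] N) g'
  rwa [zero_smul, map_zero, zero_smul] at h

theorem extMap_neg_left (g : M →ₗ[A] N) (g' : M' →ₗ[A'] N') :
    extMap hB hB' (-g) g' = -extMap hB hB' g g' := by
  refine eq_neg_of_add_eq_zero_left ?_
  rw [← extMap_add_left, neg_add_cancel, extMap_zero_left]

theorem extMap_sub_left (g h : M →ₗ[A] N) (g' : M' →ₗ[A'] N') :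
    extMap hB hB' (g - h) g' = extMap hB hB' g g' - extMap hB hB' h g' := by
  rw [sub_eq_add_neg, extMap_add_left, extMap_neg_left, sub_eq_add_neg]

theorem extMap_base_smul_left (c : k) (g : M →ₗ[A] N) (g' : M' →ₗ[A'] N') :
    extMap hB hB' (c • g) g' = c • extMap hB hB' g g' := by
  rw [← algebraMap_smul A c g, extMap_smul_left, ← IsScalarTower.algebraMap_apply,
    algebraMap_smul]

end GradedFree

namespace GradedMF

variable {f : A} {f' : A'} {d : ℤ} (hB : IsGradedAlgebraMap 𝓐 𝓑)
  (hB' : IsGradedAlgebraMap 𝓐' 𝓑)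

/-- The tensor product of graded matrix factorizations of `f` and `f'`, with
`(F0 ⊗ F0') ⊕ (F1 ⊗ F1')(d)` in even degree, `(F0 ⊗ F1') ⊕ (F1 ⊗ F0')` in odd degree, and maps
`s0 = [[1 ⊗ s0', s1 ⊗ 1], [-s0 ⊗ 1, 1 ⊗ s1']]` and
`s1 = [[1 ⊗ s1', -s1 ⊗ 1], [s0 ⊗ 1, 1 ⊗ s0']]`. -/
abbrev tensor (F : GradedMF 𝓐 f d) (F' : GradedMF 𝓐' f' d) :
    GradedMF 𝓑 (algebraMap A B f + algebraMap A' B f') d where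
  F0 := (ext hB hB' F.F0 F'.F0).prod ((ext hB hB' F.F1 F'.F1).twist d)
  F1 := (ext hB hB' F.F0 F'.F1).prod (ext hB hB' F.F1 F'.F0)
  s0 := ((extMap hB hB' LinearMap.id F'.s0).coprod (extMap hB hB' F.s1 LinearMap.id)).prod
    ((-extMap hB hB' F.s0 LinearMap.id).coprod (extMap hB hB' LinearMap.id F'.s1))
  s1 := ((extMap hB hB' LinearMap.id F'.s1).coprod (-extMap hB hB' F.s1 LinearMap.id)).prod
    ((extMap hB hB' F.s0 LinearMap.id).coprod (extMap hB hB' LinearMap.id F'.s0))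
  s0_mem n x hx := by
    have h1 := extMap_mem_gr hB hB' (zero_add d) (id_mem_gr F.F0) F'.s0_mem _ _ hx.1
    have h2 := extMap_mem_gr hB hB' (add_zero 0) F.s1_mem (id_mem_gr F'.F1) _ _ hx.2
    have h3 := extMap_mem_gr hB hB' (add_zero d) F.s0_mem (id_mem_gr F'.F0) _ _ hx.1
    have h4 := extMap_mem_gr hB hB' (add_zero 0) (id_mem_gr F.F1) F'.s1_mem _ _ hx.2
    rw [add_zero] at h2 h4
    exact ⟨add_mem h1 h2, add_mem (neg_mem h3) h4⟩
  s1_mem n x hx := by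
    have h1 := extMap_mem_gr hB hB' (add_zero 0) (id_mem_gr F.F0) F'.s1_mem _ _ hx.1
    have h2 := extMap_mem_gr hB hB' (add_zero 0) F.s1_mem (id_mem_gr F'.F0) _ _ hx.2
    have h3 := extMap_mem_gr hB hB' (add_zero d) F.s0_mem (id_mem_gr F'.F1) _ _ hx.1
    have h4 := extMap_mem_gr hB hB' (zero_add d) (id_mem_gr F.F1) F'.s0_mem _ _ hx.2
    have e : n + d = n + 0 + d := by rw [add_zero]
    rw [e] at h3 h4
    exact ⟨add_mem h1 (neg_mem h2), add_mem h3 h4⟩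
  s0_s1 := by
    refine LinearMap.ext fun x => Prod.ext ?_ ?_
    · change extMap hB hB' LinearMap.id F'.s0 (extMap hB hB' LinearMap.id F'.s1 x.1 +
          -extMap hB hB' F.s1 LinearMap.id x.2) +
        extMap hB hB' F.s1 LinearMap.id (extMap hB hB' F.s0 LinearMap.id x.1 +
          extMap hB hB' LinearMap.id F'.s0 x.2) =
        (algebraMap A B f + algebraMap A' B f') • x.1
      simp only [map_add, map_neg, extMap_apply, LinearMap.id_comp, LinearMap.comp_id, F.s1_s0,
        F'.s0_s1, extMap_smul_left, extMap_smul_right, extMap_id, add_smul, LinearMap.smul_apply,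
        LinearMap.id_apply]
      abel
    · change -extMap hB hB' F.s0 LinearMap.id (extMap hB hB' LinearMap.id F'.s1 x.1 +
          -extMap hB hB' F.s1 LinearMap.id x.2) +
        extMap hB hB' LinearMap.id F'.s1 (extMap hB hB' F.s0 LinearMap.id x.1 +
          extMap hB hB' LinearMap.id F'.s0 x.2) =
        (algebraMap A B f + algebraMap A' B f') • x.2
      simp only [map_add, map_neg, extMap_apply, LinearMap.id_comp, LinearMap.comp_id, F.s0_s1,
        F'.s1_s0, extMap_smul_left, extMap_smul_right, extMap_id, add_smul, LinearMap.smul_apply,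
        LinearMap.id_apply]
      abel
  s1_s0 := by
    refine LinearMap.ext fun x => Prod.ext ?_ ?_
    · change extMap hB hB' LinearMap.id F'.s1 (extMap hB hB' LinearMap.id F'.s0 x.1 +
          extMap hB hB' F.s1 LinearMap.id x.2) +
        -extMap hB hB' F.s1 LinearMap.id (-extMap hB hB' F.s0 LinearMap.id x.1 +
          extMap hB hB' LinearMap.id F'.s1 x.2) =
        (algebraMap A B f + algebraMap A' B f') • x.1
      simp only [map_add, map_neg, extMap_apply, LinearMap.id_comp, LinearMap.comp_id, F.s1_s0,
        F'.s1_s0, extMap_smul_left, extMap_smul_right, extMap_id, add_smul, LinearMap.smul_apply,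
        LinearMap.id_apply]
      abel
    · change extMap hB hB' F.s0 LinearMap.id (extMap hB hB' LinearMap.id F'.s0 x.1 +
          extMap hB hB' F.s1 LinearMap.id x.2) +
        extMap hB hB' LinearMap.id F'.s0 (-extMap hB hB' F.s0 LinearMap.id x.1 +
          extMap hB hB' LinearMap.id F'.s1 x.2) =
        (algebraMap A B f + algebraMap A' B f') • x.2
      simp only [map_add, map_neg, extMap_apply, LinearMap.id_comp, LinearMap.comp_id, F.s0_s1,
        F'.s0_s1, extMap_smul_left, extMap_smul_right, extMap_id, add_smul, LinearMap.smul_apply,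
        LinearMap.id_apply]
      abel

variable {F G H : GradedMF 𝓐 f d} (F' : GradedMF 𝓐' f' d)

/-- The map `α ⊗ id` for `α` of degree `m`, with the sign
`(α ⊗ id)(x ⊗ x') = (-1)^(|α|(|x'| + 1)) α(x) ⊗ x'`, where `|x'|` is `0` on `F0'` and `1` on
`F1'`. This is the Koszul-type sign belonging to the differential
`x ⊗ x' ↦ x ⊗ s'(x') - (-1)^|x'| s(x) ⊗ x'` of the tensor product. -/
def tensorMap (m : ℤ) (α : F.Total →ₗ[A] G.Total) :
    (tensor hB hB' F F').Total →ₗ[B] (tensor hB hB' G F').Total :=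
  (((m.negOnePow • extMap hB hB' (c00 α) LinearMap.id).prodMap
        (extMap hB hB' (c11 α) LinearMap.id)).coprod
      ((m.negOnePow • extMap hB hB' (c01 α) LinearMap.id ∘ₗ LinearMap.snd B _ _).prod
        (extMap hB hB' (c10 α) LinearMap.id ∘ₗ LinearMap.fst B _ _))).prod
    (((extMap hB hB' (c01 α) LinearMap.id ∘ₗ LinearMap.snd B _ _).prod
        (m.negOnePow • extMap hB hB' (c10 α) LinearMap.id ∘ₗ LinearMap.fst B _ _)).coprod
      ((extMap hB hB' (c00 α) LinearMap.id).prodMap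
        (m.negOnePow • extMap hB hB' (c11 α) LinearMap.id)))

theorem tensorMap_apply (m : ℤ) (α : F.Total →ₗ[A] G.Total)
    (a : ext hB hB' F.F0 F'.F0) (b : ext hB hB' F.F1 F'.F1)
    (c : ext hB hB' F.F0 F'.F1) (e : ext hB hB' F.F1 F'.F0) :
    tensorMap hB hB' F' m α ((a, b), (c, e)) =
      ((m.negOnePow • extMap hB hB' (c00 α) LinearMap.id a +
          m.negOnePow • extMap hB hB' (c01 α) LinearMap.id e,
        extMap hB hB' (c11 α) LinearMap.id b + extMap hB hB' (c10 α) LinearMap.id c),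
       (extMap hB hB' (c01 α) LinearMap.id b + extMap hB hB' (c00 α) LinearMap.id c,
        m.negOnePow • extMap hB hB' (c10 α) LinearMap.id a +
          m.negOnePow • extMap hB hB' (c11 α) LinearMap.id e)) := rfl

theorem tensor_s_apply (F : GradedMF 𝓐 f d)
    (a : ext hB hB' F.F0 F'.F0) (b : ext hB hB' F.F1 F'.F1)
    (c : ext hB hB' F.F0 F'.F1) (e : ext hB hB' F.F1 F'.F0) :
    (tensor hB hB' F F').s ((a, b), (c, e)) =
      ((extMap hB hB' LinearMap.id F'.s1 c + -extMap hB hB' F.s1 LinearMap.id e,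
        extMap hB hB' F.s0 LinearMap.id c + extMap hB hB' LinearMap.id F'.s0 e),
       (extMap hB hB' LinearMap.id F'.s0 a + extMap hB hB' F.s1 LinearMap.id b,
        -extMap hB hB' F.s0 LinearMap.id a + extMap hB hB' LinearMap.id F'.s1 b)) := rfl

theorem extMap_mem_gr_right {M N : GradedFree 𝓐} {g : M →ₗ[A] N} {t : ℤ} (hg : g ∈ gr M N t)
    (M' : GradedFree 𝓐') :
    extMap hB hB' g LinearMap.id ∈ gr (ext hB hB' M M') (ext hB hB' N M') t :=
  extMap_mem_gr hB hB' (add_zero t) hg (id_mem_gr M')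

theorem tensorMap_mem_homDeg {m : ℤ} {α : F.Total →ₗ[A] G.Total} (hα : α ∈ homDeg F G m) :
    tensorMap hB hB' F' m α ∈ homDeg (tensor hB hB' F F') (tensor hB hB' G F') m := by
  obtain ⟨l, rfl | rfl⟩ := Int.even_or_odd' m
  · obtain ⟨h1, h2, h3, h4⟩ := (mem_homDeg_even l).1 hα
    have hε : (2 * l).negOnePow = 1 := Int.negOnePow_two_mul l
    rw [mem_homDeg_even]
    refine ⟨?_, ?_, ?_, ?_⟩
    · rintro n ⟨a, b⟩ ⟨ha, hb⟩
      have k1 := extMap_mem_gr_right hB hB' h1 F'.F0 n a ha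
      have k2 := extMap_mem_gr_right hB hB' h2 F'.F1 (n + d) b hb
      rw [add_right_comm] at k2
      change (2 * l).negOnePow • extMap hB hB' (c00 α) LinearMap.id a +
          (2 * l).negOnePow • extMap hB hB' (c01 α) LinearMap.id 0 ∈ _ ∧
        extMap hB hB' (c11 α) LinearMap.id b + extMap hB hB' (c10 α) LinearMap.id 0 ∈ _
      rw [hε, one_smul, one_smul, map_zero, map_zero, add_zero, add_zero]
      exact ⟨k1, k2⟩
    · rintro n ⟨c, e⟩ ⟨hc, he⟩
      have k1 := extMap_mem_gr_right hB hB' h1 F'.F1 n c hc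
      have k2 := extMap_mem_gr_right hB hB' h2 F'.F0 n e he
      change extMap hB hB' (c01 α) LinearMap.id 0 + extMap hB hB' (c00 α) LinearMap.id c ∈ _ ∧
        (2 * l).negOnePow • extMap hB hB' (c10 α) LinearMap.id 0 +
          (2 * l).negOnePow • extMap hB hB' (c11 α) LinearMap.id e ∈ _
      rw [hε, one_smul, one_smul, map_zero, map_zero, zero_add, zero_add]
      exact ⟨k1, k2⟩
    · refine LinearMap.ext fun ⟨a, b⟩ => Prod.ext ?_ ?_
      · change extMap hB hB' (c01 α) LinearMap.id b + extMap hB hB' (c00 α) LinearMap.id 0 = 0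
        rw [h4, extMap_zero_left, map_zero, LinearMap.zero_apply, add_zero]
      · change (2 * l).negOnePow • extMap hB hB' (c10 α) LinearMap.id a +
          (2 * l).negOnePow • extMap hB hB' (c11 α) LinearMap.id 0 = 0
        rw [h3, extMap_zero_left, map_zero, LinearMap.zero_apply, smul_zero, add_zero]
    · refine LinearMap.ext fun ⟨c, e⟩ => Prod.ext ?_ ?_
      · change (2 * l).negOnePow • extMap hB hB' (c00 α) LinearMap.id 0 +
          (2 * l).negOnePow • extMap hB hB' (c01 α) LinearMap.id e = 0
        rw [h4, extMap_zero_left, map_zero, LinearMap.zero_apply, smul_zero, add_zero]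
      · change extMap hB hB' (c11 α) LinearMap.id 0 + extMap hB hB' (c10 α) LinearMap.id c = 0
        rw [h3, extMap_zero_left, map_zero, LinearMap.zero_apply, add_zero]
  · obtain ⟨h1, h2, h3, h4⟩ := (mem_homDeg_odd l).1 hα
    have hε : (2 * l + 1).negOnePow = -1 := Int.negOnePow_two_mul_add_one l
    rw [mem_homDeg_odd]
    refine ⟨?_, ?_, ?_, ?_⟩
    · rintro n ⟨a, b⟩ ⟨ha, hb⟩
      have k1 := extMap_mem_gr_right hB hB' h1 F'.F0 n a ha
      have k2 := extMap_mem_gr_right hB hB' h2 F'.F1 (n + d) b hb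
      rw [show n + d + l * d = n + (l + 1) * d by ring] at k2
      change extMap hB hB' (c01 α) LinearMap.id b + extMap hB hB' (c00 α) LinearMap.id 0 ∈ _ ∧
        (2 * l + 1).negOnePow • extMap hB hB' (c10 α) LinearMap.id a +
          (2 * l + 1).negOnePow • extMap hB hB' (c11 α) LinearMap.id 0 ∈ _
      rw [hε, map_zero, map_zero, smul_zero, add_zero, add_zero, Units.neg_smul, one_smul]
      exact ⟨k2, neg_mem k1⟩
    · rintro n ⟨c, e⟩ ⟨hc, he⟩
      have k1 := extMap_mem_gr_right hB hB' h1 F'.F1 n c hc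
      have k2 := extMap_mem_gr_right hB hB' h2 F'.F0 n e he
      rw [show n + (l + 1) * d = n + l * d + d by ring] at k1
      change (2 * l + 1).negOnePow • extMap hB hB' (c00 α) LinearMap.id 0 +
          (2 * l + 1).negOnePow • extMap hB hB' (c01 α) LinearMap.id e ∈ _ ∧
        extMap hB hB' (c11 α) LinearMap.id 0 + extMap hB hB' (c10 α) LinearMap.id c ∈ _
      rw [hε, map_zero, map_zero, smul_zero, zero_add, zero_add, Units.neg_smul, one_smul]
      exact ⟨neg_mem k2, k1⟩
    · refine LinearMap.ext fun ⟨a, b⟩ => Prod.ext ?_ ?_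
      · change (2 * l + 1).negOnePow • extMap hB hB' (c00 α) LinearMap.id a +
          (2 * l + 1).negOnePow • extMap hB hB' (c01 α) LinearMap.id 0 = 0
        rw [h3, extMap_zero_left, map_zero, LinearMap.zero_apply, smul_zero, add_zero]
      · change extMap hB hB' (c11 α) LinearMap.id b + extMap hB hB' (c10 α) LinearMap.id 0 = 0
        rw [h4, extMap_zero_left, map_zero, LinearMap.zero_apply, add_zero]
    · refine LinearMap.ext fun ⟨c, e⟩ => Prod.ext ?_ ?_
      · change extMap hB hB' (c01 α) LinearMap.id 0 + extMap hB hB' (c00 α) LinearMap.id c = 0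
        rw [h3, extMap_zero_left, map_zero, LinearMap.zero_apply, add_zero]
      · change (2 * l + 1).negOnePow • extMap hB hB' (c10 α) LinearMap.id 0 +
          (2 * l + 1).negOnePow • extMap hB hB' (c11 α) LinearMap.id e = 0
        rw [h4, extMap_zero_left, map_zero, LinearMap.zero_apply, smul_zero, add_zero]

theorem tensorMap_diff {m : ℤ} (α : F.Total →ₗ[A] G.Total) :
    (tensor hB hB' G F').s ∘ₗ tensorMap hB hB' F' m α -
      m.negOnePow • (tensorMap hB hB' F' m α ∘ₗ (tensor hB hB' F F').s) =
    tensorMap hB hB' F' (m + 1) (G.s ∘ₗ α - m.negOnePow • (α ∘ₗ F.s)) := by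
  refine LinearMap.ext fun ⟨⟨a, b⟩, ⟨c, e⟩⟩ => ?_
  have sF : c00 F.s = 0 ∧ c11 F.s = 0 ∧ c10 F.s = F.s0 ∧ c01 F.s = F.s1 :=
    ⟨by ext; simp [c00, s], by ext; simp [c11, s], rfl, rfl⟩
  have sG : c00 G.s = 0 ∧ c11 G.s = 0 ∧ c10 G.s = G.s0 ∧ c01 G.s = G.s1 :=
    ⟨by ext; simp [c00, s], by ext; simp [c11, s], rfl, rfl⟩
  obtain ⟨f1, f2, f3, f4⟩ := sF
  obtain ⟨g1, g2, g3, g4⟩ := sG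
  have d00 : c00 (G.s ∘ₗ α - m.negOnePow • (α ∘ₗ F.s)) =
      G.s1 ∘ₗ c10 α - m.negOnePow • (c01 α ∘ₗ F.s0) := by
    change c00 (G.s ∘ₗ α) - m.negOnePow • c00 (α ∘ₗ F.s) = _
    rw [c00_comp, c00_comp, f1, f3, g1, g4, LinearMap.zero_comp, LinearMap.comp_zero, zero_add,
      zero_add]
  have d01 : c01 (G.s ∘ₗ α - m.negOnePow • (α ∘ₗ F.s)) =
      G.s1 ∘ₗ c11 α - m.negOnePow • (c00 α ∘ₗ F.s1) := by
    change c01 (G.s ∘ₗ α) - m.negOnePow • c01 (α ∘ₗ F.s) = _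
    rw [c01_comp, c01_comp, f2, f4, g1, g4, LinearMap.zero_comp, LinearMap.comp_zero, zero_add,
      add_zero]
  have d10 : c10 (G.s ∘ₗ α - m.negOnePow • (α ∘ₗ F.s)) =
      G.s0 ∘ₗ c00 α - m.negOnePow • (c11 α ∘ₗ F.s0) := by
    change c10 (G.s ∘ₗ α) - m.negOnePow • c10 (α ∘ₗ F.s) = _
    rw [c10_comp, c10_comp, f1, f3, g2, g3, LinearMap.zero_comp, LinearMap.comp_zero, zero_add,
      add_zero]
  have d11 : c11 (G.s ∘ₗ α - m.negOnePow • (α ∘ₗ F.s)) =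
      G.s0 ∘ₗ c01 α - m.negOnePow • (c10 α ∘ₗ F.s1) := by
    change c11 (G.s ∘ₗ α) - m.negOnePow • c11 (α ∘ₗ F.s) = _
    rw [c11_comp, c11_comp, f2, f4, g2, g3, LinearMap.zero_comp, LinearMap.comp_zero, add_zero,
      add_zero]
  rw [LinearMap.sub_apply, LinearMap.smul_apply, LinearMap.comp_apply, LinearMap.comp_apply,
    tensorMap_apply, tensorMap_apply, tensor_s_apply, tensor_s_apply, tensorMap_apply, d00, d01,
    d10, d11, Int.negOnePow_succ]
  obtain hm | hm := Int.even_or_odd m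
  · rw [Int.negOnePow_even m hm]
    refine Prod.ext (Prod.ext ?_ ?_) (Prod.ext ?_ ?_)
    all_goals
      simp only [one_smul, Units.neg_smul, Prod.mk_sub_mk, map_add, map_neg, extMap_apply,
        LinearMap.id_comp, LinearMap.comp_id, extMap_sub_left, LinearMap.sub_apply]
      abel
  · rw [Int.negOnePow_odd m hm]
    refine Prod.ext (Prod.ext ?_ ?_) (Prod.ext ?_ ?_)
    all_goals
      simp only [one_smul, neg_neg, Units.neg_smul, Prod.mk_sub_mk, Prod.neg_mk, sub_neg_eq_add,
        map_add, map_neg, extMap_apply, LinearMap.id_comp, LinearMap.comp_id,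
        extMap_add_left, LinearMap.add_apply]
      abel

theorem tensorMap_id : tensorMap hB hB' F' 0 (LinearMap.id : F.Total →ₗ[A] F.Total) =
    LinearMap.id := by
  have e00 : c00 (LinearMap.id : F.Total →ₗ[A] F.Total) = LinearMap.id := rfl
  have e11 : c11 (LinearMap.id : F.Total →ₗ[A] F.Total) = LinearMap.id := rfl
  have e10 : c10 (LinearMap.id : F.Total →ₗ[A] F.Total) = 0 := rfl
  have e01 : c01 (LinearMap.id : F.Total →ₗ[A] F.Total) = 0 := rfl
  refine LinearMap.ext fun ⟨⟨a, b⟩, ⟨c, e⟩⟩ => ?_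
  rw [tensorMap_apply, e00, e11, e10, e01, extMap_zero_left, extMap_zero_left, extMap_id,
    extMap_id, Int.negOnePow_zero]
  refine Prod.ext (Prod.ext ?_ ?_) (Prod.ext ?_ ?_)
  all_goals
    simp only [one_smul, extMap_id, extMap_zero_left, LinearMap.id_apply, LinearMap.zero_apply,
      add_zero, zero_add]

theorem tensorMap_comp {m n p : ℤ} (h : m + n = p) (ψ : G.Total →ₗ[A] H.Total)
    (φ : F.Total →ₗ[A] G.Total) :
    tensorMap hB hB' F' p (ψ ∘ₗ φ) = tensorMap hB hB' F' m ψ ∘ₗ tensorMap hB hB' F' n φ := by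
  subst h
  refine LinearMap.ext fun ⟨⟨a, b⟩, ⟨c, e⟩⟩ => ?_
  rw [LinearMap.comp_apply, tensorMap_apply, tensorMap_apply, tensorMap_apply, c00_comp, c01_comp,
    c10_comp, c11_comp, Int.negOnePow_add]
  obtain hm | hm := Int.even_or_odd m <;> obtain hn | hn := Int.even_or_odd n
  all_goals
    simp only [Int.negOnePow_even, Int.negOnePow_odd, hm, hn]
    refine Prod.ext (Prod.ext ?_ ?_) (Prod.ext ?_ ?_)
    all_goals
      simp only [one_smul, mul_one, mul_neg, neg_neg, Units.neg_smul, map_add, map_neg,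
        extMap_apply, LinearMap.id_comp, extMap_add_left, LinearMap.add_apply]
      abel

theorem tensorMap_add (m : ℤ) (α β : F.Total →ₗ[A] G.Total) :
    tensorMap hB hB' F' m (α + β) = tensorMap hB hB' F' m α + tensorMap hB hB' F' m β := by
  have e00 : c00 (α + β) = c00 α + c00 β := rfl
  have e01 : c01 (α + β) = c01 α + c01 β := rfl
  have e10 : c10 (α + β) = c10 α + c10 β := rfl
  have e11 : c11 (α + β) = c11 α + c11 β := rfl
  refine LinearMap.ext fun ⟨⟨a, b⟩, ⟨c, e⟩⟩ => ?_
  rw [LinearMap.add_apply, tensorMap_apply, tensorMap_apply, tensorMap_apply, e00, e01, e10, e11]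
  refine Prod.ext (Prod.ext ?_ ?_) (Prod.ext ?_ ?_)
  all_goals
    simp only [extMap_add_left, LinearMap.add_apply, smul_add, Prod.mk_add_mk]
    abel

theorem tensorMap_smul (m : ℤ) (r : k) (α : F.Total →ₗ[A] G.Total) :
    tensorMap hB hB' F' m (r • α) = r • tensorMap hB hB' F' m α := by
  have e00 : c00 (r • α) = r • c00 α := rfl
  have e01 : c01 (r • α) = r • c01 α := rfl
  have e10 : c10 (r • α) = r • c10 α := rfl
  have e11 : c11 (r • α) = r • c11 α := rfl
  refine LinearMap.ext fun ⟨⟨a, b⟩, ⟨c, e⟩⟩ => ?_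
  rw [LinearMap.smul_apply, tensorMap_apply, tensorMap_apply, e00, e01, e10, e11]
  refine Prod.ext (Prod.ext ?_ ?_) (Prod.ext ?_ ?_)
  all_goals
    simp only [extMap_base_smul_left, LinearMap.smul_apply, smul_add, Prod.smul_mk,
      smul_comm m.negOnePow r]

/-- `α ↦ α ⊗ id` on morphisms of degree `m`, as a `k`-linear map. -/
def tensorMapₗ (F G : GradedMF 𝓐 f d) (m : ℤ) :
    homDeg F G m →ₗ[k] homDeg (tensor hB hB' F F') (tensor hB hB' G F') m where
  toFun α := ⟨tensorMap hB hB' F' m α.1, tensorMap_mem_homDeg hB hB' F' α.2⟩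
  map_add' α β := Subtype.ext (tensorMap_add hB hB' F' m α.1 β.1)
  map_smul' r α := Subtype.ext (tensorMap_smul hB hB' F' m r α.1)

/-- The dg functor `- ⊗ F'`, given by `F ↦ F ⊗ F'` on objects and `α ↦ α ⊗ id` on morphisms. -/
def tensorRight : DGFunctor (dgCategory 𝓐 f d)
    (dgCategory 𝓑 (algebraMap A B f + algebraMap A' B f') d) where
  obj F := tensor hB hB' F F'
  map F G :=
    { f := fun m => ModuleCat.ofHom (tensorMapₗ hB hB' F' F G m)
      comm' := fun i j hij => by
        have hij' : i + 1 = j := hij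
        subst hij'
        refine ModuleCat.hom_ext (LinearMap.ext fun α => ?_)
        refine (homComplex_d_apply _ _ i (i + 1) rfl (tensorMapₗ hB hB' F' F G i α)).trans ?_
        refine Eq.trans ?_ (congrArg (tensorMapₗ hB hB' F' F G (i + 1))
          (homComplex_d_apply F G i (i + 1) rfl α).symm)
        exact Subtype.ext (tensorMap_diff hB hB' F' α.1) }
  map_id F := Subtype.ext (tensorMap_id hB hB' F')
  map_comp h ψ φ := Subtype.ext (tensorMap_comp hB hB' F' h ψ.1 φ.1)

end GradedMF

end Tensor

end Graded

/-! ### Polynomial rings and the functor `K` -/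

section Knorrer

open MvPolynomial

variable {k : Type u} [Field k]

instance {σ : Type} (w : σ → ℤ) : SetLike.GradedMonoid (weightedHomogeneousSubmodule k w) :=
  WeightedHomogeneousSubmodule.gradedMonoid

/-- The dg category `MF^ℤ(f)` for `f` in the polynomial ring `k[xᵢ : i ∈ σ]`, graded by giving `xᵢ`
the degree `w i`. -/
abbrev MFZ {σ : Type} (w : σ → ℤ) (f : MvPolynomial σ k) (d : ℤ) : DGCategory.{u, u + 1, u} k :=
  GradedMF.dgCategory (weightedHomogeneousSubmodule k w) f d

/-- The object `k[u,v] ⇄ k[u,v](l - d)` of `MF^ℤ(uv)`, with `s0 = u` and `s1 = v`, where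
`u = X 0` has degree `l` and `v = X 1` has degree `d - l`. -/
def knorrerMF (k : Type u) [Field k] (d l : ℤ) :
    GradedMF (weightedHomogeneousSubmodule k ![l, d - l])
      (X 0 * X 1 : MvPolynomial (Fin 2) k) d where
  F0 := GradedFree.self _
  F1 := (GradedFree.self _).twist (l - d)
  s0 := (X 0 : MvPolynomial (Fin 2) k) • LinearMap.id
  s1 := (X 1 : MvPolynomial (Fin 2) k) • LinearMap.id
  s0_mem n x hx := by
    have h : IsWeightedHomogeneous ![l, d - l] (X 0 * x) (l + n) :=
      (isWeightedHomogeneous_X k ![l, d - l] 0).mul hx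
    change IsWeightedHomogeneous ![l, d - l] (X 0 * x) (n + d + (l - d))
    convert h using 1
    ring
  s1_mem n x hx := by
    have h : IsWeightedHomogeneous ![l, d - l] (X 1 * x) (d - l + (n + (l - d))) :=
      (isWeightedHomogeneous_X k ![l, d - l] 1).mul hx
    change IsWeightedHomogeneous ![l, d - l] (X 1 * x) (n + 0)
    convert h using 1
    ring
  s0_s1 := by
    rw [LinearMap.smul_comp, LinearMap.comp_smul, smul_smul]
    rfl
  s1_s0 := by
    rw [LinearMap.smul_comp, LinearMap.comp_smul, smul_smul, mul_comm]
    rfl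

/-- The inclusion `k[xᵢ : i ∈ σ] → k[xᵢ, yⱼ : i ∈ σ, j ∈ τ]` as an algebra structure. -/
abbrev inlAlgebra (k : Type u) [Field k] (σ τ : Type) :
    Algebra (MvPolynomial σ k) (MvPolynomial (σ ⊕ τ) k) :=
  (rename Sum.inl : MvPolynomial σ k →ₐ[k] MvPolynomial (σ ⊕ τ) k).toRingHom.toAlgebra

/-- The inclusion `k[yⱼ : j ∈ τ] → k[xᵢ, yⱼ : i ∈ σ, j ∈ τ]` as an algebra structure. -/
abbrev inrAlgebra (k : Type u) [Field k] (σ τ : Type) :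
    Algebra (MvPolynomial τ k) (MvPolynomial (σ ⊕ τ) k) :=
  (rename Sum.inr : MvPolynomial τ k →ₐ[k] MvPolynomial (σ ⊕ τ) k).toRingHom.toAlgebra

theorem rename_mem_weightedHomogeneousSubmodule {σ τ : Type} (g : σ → τ) (w : τ → ℤ) (i : ℤ)
    (p : MvPolynomial σ k) (hp : p ∈ weightedHomogeneousSubmodule k (w ∘ g) i) :
    rename g p ∈ weightedHomogeneousSubmodule k w i := by
  rw [mem_weightedHomogeneousSubmodule] at hp ⊢
  rw [p.as_sum, map_sum]
  refine IsWeightedHomogeneous.sum _ _ _ fun s hs => ?_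
  rw [rename_monomial]
  refine isWeightedHomogeneous_monomial _ _ _ ?_
  rw [← hp (mem_support_iff.1 hs)]
  rw [Finsupp.weight_apply, Finsupp.weight_apply, Finsupp.sum_mapDomain_index]
  · rfl
  · intro j
    exact zero_smul ℕ _
  · intro j a b
    exact add_smul a b _

/-- The dg functor `K = - ⊗ X : MF^ℤ(f) → MF^ℤ(f + uv)`, where `X` is the matrix factorization
`k[u,v] ⇄ k[u,v](l - d)` of `uv`. -/
def knorrerFunctor {n : ℕ} (w : Fin n → ℤ) (d l : ℤ) (f : MvPolynomial (Fin n) k) :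
    DGFunctor (MFZ w f d)
      (MFZ (Sum.elim w ![l, d - l])
        (rename Sum.inl f + rename Sum.inr (X 0 * X 1 : MvPolynomial (Fin 2) k)) d) :=
  letI := inlAlgebra k (Fin n) (Fin 2)
  letI := inrAlgebra k (Fin n) (Fin 2)
  haveI : IsScalarTower k (MvPolynomial (Fin n) k) (MvPolynomial (Fin n ⊕ Fin 2) k) :=
    .of_algebraMap_eq fun c => (rename Sum.inl).commutes c |>.symm
  haveI : IsScalarTower k (MvPolynomial (Fin 2) k) (MvPolynomial (Fin n ⊕ Fin 2) k) :=
    .of_algebraMap_eq fun c => (rename Sum.inr).commutes c |>.symm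
  GradedMF.tensorRight (𝓐 := weightedHomogeneousSubmodule k w)
    (𝓐' := weightedHomogeneousSubmodule k (![l, d - l] : Fin 2 → ℤ)) (f := f)
    (fun i p hp => rename_mem_weightedHomogeneousSubmodule Sum.inl (Sum.elim w ![l, d - l]) i p hp)
    (fun i p hp => rename_mem_weightedHomogeneousSubmodule Sum.inr (Sum.elim w ![l, d - l]) i p hp)
    (knorrerMF k d l)

end Knorrer

end

noncomputable section

/-! ### Criteria for quasi-equivalences -/

/-! Write `B = Q[u,v]`. Grouping the four summands of `K(F)` by their factor of `X` identifies its
total module with two copies of `B ⊗ F`. The differential becomes the block matrix `(-s, v; u, s)`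
(`koszulEquiv_s`) and `α ⊗ id` becomes block diagonal with entries `±α`, `α`
(`koszulEquiv_tensorMap`).

Morphism complexes. Taking the last block of a morphism and setting `u = v = 0` gives a chain map
`koszulConst` back to `Hom(F, G)`, left inverse to `α ↦ α ⊗ id`; hence `K` is injective on
cohomology. If this constant term of a closed morphism vanishes, its last block lies in `(u, v)`,
and because `v, u` is a regular sequence the closedness equations can be solved for a null-homotopy
(`koszul_exact`). The component of the right bidegree is still a null-homotopy
(`exists_homDeg_boundary`), so every closed morphism is cohomologous to some `α ⊗ id`.

Homotopy retracts. Let `S` be the matrix of the differential of a factorization `E` of `f + uv`, so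
`S² = f + uv`. Setting `u = v = 0` gives `T` with `T² = f`, hence an object `F` over `Q`. The
divided differences `X = (S - S|_{u=0})/u` and `Y = (S - S|_{v=0})/v` produce closed maps `E → K(F)
→ E`. Their composite is homotopic to the identity: by the Leibniz rule `∂S/∂u` is a null-homotopy
of `v` and `∂S/∂v` one of `u`, so anything that commutes with `S` and lies in `(u, v)` is
null-homotopic, and only constant terms matter. For the constant terms `a`, `b` of `X`, `Y`, the
coefficients of `uv` and `v²` in `S²` give `ab + ba ∼ 1` and `b² ∼ 0`, which suffices
(`IsKoszulEval.exists_homotopy`). Thus `E` is a homotopy retract of `K(F)` (`exists_retract`).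

Essential surjectivity. Idempotents split in `[MF(f)]`: a homotopy idempotent lies in a
finite-dimensional algebra, some polynomial in it is a strict idempotent homotopic to it, and a
strict homogeneous idempotent matrix splits through a graded free module because `Q₀ = k`
(`GradedMF.exists_split`). A fully faithful functor out of an idempotent complete category is
essentially surjective once its image has every object as a retract. Positivity of the weights
enters only in this splitting, which takes place over `Q`; over `B` the part of degree `0` can be
larger than `k`, since `|v|` may vanish. -/

/-- A pointwise lift of a linear map along another one becomes linear on a free cover. -/
theorem ModuleCat.exists_epi_of_forall {k : Type u} [Field k] {A X Y : ModuleCat.{u} k}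
    (g : X ⟶ Y) (f : A ⟶ Y) (h : ∀ a : A, ∃ x : X, f a = g x) :
    ∃ (A' : ModuleCat.{u} k) (π : A' ⟶ A) (_ : Epi π) (x : A' ⟶ X), π ≫ f = x ≫ g := by
  choose x hx using h
  refine ⟨ModuleCat.of k (A →₀ k), ModuleCat.ofHom (Finsupp.linearCombination k _root_.id), ?_,
    ModuleCat.ofHom (Finsupp.linearCombination k x), ?_⟩
  · rw [ModuleCat.epi_iff_surjective]
    exact Finsupp.linearCombination_id_surjective k A
  · refine ModuleCat.hom_ext (Finsupp.lhom_ext fun a c => ?_)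
    change f.hom (Finsupp.linearCombination k _root_.id (Finsupp.single a c)) =
      g.hom (Finsupp.linearCombination k x (Finsupp.single a c))
    rw [Finsupp.linearCombination_single, Finsupp.linearCombination_single, map_smul, map_smul]
    exact congrArg (c • ·) (hx a)

/-- A morphism of cochain complexes of vector spaces is a quasi-isomorphism if it is injective and
surjective on cohomology, expressed by elements. -/
theorem quasiIso_of_elements {k : Type u} [Field k] {K L : CochainComplex (ModuleCat.{u} k) ℤ}
    (φ : K ⟶ L)
    (hinj : ∀ m (x : K.X (m + 1)) (y : L.X m), K.d (m + 1) (m + 1 + 1) x = 0 →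
      φ.f (m + 1) x = L.d m (m + 1) y → ∃ z : K.X m, x = K.d m (m + 1) z)
    (hsurj : ∀ m (y : L.X (m + 1)), L.d (m + 1) (m + 1 + 1) y = 0 →
      ∃ (x : K.X (m + 1)) (z : L.X m), K.d (m + 1) (m + 1 + 1) x = 0 ∧
        y = φ.f (m + 1) x + L.d m (m + 1) z) : QuasiIso φ := by
  refine ⟨fun j => ?_⟩
  obtain ⟨m, rfl⟩ : ∃ m, j = m + 1 := ⟨j - 1, by ring⟩
  rw [quasiIsoAt_iff_isIso_homologyMap]
  have hp : (ComplexShape.up ℤ).prev (m + 1) = m := by simp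
  have hn : (ComplexShape.up ℤ).next (m + 1) = m + 1 + 1 := by simp
  have hmono : Mono (HomologicalComplex.homologyMap φ (m + 1)) := by
    rw [HomologicalComplex.mono_homologyMap_iff_up_to_refinements φ m (m + 1) (m + 1 + 1) hp hn]
    intro A x hx y hy
    refine ModuleCat.exists_epi_of_forall _ _ fun a => hinj m (x a) (y a) ?_ ?_
    · exact congrArg (fun t => t.hom a) hx
    · exact congrArg (fun t => t.hom a) hy
  have hepi : Epi (HomologicalComplex.homologyMap φ (m + 1)) := by
    rw [HomologicalComplex.epi_homologyMap_iff_up_to_refinements φ m (m + 1) (m + 1 + 1) hp hn]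
    intro A y hy
    -- Pairs of a cocycle upstairs and a bounding cochain downstairs are packed into one space, so
    -- that both are lifted along a single linear map.
    let P : Submodule k (K.X (m + 1) × L.X m) :=
      LinearMap.ker ((K.d (m + 1) (m + 1 + 1)).hom ∘ₗ LinearMap.fst k _ _)
    let g : P →ₗ[k] L.X (m + 1) :=
      ((φ.f (m + 1)).hom.coprod (L.d m (m + 1)).hom) ∘ₗ P.subtype
    obtain ⟨A', π, hπ, x, hx⟩ := ModuleCat.exists_epi_of_forall (X := ModuleCat.of k P)
      (ModuleCat.ofHom g) y fun a => by
        obtain ⟨x, z, hx, hz⟩ := hsurj m (y a) (congrArg (fun t => t.hom a) hy)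
        exact ⟨⟨(x, z), hx⟩, hz⟩
    refine ⟨A', π, hπ, ModuleCat.ofHom (LinearMap.fst k _ _ ∘ₗ P.subtype ∘ₗ x.hom), ?_,
      ModuleCat.ofHom (LinearMap.snd k _ _ ∘ₗ P.subtype ∘ₗ x.hom), ?_⟩
    · exact ModuleCat.hom_ext (LinearMap.ext fun a => (x.hom a).2)
    · rw [hx]
      rfl
  exact isIso_of_mono_of_epi _

namespace CategoryTheory

/-- A fully faithful functor whose source has split idempotents is essentially surjective as soon
as every object of the target is a retract of an object in the image. -/
theorem Functor.essSurj_of_retract {C D : Type*} [Category C] [Category D] (F : C ⥤ D) [F.Full]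
    [F.Faithful] [IsIdempotentComplete C]
    (h : ∀ Y : D, ∃ (X : C) (i : Y ⟶ F.obj X) (p : F.obj X ⟶ Y), i ≫ p = 𝟙 Y) : F.EssSurj := by
  refine ⟨fun Y => ?_⟩
  obtain ⟨X, i, p, hip⟩ := h Y
  -- `p ≫ i` is idempotent because `i ≫ p = 𝟙`. Its preimage is idempotent by faithfulness, and the
  -- image under `F` of an object splitting it is isomorphic to `Y`, since both split `p ≫ i`.
  obtain ⟨e, he⟩ := F.map_surjective (p ≫ i)
  have hee : e ≫ e = e := F.map_injective (by
    rw [F.map_comp, he, Category.assoc, reassoc_of% hip])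
  obtain ⟨Z, j, q, hjq, hqj⟩ := IsIdempotentComplete.idempotents_split X e hee
  refine ⟨Z, ⟨⟨F.map j ≫ p, i ≫ F.map q, ?_, ?_⟩⟩⟩
  · calc (F.map j ≫ p) ≫ i ≫ F.map q = F.map j ≫ (p ≫ i) ≫ F.map q := by
          simp only [Category.assoc]
      _ = F.map ((j ≫ q) ≫ (j ≫ q)) := by
          rw [← he, ← hqj]; simp only [Functor.map_comp, Category.assoc]
      _ = 𝟙 _ := by rw [hjq, Category.id_comp, F.map_id]
  · calc (i ≫ F.map q) ≫ F.map j ≫ p = i ≫ F.map (q ≫ j) ≫ p := by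
          simp only [Functor.map_comp, Category.assoc]
      _ = 𝟙 _ := by rw [hqj, he, Category.assoc, reassoc_of% hip, hip]

end CategoryTheory

namespace DGCategory

variable {k : Type u} [Field k] {C : DGCategory.{u, v, w} k}

/-- The class of a closed morphism of degree `0` in the homotopy category. -/
def H0.homMk {X Y : C.Obj} (f : (C.hom X Y).X 0) (hf : f ∈ C.cocycles X Y) :
    (⟨X⟩ : H0 C) ⟶ ⟨Y⟩ :=
  (Submodule.Quotient.mk ⟨f, hf⟩ : C.H0Hom X Y)

theorem H0.homMk_surjective {X Y : C.Obj} (φ : (⟨X⟩ : H0 C) ⟶ ⟨Y⟩) :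
    ∃ f hf, φ = H0.homMk f hf := by
  obtain ⟨⟨f, hf⟩, rfl⟩ := Submodule.Quotient.mk_surjective _ φ
  exact ⟨f, hf, rfl⟩

theorem H0.homMk_eq_iff {X Y : C.Obj} {f g : (C.hom X Y).X 0} {hf : f ∈ C.cocycles X Y}
    {hg : g ∈ C.cocycles X Y} :
    H0.homMk f hf = H0.homMk g hg ↔ ∃ h, f - g = (C.hom X Y).d (-1) 0 h := by
  refine (Submodule.Quotient.eq _).trans ?_
  change _ ∈ C.coboundaries X Y ↔ _
  constructor
  · rintro ⟨h, hh⟩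
    exact ⟨h, hh.symm⟩
  · rintro ⟨h, hh⟩
    exact ⟨h, hh.symm⟩

end DGCategory

namespace DGFunctor

open DGCategory

variable {k : Type u} [Field k] {C D : DGCategory.{u, v, w} k} (F : DGFunctor C D)

theorem mapH0_homMk {X Y : C.Obj} (f : (C.hom X Y).X 0) (hf : f ∈ C.cocycles X Y) :
    F.mapH0.map (H0.homMk f hf) = H0.homMk ((F.map X Y).f 0 f) (F.map_mem_cocycles hf) := rfl

/-- The hypothesis is the degree `0` case of the surjectivity condition of `quasiIso_of_elements`,
so one computation with elements serves both for the quasi-isomorphism and for fullness on `H⁰`. The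
faithful case is analogous. -/
theorem mapH0_full (hsurj : ∀ (X Y : C.Obj) (y : (D.hom (F.obj X) (F.obj Y)).X 0),
    (D.hom _ _).d 0 1 y = 0 → ∃ (x : (C.hom X Y).X 0) (z : (D.hom (F.obj X) (F.obj Y)).X (-1)),
      (C.hom X Y).d 0 1 x = 0 ∧ y = (F.map X Y).f 0 x + (D.hom _ _).d (-1) 0 z) :
    F.mapH0.Full := by
  refine ⟨fun {X Y} φ => ?_⟩
  obtain ⟨y, hy, rfl⟩ := H0.homMk_surjective φ
  obtain ⟨x, z, hx, hz⟩ := hsurj X.as Y.as y hy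
  refine ⟨H0.homMk x hx, ?_⟩
  refine (F.mapH0_homMk x hx).trans (H0.homMk_eq_iff.2 ⟨-z, ?_⟩)
  rw [hz, map_neg]
  abel

theorem mapH0_faithful (hinj : ∀ (X Y : C.Obj) (x : (C.hom X Y).X 0)
    (y : (D.hom (F.obj X) (F.obj Y)).X (-1)), (C.hom X Y).d 0 1 x = 0 →
      (F.map X Y).f 0 x = (D.hom _ _).d (-1) 0 y → ∃ z, x = (C.hom X Y).d (-1) 0 z) :
    F.mapH0.Faithful := by
  refine ⟨fun {X Y} φ ψ h => ?_⟩
  obtain ⟨f, hf, rfl⟩ := H0.homMk_surjective φ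
  obtain ⟨g, hg, rfl⟩ := H0.homMk_surjective ψ
  obtain ⟨y, hy⟩ := H0.homMk_eq_iff.1
    (((F.mapH0_homMk f hf).symm.trans h).trans (F.mapH0_homMk g hg))
  have hfg : f - g ∈ C.cocycles X.as Y.as := sub_mem hf hg
  obtain ⟨z, hz⟩ := hinj X.as Y.as (f - g) y hfg (by rw [map_sub]; exact hy)
  exact H0.homMk_eq_iff.2 ⟨z, hz⟩

end DGFunctor

/-! ### The bigrading on a pair of graded free modules -/

section Bigrading

variable {k : Type u} [Field k] {A : Type u} [CommRing A] [Algebra k A]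

/-- The ring `A` as a bigraded ring in which the pieces `(c + 2, n)` and `(c, n + d)` agree and
those with `c` odd vanish. -/
def bideg (𝓐 : ℤ → Submodule k A) (d c n : ℤ) : Submodule k A :=
  if Even c then 𝓐 (n + c / 2 * d) else ⊥

theorem bideg_two_mul (𝓐 : ℤ → Submodule k A) (d j n : ℤ) :
    bideg 𝓐 d (2 * j) n = 𝓐 (n + j * d) := by
  rw [bideg, if_pos (even_two_mul j), Int.mul_ediv_cancel_left _ two_ne_zero]

theorem bideg_two_mul_add_one (𝓐 : ℤ → Submodule k A) (d j n : ℤ) :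
    bideg 𝓐 d (2 * j + 1) n = ⊥ :=
  if_neg (Int.not_even_two_mul_add_one j)

theorem bideg_add_two (𝓐 : ℤ → Submodule k A) (d c n : ℤ) :
    bideg 𝓐 d (c + 2) n = bideg 𝓐 d c (n + d) := by
  obtain ⟨j, rfl | rfl⟩ := Int.even_or_odd' c
  · rw [show 2 * j + 2 = 2 * (j + 1) by ring, bideg_two_mul, bideg_two_mul]
    ring_nf
  · rw [show 2 * j + 1 + 2 = 2 * (j + 1) + 1 by ring, bideg_two_mul_add_one, bideg_two_mul_add_one]

theorem one_mem_bideg (𝓐 : ℤ → Submodule k A) [SetLike.GradedMonoid 𝓐] (d : ℤ) :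
    (1 : A) ∈ bideg 𝓐 d 0 0 := by
  have := bideg_two_mul 𝓐 d 0 0
  simp only [mul_zero, zero_mul, add_zero] at this
  rw [this]
  exact SetLike.one_mem_graded 𝓐

theorem mul_mem_bideg {𝓐 : ℤ → Submodule k A} [SetLike.GradedMonoid 𝓐] {d c n c' n' : ℤ} {x y : A}
    (hx : x ∈ bideg 𝓐 d c n) (hy : y ∈ bideg 𝓐 d c' n') :
    x * y ∈ bideg 𝓐 d (c + c') (n + n') := by
  obtain ⟨i, rfl | rfl⟩ := Int.even_or_odd' c
  · obtain ⟨j, rfl | rfl⟩ := Int.even_or_odd' c'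
    · rw [bideg_two_mul] at hx hy
      rw [← mul_add, bideg_two_mul]
      have := SetLike.mul_mem_graded hx hy
      convert this using 2
      ring
    · rw [bideg_two_mul_add_one, Submodule.mem_bot] at hy
      rw [hy, mul_zero]
      exact zero_mem _
  · rw [bideg_two_mul_add_one, Submodule.mem_bot] at hx
    rw [hx, zero_mul]
    exact zero_mem _

/-- The projection onto a component of the bigrading. -/
def bidegProj (𝓐 : ℤ → Submodule k A) [GradedAlgebra 𝓐] (d c n : ℤ) : A →+ A :=
  if Even c then GradedRing.proj 𝓐 (n + c / 2 * d) else 0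

theorem bidegProj_two_mul (𝓐 : ℤ → Submodule k A) [GradedAlgebra 𝓐] (d j n : ℤ) :
    bidegProj 𝓐 d (2 * j) n = GradedRing.proj 𝓐 (n + j * d) := by
  rw [bidegProj, if_pos (even_two_mul j), Int.mul_ediv_cancel_left _ two_ne_zero]

theorem bidegProj_two_mul_add_one (𝓐 : ℤ → Submodule k A) [GradedAlgebra 𝓐] (d j n : ℤ) :
    bidegProj 𝓐 d (2 * j + 1) n = 0 :=
  if_neg (Int.not_even_two_mul_add_one j)

theorem bidegProj_mem (𝓐 : ℤ → Submodule k A) [GradedAlgebra 𝓐] (d c n : ℤ) (x : A) :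
    bidegProj 𝓐 d c n x ∈ bideg 𝓐 d c n := by
  obtain ⟨j, rfl | rfl⟩ := Int.even_or_odd' c
  · rw [bidegProj_two_mul, bideg_two_mul]
    exact SetLike.coe_mem _
  · rw [bidegProj_two_mul_add_one]
    exact zero_mem _

theorem bidegProj_of_mem {𝓐 : ℤ → Submodule k A} [GradedAlgebra 𝓐] {d c n : ℤ} {x : A}
    (hx : x ∈ bideg 𝓐 d c n) : bidegProj 𝓐 d c n x = x := by
  obtain ⟨j, rfl | rfl⟩ := Int.even_or_odd' c
  · rw [bideg_two_mul] at hx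
    rw [bidegProj_two_mul, GradedRing.proj_apply, DirectSum.decompose_of_mem_same _ hx]
  · rw [bideg_two_mul_add_one, Submodule.mem_bot] at hx
    rw [hx, map_zero]

/-- Only the first factor has to be homogeneous. This is what allows an equation with homogeneous
coefficients and arbitrary unknowns to be projected to a single bidegree. -/
theorem bidegProj_mul_left {𝓐 : ℤ → Submodule k A} [GradedAlgebra 𝓐] {d c n : ℤ} {x : A}
    (hx : x ∈ bideg 𝓐 d c n) (c' n' : ℤ) (y : A) :
    bidegProj 𝓐 d (c + c') (n + n') (x * y) = x * bidegProj 𝓐 d c' n' y := by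
  obtain ⟨i, rfl | rfl⟩ := Int.even_or_odd' c
  · rw [bideg_two_mul] at hx
    obtain ⟨j, rfl | rfl⟩ := Int.even_or_odd' c'
    · rw [← mul_add, bidegProj_two_mul, bidegProj_two_mul, GradedRing.proj_apply,
        GradedRing.proj_apply, show n + n' + (i + j) * d = n + i * d + (n' + j * d) by ring,
        DirectSum.coe_decompose_mul_add_of_left_mem 𝓐 hx]
    · rw [← add_assoc, ← mul_add, bidegProj_two_mul_add_one, bidegProj_two_mul_add_one]
      simp
  · rw [bideg_two_mul_add_one, Submodule.mem_bot] at hx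
    rw [hx, zero_mul, zero_mul, map_zero]

namespace GradedFree

variable {𝓐 : ℤ → Submodule k A}

/-- The bigrading on `M0 ⊕ M1` with `M0` in even and `M1` in odd cohomological degrees, in which the
pieces `(c + 2, n)` and `(c, n + d)` agree. -/
def superDeg (d : ℤ) (M0 M1 : GradedFree 𝓐) (c n : ℤ) : Submodule k (M0 × M1) :=
  if Even c then (M0.deg (n + c / 2 * d)).prod ⊥
  -- The shift `c / 2 + 1` in the odd case makes both `s0`, of degree `d`, and `s1`, of degree `0`,
  -- maps of bidegree `(1, 0)`.
  else (⊥ : Submodule k M0).prod (M1.deg (n + (c / 2 + 1) * d))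

variable {d : ℤ} {M0 M1 N0 N1 : GradedFree 𝓐}

theorem mem_superDeg_even {j n : ℤ} {x : M0 × M1} :
    x ∈ superDeg d M0 M1 (2 * j) n ↔ x.1 ∈ M0.deg (n + j * d) ∧ x.2 = 0 := by
  rw [superDeg, if_pos (even_two_mul j), Int.mul_ediv_cancel_left _ two_ne_zero]
  rfl

theorem mem_superDeg_odd {j n : ℤ} {x : M0 × M1} :
    x ∈ superDeg d M0 M1 (2 * j + 1) n ↔ x.1 = 0 ∧ x.2 ∈ M1.deg (n + (j + 1) * d) := by
  have : (2 * j + 1) / 2 = j := by omega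
  rw [superDeg, if_neg (Int.not_even_two_mul_add_one j), this]
  rfl

/-- A basis which is homogeneous, with `b i` in degree `a i`. -/
def IsHomogeneousBasis {ι : Type*} (M : GradedFree 𝓐) (b : Module.Basis ι A M) (a : ι → ℤ) :
    Prop :=
  ∀ n x, x ∈ M.deg n ↔ ∀ i, b.repr x i ∈ 𝓐 (n - a i)

theorem IsHomogeneousBasis.mem [SetLike.GradedMonoid 𝓐] {ι : Type*} {M : GradedFree 𝓐}
    {b : Module.Basis ι A M} {a : ι → ℤ} (h : M.IsHomogeneousBasis b a) (i : ι) :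
    b i ∈ M.deg (a i) := by
  rw [h]
  intro j
  rw [b.repr_self]
  by_cases hp : i = j
  · subst hp
    rw [Finsupp.single_eq_same, sub_self]
    exact SetLike.one_mem_graded 𝓐
  · rw [Finsupp.single_eq_of_ne' hp]
    exact zero_mem _

theorem exists_isHomogeneousBasis (M : GradedFree 𝓐) : ∃ (ι : Type) (_ : Fintype ι)
    (_ : DecidableEq ι) (b : Module.Basis ι A M) (a : ι → ℤ), M.IsHomogeneousBasis b a := by
  obtain ⟨ι, hι, b, a, h⟩ := M.exists_basis
  exact ⟨ι, Fintype.ofFinite ι, Classical.decEq ι, b, a, h⟩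

/-- A graded free module is generated by homogeneous elements. -/
theorem hom_ext_deg [SetLike.GradedMonoid 𝓐] {M : GradedFree 𝓐} {P : Type*} [AddCommGroup P]
    [Module A P] {φ ψ : M →ₗ[A] P} (h : ∀ n, ∀ x ∈ M.deg n, φ x = ψ x) : φ = ψ := by
  obtain ⟨ι, _, _, b, a, hb⟩ := M.exists_isHomogeneousBasis
  exact b.ext fun i => h _ _ (hb.mem i)

/-- A basis of `M0 ⊕ M1` which is homogeneous for the bigrading. -/
def IsBihomogeneousBasis {ι : Type*} (d : ℤ) (M0 M1 : GradedFree 𝓐)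
    (b : Module.Basis ι A (M0 × M1)) (c a : ι → ℤ) : Prop :=
  ∀ p n x, x ∈ superDeg d M0 M1 p n ↔ ∀ i, b.repr x i ∈ bideg 𝓐 d (p - c i) (n - a i)

/-- In cohomological degree `1` the piece of internal degree `n` is `M1` in degree `n + d`; hence a
basis element of `M1` of degree `a'` has bidegree `(1, a' - d)`. -/
theorem IsHomogeneousBasis.prod {ι ι' : Type*} {b : Module.Basis ι A M0} {a : ι → ℤ}
    {b' : Module.Basis ι' A M1} {a' : ι' → ℤ} (h : M0.IsHomogeneousBasis b a)
    (h' : M1.IsHomogeneousBasis b' a') (d : ℤ) :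
    IsBihomogeneousBasis d M0 M1 (b.prod b') (Sum.elim (fun _ => 0) (fun _ => 1))
      (Sum.elim a fun i => a' i - d) := by
  intro p n x
  rw [Sum.forall]
  simp only [Module.Basis.prod_repr_inl, Module.Basis.prod_repr_inr, Sum.elim_inl, Sum.elim_inr,
    sub_zero]
  obtain ⟨j, rfl | rfl⟩ := Int.even_or_odd' p
  · rw [mem_superDeg_even, h, show 2 * j - 1 = 2 * (j - 1) + 1 by ring]
    simp only [bideg_two_mul, bideg_two_mul_add_one, Submodule.mem_bot]
    refine and_congr ?_ ?_
    · refine forall_congr' fun i => ?_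
      rw [add_sub_right_comm]
    · rw [← b'.repr.map_eq_zero_iff, Finsupp.ext_iff]
      rfl
  · rw [mem_superDeg_odd, h', show 2 * j + 1 - 1 = 2 * j by ring]
    simp only [bideg_two_mul, bideg_two_mul_add_one, Submodule.mem_bot]
    refine and_congr ?_ ?_
    · rw [← b.repr.map_eq_zero_iff, Finsupp.ext_iff]
      rfl
    · refine forall_congr' fun i => ?_
      rw [show n - (a' i - d) + j * d = n + (j + 1) * d - a' i by ring]

theorem IsBihomogeneousBasis.mem [SetLike.GradedMonoid 𝓐] {ι : Type*}
    {b : Module.Basis ι A (M0 × M1)} {c a : ι → ℤ}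
    (h : IsBihomogeneousBasis d M0 M1 b c a) (i : ι) :
    b i ∈ superDeg d M0 M1 (c i) (a i) := by
  rw [h]
  intro j
  rw [b.repr_self]
  by_cases hp : i = j
  · subst hp
    rw [Finsupp.single_eq_same, sub_self, sub_self]
    exact one_mem_bideg 𝓐 d
  · rw [Finsupp.single_eq_of_ne' hp]
    exact zero_mem _

theorem exists_isBihomogeneousBasis (d : ℤ) (M0 M1 : GradedFree 𝓐) : ∃ (ι : Type) (_ : Fintype ι)
    (_ : DecidableEq ι) (b : Module.Basis ι A (M0 × M1)) (c a : ι → ℤ),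
    IsBihomogeneousBasis d M0 M1 b c a := by
  obtain ⟨ι, _, _, b, a, h⟩ := M0.exists_isHomogeneousBasis
  obtain ⟨ι', _, _, b', a', h'⟩ := M1.exists_isHomogeneousBasis
  exact ⟨ι ⊕ ι', inferInstance, inferInstance, _, _, _, h.prod h' d⟩

/-- Linear maps of bidegree `(m, e)`. -/
def IsBihom (d : ℤ) (M0 M1 N0 N1 : GradedFree 𝓐) (m e : ℤ) (φ : M0 × M1 →ₗ[A] N0 × N1) : Prop :=
  ∀ c n, ∀ x ∈ superDeg d M0 M1 c n, φ x ∈ superDeg d N0 N1 (c + m) (n + e)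

/-- Matrices of bidegree `(m, e)`, with respect to basis elements of bidegrees `(c i, a i)`. -/
def IsBihomMatrix {ι ι' : Type*} (𝓐 : ℤ → Submodule k A) (d : ℤ) (c a : ι → ℤ) (c' a' : ι' → ℤ)
    (m e : ℤ) (X : Matrix ι' ι A) : Prop :=
  ∀ i j, X i j ∈ bideg 𝓐 d (m + c j - c' i) (e + a j - a' i)

/-- Translates homogeneity of maps into a condition on matrix entries, so that the later arguments
can be carried out in matrix rings. -/
theorem isBihom_iff [SetLike.GradedMonoid 𝓐] {ι ι' : Type*} [Fintype ι] [DecidableEq ι]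
    [Fintype ι'] {b : Module.Basis ι A (M0 × M1)} {c a : ι → ℤ}
    (h : IsBihomogeneousBasis d M0 M1 b c a) {b' : Module.Basis ι' A (N0 × N1)} {c' a' : ι' → ℤ}
    (h' : IsBihomogeneousBasis d N0 N1 b' c' a') (m e : ℤ) (φ : M0 × M1 →ₗ[A] N0 × N1) :
    IsBihom d M0 M1 N0 N1 m e φ ↔
      IsBihomMatrix 𝓐 d c a c' a' m e (LinearMap.toMatrix b b' φ) := by
  constructor
  · intro hφ i j
    have := (h' _ _ _).1 (hφ _ _ _ (h.mem j)) i
    rw [LinearMap.toMatrix_apply, add_comm m, add_comm e]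
    exact this
  · intro hφ p n x hx
    rw [h']
    intro i
    rw [← LinearMap.toMatrix_mulVec_repr b b' φ x, Matrix.mulVec, dotProduct]
    refine Submodule.sum_mem _ fun j _ => ?_
    have := mul_mem_bideg (hφ i j) ((h _ _ _).1 hx j)
    convert this using 2 <;> ring

end GradedFree

open GradedFree

namespace GradedMF

variable {𝓐 : ℤ → Submodule k A} [SetLike.GradedMonoid 𝓐] {f : A} {d : ℤ} {F G : GradedMF 𝓐 f d}

/-- The even and odd descriptions of morphisms merge into the single condition of bidegree `(m, 0)`,
the twists by multiples of `d` being absorbed by the convention for `superDeg`. -/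
theorem mem_homDeg_iff_isBihom (m : ℤ) (φ : F.Total →ₗ[A] G.Total) :
    φ ∈ homDeg F G m ↔ IsBihom d F.F0 F.F1 G.F0 G.F1 m 0 φ := by
  constructor
  · rintro hφ c n ⟨x, y⟩ hx
    rw [add_zero, apply_eq]
    obtain ⟨i, rfl | rfl⟩ := Int.even_or_odd' m <;> obtain ⟨j, rfl | rfl⟩ := Int.even_or_odd' c
    · obtain ⟨h1, h2, h3, h4⟩ := (mem_homDeg_even i).1 hφ
      obtain ⟨hx1, rfl : y = 0⟩ := mem_superDeg_even.1 hx
      rw [← mul_add, mem_superDeg_even, h3, h4]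
      simp only [LinearMap.zero_apply, map_zero, add_zero, and_true]
      have := h1 _ _ hx1
      rwa [show n + j * d + i * d = n + (j + i) * d by ring] at this
    · obtain ⟨h1, h2, h3, h4⟩ := (mem_homDeg_even i).1 hφ
      obtain ⟨rfl : x = 0, hx1⟩ := mem_superDeg_odd.1 hx
      rw [add_right_comm, ← mul_add, mem_superDeg_odd, h3, h4]
      simp only [LinearMap.zero_apply, map_zero, add_zero, zero_add, true_and]
      have := h2 _ _ hx1
      rwa [show n + (j + 1) * d + i * d = n + (j + i + 1) * d by ring] at this
    · obtain ⟨h1, h2, h3, h4⟩ := (mem_homDeg_odd i).1 hφ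
      obtain ⟨hx1, rfl : y = 0⟩ := mem_superDeg_even.1 hx
      rw [← add_assoc, ← mul_add, mem_superDeg_odd, h3, h4]
      simp only [LinearMap.zero_apply, map_zero, add_zero, true_and]
      have := h1 _ _ hx1
      rwa [show n + j * d + (i + 1) * d = n + (j + i + 1) * d by ring] at this
    · obtain ⟨h1, h2, h3, h4⟩ := (mem_homDeg_odd i).1 hφ
      obtain ⟨rfl : x = 0, hx1⟩ := mem_superDeg_odd.1 hx
      rw [show 2 * j + 1 + (2 * i + 1) = 2 * (j + i + 1) by ring, mem_superDeg_even, h3, h4]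
      simp only [LinearMap.zero_apply, map_zero, zero_add, and_true]
      have := h2 _ _ hx1
      rwa [show n + (j + 1) * d + i * d = n + (j + i + 1) * d by ring] at this
  · intro hφ
    have h0 : ∀ j n x, x ∈ F.F0.deg (n + j * d) →
        (c00 φ x, c10 φ x) ∈ superDeg d G.F0 G.F1 (2 * j + m) n := by
      intro j n x hx
      have := hφ (2 * j) n (x, 0) (mem_superDeg_even.2 ⟨hx, rfl⟩)
      rw [add_zero, apply_eq] at this
      simpa using this
    have h1 : ∀ j n x, x ∈ F.F1.deg (n + (j + 1) * d) →
        (c01 φ x, c11 φ x) ∈ superDeg d G.F0 G.F1 (2 * j + 1 + m) n := by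
      intro j n x hx
      have := hφ (2 * j + 1) n (0, x) (mem_superDeg_odd.2 ⟨rfl, hx⟩)
      rw [add_zero, apply_eq] at this
      simpa using this
    have h0' : ∀ n x, x ∈ F.F0.deg n → (c00 φ x, c10 φ x) ∈ superDeg d G.F0 G.F1 m n := by
      intro n x hx
      have := h0 0 n x (by simpa using hx)
      simpa using this
    -- The index `j = -1` is the one for which the odd piece is `F1` with no shift; it has
    -- cohomological degree `-1`, whence `m - 1`.
    have h1' : ∀ n x, x ∈ F.F1.deg n → (c01 φ x, c11 φ x) ∈ superDeg d G.F0 G.F1 (m - 1) n := by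
      intro n x hx
      have := h1 (-1) n x (by simpa using hx)
      rwa [show 2 * (-1) + 1 + m = m - 1 by ring] at this
    obtain ⟨i, rfl | rfl⟩ := Int.even_or_odd' m
    · rw [mem_homDeg_even]
      simp only [show 2 * i - 1 = 2 * (i - 1) + 1 by ring, mem_superDeg_odd, mem_superDeg_even,
        sub_add_cancel] at h0' h1'
      exact ⟨fun n x hx => (h0' n x hx).1, fun n x hx => (h1' n x hx).2,
        hom_ext_deg fun n x hx => (h0' n x hx).2, hom_ext_deg fun n x hx => (h1' n x hx).1⟩
    · rw [mem_homDeg_odd]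
      simp only [show 2 * i + 1 - 1 = 2 * i by ring, mem_superDeg_odd, mem_superDeg_even]
        at h0' h1'
      exact ⟨fun n x hx => (h0' n x hx).2, fun n x hx => (h1' n x hx).1,
        hom_ext_deg fun n x hx => (h0' n x hx).1, hom_ext_deg fun n x hx => (h1' n x hx).2⟩

end GradedMF

end Bigrading

/-! ### Homogeneous components of null-homotopies. -/

section Exactness

variable {k : Type u} [Field k] {A : Type u} [CommRing A] [Algebra k A]
  {𝓐 : ℤ → Submodule k A} [GradedAlgebra 𝓐]

/-- The projection of matrices onto those of bidegree `(m, 0)`. -/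
def bihomProj (𝓐 : ℤ → Submodule k A) [GradedAlgebra 𝓐] {ι ι' : Type*} (d : ℤ) (c a : ι → ℤ)
    (c' a' : ι' → ℤ) (m : ℤ) (X : Matrix ι' ι A) : Matrix ι' ι A :=
  .of fun i j => bidegProj 𝓐 d (m + c j - c' i) (0 + a j - a' i) (X i j)

open GradedFree

variable {ι ι' : Type*} {d : ℤ} {c a : ι → ℤ} {c' a' : ι' → ℤ} {m p : ℤ}

theorem isBihomMatrix_bihomProj (X : Matrix ι' ι A) :
    IsBihomMatrix 𝓐 d c a c' a' m 0 (bihomProj 𝓐 d c a c' a' m X) :=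
  fun _ _ => bidegProj_mem _ _ _ _ _

theorem bihomProj_of_isBihomMatrix {X : Matrix ι' ι A} (hX : IsBihomMatrix 𝓐 d c a c' a' m 0 X) :
    bihomProj 𝓐 d c a c' a' m X = X :=
  Matrix.ext fun i j => bidegProj_of_mem (hX i j)

theorem bihomProj_mul_left [Fintype ι'] {ι'' : Type*} {c'' a'' : ι'' → ℤ} {S : Matrix ι'' ι' A}
    (hS : IsBihomMatrix 𝓐 d c' a' c'' a'' p 0 S) (X : Matrix ι' ι A) :
    bihomProj 𝓐 d c a c'' a'' (p + m) (S * X) = S * bihomProj 𝓐 d c a c' a' m X := by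
  ext i j
  simp only [bihomProj, Matrix.of_apply, Matrix.mul_apply, map_sum]
  refine Finset.sum_congr rfl fun l _ => ?_
  rw [← bidegProj_mul_left (hS i l)]
  ring_nf

theorem bihomProj_mul_right [Fintype ι] {S : Matrix ι ι A}
    (hS : IsBihomMatrix 𝓐 d c a c a p 0 S) (X : Matrix ι' ι A) :
    bihomProj 𝓐 d c a c' a' (m + p) (X * S) = bihomProj 𝓐 d c a c' a' m X * S := by
  ext i j
  simp only [bihomProj, Matrix.of_apply, Matrix.mul_apply, map_sum]
  refine Finset.sum_congr rfl fun l _ => ?_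
  rw [mul_comm (X i l), mul_comm _ (S l j), ← bidegProj_mul_left (hS l j)]
  ring_nf

theorem bihomProj_sub (X Y : Matrix ι' ι A) :
    bihomProj 𝓐 d c a c' a' m (X - Y) =
      bihomProj 𝓐 d c a c' a' m X - bihomProj 𝓐 d c a c' a' m Y :=
  Matrix.ext fun i j => map_sub (bidegProj 𝓐 d _ _) (X i j) (Y i j)

theorem bihomProj_units_smul (e : ℤˣ) (X : Matrix ι' ι A) :
    bihomProj 𝓐 d c a c' a' m (e • X) = e • bihomProj 𝓐 d c a c' a' m X :=
  Matrix.ext fun _ _ => map_zsmul (bidegProj 𝓐 d _ _) (e : ℤ) _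

namespace GradedMF

variable {f : A} {F G : GradedMF 𝓐 f d}

/-- A morphism which is the boundary of some linear map is the boundary of a homogeneous one. -/
theorem exists_homDeg_boundary {φ : F.Total →ₗ[A] G.Total} (hφ : φ ∈ homDeg F G (m + 1))
    (ψ : F.Total →ₗ[A] G.Total) (h : φ = G.s ∘ₗ ψ - m.negOnePow • (ψ ∘ₗ F.s)) :
    ∃ ψ' ∈ homDeg F G m, φ = G.s ∘ₗ ψ' - m.negOnePow • (ψ' ∘ₗ F.s) := by
  obtain ⟨ι, _, _, b, c, a, hb⟩ := exists_isBihomogeneousBasis d F.F0 F.F1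
  obtain ⟨ι', _, _, b', c', a', hb'⟩ := exists_isBihomogeneousBasis d G.F0 G.F1
  -- The witness is the component of `ψ` of bidegree `(m, 0)`. Since the matrices of `s` are
  -- homogeneous of bidegree `(1, 0)`, the boundary of this component is the component of bidegree
  -- `(m + 1, 0)` of the boundary of `ψ`, which is all of `φ`.
  refine ⟨Matrix.toLin b b' (bihomProj 𝓐 d c a c' a' m (LinearMap.toMatrix b b' ψ)), ?_, ?_⟩
  · rw [mem_homDeg_iff_isBihom, isBihom_iff hb hb', LinearMap.toMatrix_toLin]
    exact isBihomMatrix_bihomProj _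
  · have hs := (isBihom_iff hb hb 1 0 F.s).1 ((mem_homDeg_iff_isBihom _ _).1 F.s_mem_homDeg)
    have hs' := (isBihom_iff hb' hb' 1 0 G.s).1 ((mem_homDeg_iff_isBihom _ _).1 G.s_mem_homDeg)
    have hφ' := (isBihom_iff hb hb' _ 0 φ).1 ((mem_homDeg_iff_isBihom _ _).1 hφ)
    have key := bihomProj_of_isBihomMatrix hφ'
    apply (LinearMap.toMatrix b b').injective
    have hmul : ∀ χ : F.Total →ₗ[A] G.Total,
        LinearMap.toMatrix b b' (G.s ∘ₗ χ - m.negOnePow • (χ ∘ₗ F.s)) =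
        LinearMap.toMatrix b' b' G.s * LinearMap.toMatrix b b' χ -
          m.negOnePow • (LinearMap.toMatrix b b' χ * LinearMap.toMatrix b b F.s) := by
      intro χ
      rw [map_sub, LinearMap.toMatrix_comp b b' b']
      congr 1
      rw [Units.smul_def, map_zsmul, LinearMap.toMatrix_comp b b b', Units.smul_def]
    rw [hmul, LinearMap.toMatrix_toLin, ← bihomProj_mul_right hs, ← bihomProj_mul_left hs',
      ← bihomProj_units_smul, add_comm 1 m, ← bihomProj_sub, ← hmul, ← h, key]

end GradedMF

end Exactness

/-! ### Tensoring with graded modules of rank one -/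

section RankOne

variable {A A' B M N : Type*} [CommRing A] [CommRing A'] [CommRing B] [Algebra A B] [Algebra A' B]
  [AddCommGroup M] [Module A M] [AddCommGroup N] [Module A N]

/-- The isomorphism `(B ⊗ M) ⊗_B (B ⊗ A') ≃ B ⊗ M`. -/
def tensorUnitEquiv (A A' B M : Type*) [CommRing A] [CommRing A'] [CommRing B] [Algebra A B]
    [Algebra A' B] [AddCommGroup M] [Module A M] :
    (B ⊗[A] M) ⊗[B] (B ⊗[A'] A') ≃ₗ[B] B ⊗[A] M :=
  TensorProduct.congr (LinearEquiv.refl B _) (TensorProduct.AlgebraTensorModule.rid A' B B) ≪≫ₗ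
    TensorProduct.rid B (B ⊗[A] M)

theorem tensorUnitEquiv_tmul (x : B ⊗[A] M) (c : B) (q : A') :
    tensorUnitEquiv A A' B M (x ⊗ₜ (c ⊗ₜ q)) = (q • c) • x := rfl

theorem tensorUnitEquiv_symm_apply (x : B ⊗[A] M) :
    (tensorUnitEquiv A A' B M).symm x = x ⊗ₜ (1 ⊗ₜ 1) := by
  rw [LinearEquiv.symm_apply_eq, tensorUnitEquiv_tmul, one_smul, one_smul]

theorem tensorUnitEquiv_map (g : M →ₗ[A] N) (z : (B ⊗[A] M) ⊗[B] (B ⊗[A'] A')) :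
    tensorUnitEquiv A A' B N (TensorProduct.map (g.baseChange B)
      ((LinearMap.id : A' →ₗ[A'] A').baseChange B) z) =
      g.baseChange B (tensorUnitEquiv A A' B M z) := by
  obtain ⟨x, rfl⟩ := (tensorUnitEquiv A A' B M).symm.surjective z
  rw [LinearEquiv.apply_symm_apply, tensorUnitEquiv_symm_apply, TensorProduct.map_tmul,
    LinearMap.baseChange_tmul, LinearMap.id_apply, tensorUnitEquiv_tmul, one_smul, one_smul]

theorem fst_prodRight_baseChange (x : B ⊗[A] (M × N)) :
    (TensorProduct.prodRight A B B M N x).1 = (LinearMap.fst A M N).baseChange B x := by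
  induction x using TensorProduct.induction_on with
  | zero => simp
  | tmul c y => simp
  | add x y hx hy => rw [map_add, map_add, Prod.fst_add, hx, hy]

theorem snd_prodRight_baseChange (x : B ⊗[A] (M × N)) :
    (TensorProduct.prodRight A B B M N x).2 = (LinearMap.snd A M N).baseChange B x := by
  induction x using TensorProduct.induction_on with
  | zero => simp
  | tmul c y => simp
  | add x y hx hy => rw [map_add, map_add, Prod.snd_add, hx, hy]

theorem prodRight_symm_apply_eq (x : B ⊗[A] M) (y : B ⊗[A] N) :
    (TensorProduct.prodRight A B B M N).symm (x, y) =
      (LinearMap.inl A M N).baseChange B x + (LinearMap.inr A M N).baseChange B y := by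
  rw [LinearEquiv.symm_apply_eq]
  refine Prod.ext ?_ ?_
  · rw [fst_prodRight_baseChange, map_add, ← LinearMap.comp_apply, ← LinearMap.comp_apply,
      ← LinearMap.baseChange_comp, ← LinearMap.baseChange_comp, LinearMap.fst_comp_inl,
      LinearMap.fst_comp_inr, LinearMap.baseChange_id, LinearMap.baseChange_zero]
    simp
  · rw [snd_prodRight_baseChange, map_add, ← LinearMap.comp_apply, ← LinearMap.comp_apply,
      ← LinearMap.baseChange_comp, ← LinearMap.baseChange_comp, LinearMap.snd_comp_inl,
      LinearMap.snd_comp_inr, LinearMap.baseChange_id, LinearMap.baseChange_zero]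
    simp

end RankOne

/-! ### Degrees in base changes and in rank one tensor products. -/

section Graded

variable {k : Type u} [Field k] {A : Type u} [CommRing A] [Algebra k A]
  {𝓐 : ℤ → Submodule k A} [SetLike.GradedMonoid 𝓐]
  {A' : Type u} [CommRing A'] [Algebra k A'] {𝓐' : ℤ → Submodule k A'}
  [SetLike.GradedMonoid 𝓐']
  {B : Type u} [CommRing B] [Algebra k B] [Algebra A B] [IsScalarTower k A B]
  [Algebra A' B] [IsScalarTower k A' B] {𝓑 : ℤ → Submodule k B} [SetLike.GradedMonoid 𝓑]

namespace GradedFree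

theorem smul_mem_deg (M : GradedFree 𝓐) {i j : ℤ} {c : A} {x : M} (hc : c ∈ 𝓐 i)
    (hx : x ∈ M.deg j) : c • x ∈ M.deg (i + j) := by
  obtain ⟨ι, _, _, b, a, h⟩ := M.exists_isHomogeneousBasis
  rw [h]
  intro p
  rw [map_smul, Finsupp.smul_apply, smul_eq_mul, add_sub_assoc]
  exact SetLike.mul_mem_graded hc ((h _ _).1 hx p)

/-- The graded structure of a base change only records that some homogeneous basis exists; here any
prescribed homogeneous basis of `M` is seen to remain one. -/
theorem IsHomogeneousBasis.mem_span_iff (hB : IsGradedAlgebraMap 𝓐 𝓑) {ι : Type*} [Finite ι]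
    {M : GradedFree 𝓐} {b : Module.Basis ι A M} {a : ι → ℤ} (h : M.IsHomogeneousBasis b a) (n : ℤ)
    (z : B ⊗[A] M) :
    z ∈ Submodule.span k {z : B ⊗[A] M | ∃ i j, i + j = n ∧ ∃ c ∈ 𝓑 i, ∃ x ∈ M.deg j,
      z = c ⊗ₜ[A] x} ↔ ∀ i, (b.baseChange B).repr z i ∈ 𝓑 (n - a i) := by
  constructor
  · intro hz
    induction hz using Submodule.span_induction with
    | mem z hz =>
      obtain ⟨i, j, rfl, c, hc, x, hx, rfl⟩ := hz
      intro p
      rw [Module.Basis.baseChange_repr_tmul, Algebra.smul_def, mul_comm, add_sub_assoc]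
      exact SetLike.mul_mem_graded hc (hB _ _ ((h _ _).1 hx p))
    | zero => intro i; simp
    | add z z' _ _ hz hz' => intro i; simpa using add_mem (hz i) (hz' i)
    | smul c z _ hz =>
      intro i
      rw [← algebraMap_smul B c z, map_smul, Finsupp.smul_apply, algebraMap_smul]
      exact Submodule.smul_mem _ c (hz i)
  · intro hz
    cases nonempty_fintype ι
    rw [← (b.baseChange B).sum_repr z]
    refine Submodule.sum_mem _ fun i _ => Submodule.subset_span ?_
    refine ⟨n - a i, a i, by omega, (b.baseChange B).repr z i, hz i, b i, h.mem i, ?_⟩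
    rw [Module.Basis.baseChange_apply, TensorProduct.smul_tmul', smul_eq_mul, mul_one]

theorem IsHomogeneousBasis.baseChange (hB : IsGradedAlgebraMap 𝓐 𝓑) {ι : Type*} [Finite ι]
    {M : GradedFree 𝓐} {b : Module.Basis ι A M} {a : ι → ℤ} (h : M.IsHomogeneousBasis b a) :
    (GradedFree.baseChange hB M).IsHomogeneousBasis (b.baseChange B) a :=
  fun n z => h.mem_span_iff hB n z

/-- `E` stands for the twist `A'(t)`, whose generator `1` has degree `-t`; tensoring with it
therefore shifts degrees by `t`. Leaving `t` free covers both `X0` (`t = 0`) and `X1` (`t = l - d`).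
-/
theorem tensorUnitEquiv_mem_iff (hB' : IsGradedAlgebraMap 𝓐' 𝓑) {M : Type*} [AddCommGroup M]
    [Module A M] (D : ℤ → Submodule k (B ⊗[A] M))
    (hD : ∀ i j c x, c ∈ 𝓑 i → x ∈ D j → c • x ∈ D (i + j)) (t : ℤ) (E : ℤ → Submodule k A')
    (hE : ∀ q, E q = 𝓐' (q + t)) (n : ℤ) (z : (B ⊗[A] M) ⊗[B] (B ⊗[A'] A')) :
    z ∈ Submodule.span k {z : (B ⊗[A] M) ⊗[B] (B ⊗[A'] A') | ∃ i j, i + j = n ∧ ∃ x ∈ D i,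
      ∃ y ∈ Submodule.span k {y : B ⊗[A'] A' | ∃ p q, p + q = j ∧ ∃ c ∈ 𝓑 p, ∃ a ∈ E q,
        y = c ⊗ₜ[A'] a}, z = x ⊗ₜ[B] y} ↔ tensorUnitEquiv A A' B M z ∈ D (n + t) := by
  constructor
  · intro hz
    induction hz using Submodule.span_induction with
    | mem z hz =>
      obtain ⟨i, j, rfl, x, hx, y, hy, rfl⟩ := hz
      induction hy using Submodule.span_induction with
      | mem y hy =>
        obtain ⟨p, q, rfl, c, hc, y, hy, rfl⟩ := hy
        rw [hE] at hy
        rw [tensorUnitEquiv_tmul, Algebra.smul_def]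
        have h2 := hD _ _ _ _ (SetLike.mul_mem_graded (hB' _ _ hy) hc) hx
        rwa [show q + t + p + i = i + (p + q) + t by ring] at h2
      | zero => rw [TensorProduct.tmul_zero, map_zero]; exact zero_mem _
      | add y y' _ _ h h' => rw [TensorProduct.tmul_add, map_add]; exact add_mem h h'
      | smul c y _ h =>
        rw [← algebraMap_smul B c y, TensorProduct.tmul_smul, map_smul, algebraMap_smul]
        exact Submodule.smul_mem _ c h
    | zero => rw [map_zero]; exact zero_mem _
    | add z z' _ _ h h' => rw [map_add]; exact add_mem h h'
    | smul c y _ h =>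
      rw [← algebraMap_smul B c y, map_smul, algebraMap_smul]
      exact Submodule.smul_mem _ c h
  · intro hz
    rw [← (tensorUnitEquiv A A' B M).symm_apply_apply z, tensorUnitEquiv_symm_apply]
    refine Submodule.subset_span ⟨n + t, -t, by omega, _, hz, _, ?_, rfl⟩
    refine Submodule.subset_span ⟨0, -t, by omega, 1, SetLike.one_mem_graded 𝓑, 1, ?_, rfl⟩
    rw [hE, neg_add_cancel]
    exact SetLike.one_mem_graded 𝓐'

end GradedFree

end Graded

/-! ### Tensoring with a Koszul matrix factorization of rank one -/

section Retraction

variable {A B M N : Type*} [CommRing A] [CommRing B] [Algebra A B] [AddCommGroup M] [Module A M]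
  [AddCommGroup N] [Module A N]

/-- The map `B ⊗ M → M` induced by a retraction `B → A`. -/
def tensorRetract (π : B →ₐ[A] A) (M : Type*) [AddCommGroup M] [Module A M] :
    B ⊗[A] M →ₗ[A] M :=
  (TensorProduct.lid A M).toLinearMap ∘ₗ π.toLinearMap.rTensor M

variable (π : B →ₐ[A] A)

theorem tensorRetract_tmul (c : B) (x : M) : tensorRetract π M (c ⊗ₜ x) = π c • x := rfl

theorem tensorRetract_baseChange (g : M →ₗ[A] N) (x : B ⊗[A] M) :
    tensorRetract π N (g.baseChange B x) = g (tensorRetract π M x) := by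
  induction x using TensorProduct.induction_on with
  | zero => simp
  | tmul c x => simp [tensorRetract_tmul]
  | add x y hx hy => rw [map_add, map_add, map_add, map_add, hx, hy]

theorem tensorRetract_smul (c : B) (x : B ⊗[A] M) :
    tensorRetract π M (c • x) = π c • tensorRetract π M x := by
  induction x using TensorProduct.induction_on with
  | zero => simp
  | tmul c' x => simp [tensorRetract_tmul, TensorProduct.smul_tmul', mul_smul]
  | add x y hx hy => rw [smul_add, map_add, map_add, smul_add, hx, hy]

theorem repr_tensorRetract {ι : Type*} (b : Module.Basis ι A M) (x : B ⊗[A] M) (i : ι) :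
    b.repr (tensorRetract π M x) i = π ((b.baseChange B).repr x i) := by
  induction x using TensorProduct.induction_on with
  | zero => simp
  | tmul c x =>
    rw [tensorRetract_tmul, Module.Basis.baseChange_repr_tmul, map_smul, map_smul,
      Finsupp.smul_apply, smul_eq_mul, smul_eq_mul, mul_comm]
  | add x y hx hy => simp [hx, hy]

end Retraction

/-- The properties of `u` and `v` in `B = A[u, v]` that are used: `π` is the retraction `B → A`
with kernel `(u, v)`, and `v, u` is a regular sequence. -/
structure IsKoszulRetract {A B : Type*} [CommRing A] [CommRing B] [Algebra A B] (π : B →ₐ[A] A)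
    (u v : B) : Prop where
  map_u : π u = 0
  map_v : π v = 0
  exists_of_map_eq_zero : ∀ x, π x = 0 → ∃ y z, x = u * y + v * z
  dvd_of_eq : ∀ x y, u * x = v * y → ∃ z, x = v * z
  eq_zero_of_mul : ∀ x, v * x = 0 → x = 0

namespace IsKoszulRetract

variable {A B M N : Type*} [CommRing A] [CommRing B] [Algebra A B] [AddCommGroup M] [Module A M]
  [AddCommGroup N] [Module B N] {π : B →ₐ[A] A} {u v : B} {ι κ : Type*}

/-- The three lemmas here carry the ideal-theoretic properties of `u` and `v` over to maps of free
modules by applying them to each matrix entry. Freeness of the source turns the choices made on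
basis elements into linear maps. -/
theorem exists_linearMap_of_retract [Finite ι] (b : Module.Basis ι A M) (c : Module.Basis κ B N)
    (h : IsKoszulRetract π u v) (φ : N →ₗ[B] B ⊗[A] M)
    (hφ : ∀ j, tensorRetract π M (φ (c j)) = 0) :
    ∃ x y : N →ₗ[B] B ⊗[A] M, φ = u • x + v • y := by
  cases nonempty_fintype ι
  have key : ∀ j i, ∃ y z, (b.baseChange B).repr (φ (c j)) i = u * y + v * z := fun j i =>
    h.exists_of_map_eq_zero _ (by rw [← repr_tensorRetract, hφ, map_zero, Finsupp.zero_apply])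
  choose y z hyz using key
  refine ⟨c.constr B fun j => ∑ i, y j i • b.baseChange B i,
    c.constr B fun j => ∑ i, z j i • b.baseChange B i, c.ext fun j => ?_⟩
  rw [LinearMap.add_apply, LinearMap.smul_apply, LinearMap.smul_apply, c.constr_basis,
    c.constr_basis, Finset.smul_sum, Finset.smul_sum, ← Finset.sum_add_distrib,
    ← (b.baseChange B).sum_repr (φ (c j))]
  refine Finset.sum_congr rfl fun i _ => ?_
  rw [hyz, add_smul, mul_smul, mul_smul]

theorem exists_linearMap_of_eq [Finite ι] (b : Module.Basis ι A M) (c : Module.Basis κ B N)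
    (h : IsKoszulRetract π u v) (φ ψ : N →ₗ[B] B ⊗[A] M) (hφ : u • φ = v • ψ) :
    ∃ χ : N →ₗ[B] B ⊗[A] M, φ = v • χ := by
  cases nonempty_fintype ι
  have key : ∀ j i, ∃ z, (b.baseChange B).repr (φ (c j)) i = v * z := fun j i => by
    refine h.dvd_of_eq _ ((b.baseChange B).repr (ψ (c j)) i) ?_
    have := congrArg (fun t => (b.baseChange B).repr t i) (LinearMap.congr_fun hφ (c j))
    simpa using this
  choose z hz using key
  refine ⟨c.constr B fun j => ∑ i, z j i • b.baseChange B i, c.ext fun j => ?_⟩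
  rw [LinearMap.smul_apply, c.constr_basis, Finset.smul_sum,
    ← (b.baseChange B).sum_repr (φ (c j))]
  refine Finset.sum_congr rfl fun i _ => ?_
  rw [hz, mul_smul]

theorem eq_zero_of_smul (b : Module.Basis ι A M) (c : Module.Basis κ B N)
    (h : IsKoszulRetract π u v) (φ : N →ₗ[B] B ⊗[A] M) (hφ : v • φ = 0) : φ = 0 := by
  refine c.ext fun j => (b.baseChange B).ext_elem fun i => ?_
  have := congrArg (fun t => (b.baseChange B).repr t i) (LinearMap.congr_fun hφ (c j))
  have h0 := h.eq_zero_of_mul _ (by simpa using this)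
  simpa using h0

end IsKoszulRetract

/-- The boundary of a matrix of linear maps for the differentials `(-s, v; u, s)`: a closed matrix
whose last entry lies in `(u, v)` is a boundary. -/
theorem koszul_exact {B N N' : Type*} [CommRing B] [AddCommGroup N] [Module B N] [AddCommGroup N']
    [Module B N'] {s : N →ₗ[B] N} {s' : N' →ₗ[B] N'} {u v f : B} (hs : ∀ x, s (s x) = f • x)
    (hs' : ∀ x, s' (s' x) = f • x)
    (hdiv : ∀ φ ψ : N →ₗ[B] N', u • φ = v • ψ → ∃ χ : N →ₗ[B] N', φ = v • χ)
    (hreg : ∀ φ : N →ₗ[B] N', v • φ = 0 → φ = 0) {e : B} (he : e = 1 ∨ e = -1)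
    {φ00 φ01 φ10 φ11 x y : N →ₗ[B] N'} (hφ : φ11 = u • x + v • y)
    (h01 : ∀ n, -s' (φ01 n) + v • φ11 n + e • (v • φ00 n + φ01 (s n)) = 0)
    (h11 : ∀ n, u • φ01 n + s' (φ11 n) + e • (v • φ10 n + φ11 (s n)) = 0) :
    ∃ ψ00 ψ01 ψ10 ψ11 : N →ₗ[B] N',
      (∀ n, φ00 n = -s' (ψ00 n) + v • ψ10 n - e • (-ψ00 (s n) + u • ψ01 n)) ∧
      (∀ n, φ01 n = -s' (ψ01 n) + v • ψ11 n - e • (v • ψ00 n + ψ01 (s n))) ∧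
      (∀ n, φ10 n = u • ψ00 n + s' (ψ10 n) - e • (-ψ10 (s n) + u • ψ11 n)) ∧
      (∀ n, φ11 n = u • ψ01 n + s' (ψ11 n) - e • (v • ψ10 n + ψ11 (s n))) := by
  subst hφ
  have he2 : e * e = 1 := by obtain rfl | rfl := he <;> ring
  simp only [LinearMap.add_apply, LinearMap.smul_apply, map_add, map_smul] at h01 h11
  -- Inserting `φ11 = u x + v y` into the last closedness equation gives `u (φ01 + s'x + e x s) = -v
  -- (s'y + e φ10 + e y s)`, so the left bracket is divisible by `v`.
  obtain ⟨c, hc⟩ := hdiv (φ01 + s' ∘ₗ x + e • (x ∘ₗ s))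
    (-(s' ∘ₗ y + e • φ10 + e • (y ∘ₗ s))) (LinearMap.ext fun n => by
      simp only [LinearMap.add_apply, LinearMap.smul_apply, LinearMap.neg_apply,
        LinearMap.comp_apply]
      linear_combination (norm := module) h11 n)
  have hc' : ∀ n, φ01 n = v • c n - s' (x n) - e • x (s n) := fun n => by
    have := LinearMap.congr_fun hc n
    simp only [LinearMap.add_apply, LinearMap.smul_apply, LinearMap.comp_apply] at this
    linear_combination (norm := module) this
  -- With `φ01` eliminated by means of `c`, the same equation is a multiple of `v`; cancelling `v`
  -- determines `φ10`.
  have h10 := hreg (u • c + s' ∘ₗ y + e • φ10 + e • (y ∘ₗ s)) (LinearMap.ext fun n => by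
    have := h11 n
    rw [hc'] at this
    simp only [LinearMap.add_apply, LinearMap.smul_apply, LinearMap.comp_apply,
      LinearMap.zero_apply]
    linear_combination (norm := module) this)
  -- In the other equation the terms free of `v` are `s's'x - e² x s s`, up to mixed terms that
  -- cancel. They vanish because both squares are `f` and `e² = 1`; what remains is again a multiple
  -- of `v` and determines `φ00`.
  have h00 := hreg (-(s' ∘ₗ c) + u • x + v • y + e • φ00 + e • (c ∘ₗ s)) (LinearMap.ext fun n => by
    have := h01 n
    rw [hc', hc'] at this
    simp only [map_sub, map_smul, hs, hs'] at this
    simp only [LinearMap.add_apply, LinearMap.smul_apply, LinearMap.comp_apply,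
      LinearMap.neg_apply, LinearMap.zero_apply]
    have h2 : (e * e) • f • x n = f • x n := by rw [he2, one_smul]
    linear_combination (norm := module) this + h2)
  -- Taking `ψ11 = 0`, the entry `φ11 = u x + v y` forces the choice `ψ01 = x`, `ψ10 = -e y`, and
  -- then `φ01` asks for `ψ00 = -e c`. The other two entries are `h00` and `h10`.
  refine ⟨-e • c, x, -e • y, 0, fun n => ?_, fun n => ?_, fun n => ?_, fun n => ?_⟩
  · have := LinearMap.congr_fun h00 n
    simp only [LinearMap.add_apply, LinearMap.smul_apply, LinearMap.comp_apply,
      LinearMap.neg_apply, LinearMap.zero_apply, map_smul] at this ⊢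
    obtain rfl | rfl := he
    · linear_combination (norm := module) this
    · linear_combination (norm := module) -this
  · rw [hc' n]
    simp only [LinearMap.smul_apply, LinearMap.zero_apply]
    obtain rfl | rfl := he <;> module
  · have := LinearMap.congr_fun h10 n
    simp only [LinearMap.add_apply, LinearMap.smul_apply, LinearMap.comp_apply,
      LinearMap.zero_apply, map_smul] at this ⊢
    obtain rfl | rfl := he
    · linear_combination (norm := module) this
    · linear_combination (norm := module) -this
  · simp only [LinearMap.add_apply, LinearMap.smul_apply, LinearMap.zero_apply, map_zero]
    obtain rfl | rfl := he <;> module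

/-! ### The tensor product with a rank one factorization as two copies of `B ⊗ F`. -/

section KoszulTensor

variable {k : Type u} [Field k] {A : Type u} [CommRing A] [Algebra k A]
  {𝓐 : ℤ → Submodule k A} [SetLike.GradedMonoid 𝓐]
  {A' : Type u} [CommRing A'] [Algebra k A'] {𝓐' : ℤ → Submodule k A'}
  [SetLike.GradedMonoid 𝓐']
  {B : Type u} [CommRing B] [Algebra k B] [Algebra A B] [IsScalarTower k A B]
  [Algebra A' B] [IsScalarTower k A' B] {𝓑 : ℤ → Submodule k B} [SetLike.GradedMonoid 𝓑]

open GradedFree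

namespace GradedFree

variable (hB : IsGradedAlgebraMap 𝓐 𝓑) {d : ℤ} {M0 M1 N0 N1 : GradedFree 𝓐}

/-- The bigrading on `B ⊗ (M0 ⊕ M1)`. -/
def MemBaseChange (hB : IsGradedAlgebraMap 𝓐 𝓑) (d : ℤ) (M0 M1 : GradedFree 𝓐) (c n : ℤ)
    (z : B ⊗[A] (M0 × M1)) : Prop :=
  TensorProduct.prodRight A B B M0 M1 z ∈ superDeg d (baseChange hB M0) (baseChange hB M1) c n

theorem memBaseChange_symm_even {j n : ℤ} {x : B ⊗[A] M0} {y : B ⊗[A] M1} :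
    MemBaseChange hB d M0 M1 (2 * j) n ((TensorProduct.prodRight A B B M0 M1).symm (x, y)) ↔
      (x : baseChange hB M0) ∈ (baseChange hB M0).deg (n + j * d) ∧ y = 0 := by
  rw [MemBaseChange, LinearEquiv.apply_symm_apply]
  exact mem_superDeg_even

theorem memBaseChange_symm_odd {j n : ℤ} {x : B ⊗[A] M0} {y : B ⊗[A] M1} :
    MemBaseChange hB d M0 M1 (2 * j + 1) n ((TensorProduct.prodRight A B B M0 M1).symm (x, y)) ↔
      x = 0 ∧ (y : baseChange hB M1) ∈ (baseChange hB M1).deg (n + (j + 1) * d) := by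
  rw [MemBaseChange, LinearEquiv.apply_symm_apply]
  exact mem_superDeg_odd

theorem memBaseChange_one_tmul {c n : ℤ} {x : M0 × M1} (hx : x ∈ superDeg d M0 M1 c n) :
    MemBaseChange hB d M0 M1 c n (1 ⊗ₜ[A] x) := by
  have key : ∀ (M : GradedFree 𝓐) p (y : M), y ∈ M.deg p →
      (1 ⊗ₜ[A] y : B ⊗[A] M) ∈ (baseChange hB M).deg p := fun M p y hy =>
    Submodule.subset_span (s := {z : B ⊗[A] M | ∃ i j, i + j = p ∧ ∃ c ∈ 𝓑 i, ∃ x ∈ M.deg j,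
      z = c ⊗ₜ[A] x}) ⟨0, p, zero_add p, 1, SetLike.one_mem_graded 𝓑, y, hy, rfl⟩
  obtain ⟨j, rfl | rfl⟩ := Int.even_or_odd' c
  · rw [mem_superDeg_even] at hx
    exact mem_superDeg_even.2 ⟨key _ _ _ hx.1, by
      rw [TensorProduct.prodRight_tmul, hx.2, TensorProduct.tmul_zero]; rfl⟩
  · rw [mem_superDeg_odd] at hx
    exact mem_superDeg_odd.2 ⟨by
      rw [TensorProduct.prodRight_tmul, hx.1, TensorProduct.tmul_zero]; rfl, key _ _ _ hx.2⟩

theorem tensorRetract_mem_deg {π : B →ₐ[A] A} (hπ : ∀ i, ∀ c ∈ 𝓑 i, π c ∈ 𝓐 i) {M : GradedFree 𝓐}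
    {n : ℤ} {x : B ⊗[A] M} (hx : x ∈ (baseChange hB M).deg n) : tensorRetract π M x ∈ M.deg n := by
  obtain ⟨ι, _, _, b, a, h⟩ := M.exists_isHomogeneousBasis
  rw [h]
  intro i
  rw [repr_tensorRetract]
  exact hπ _ _ ((h.baseChange hB n x).1 hx i)

theorem MemBaseChange.tensorRetract_mem {π : B →ₐ[A] A} (hπ : ∀ i, ∀ c ∈ 𝓑 i, π c ∈ 𝓐 i)
    {c n : ℤ} {z : B ⊗[A] (M0 × M1)} (hz : MemBaseChange hB d M0 M1 c n z) :
    tensorRetract π (M0 × M1) z ∈ superDeg d M0 M1 c n := by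
  have h1 : (tensorRetract π (M0 × M1) z).1 =
      tensorRetract π M0 (TensorProduct.prodRight A B B M0 M1 z).1 := by
    rw [fst_prodRight_baseChange, tensorRetract_baseChange]
    rfl
  have h2 : (tensorRetract π (M0 × M1) z).2 =
      tensorRetract π M1 (TensorProduct.prodRight A B B M0 M1 z).2 := by
    rw [snd_prodRight_baseChange, tensorRetract_baseChange]
    rfl
  obtain ⟨j, rfl | rfl⟩ := Int.even_or_odd' c
  · obtain ⟨h, h'⟩ := mem_superDeg_even.1 hz
    exact mem_superDeg_even.2 ⟨h1 ▸ tensorRetract_mem_deg hB hπ h, by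
      rw [h2]; exact (congrArg _ h').trans (map_zero _)⟩
  · obtain ⟨h, h'⟩ := mem_superDeg_odd.1 hz
    exact mem_superDeg_odd.2 ⟨by rw [h1]; exact (congrArg _ h).trans (map_zero _),
      h2 ▸ tensorRetract_mem_deg hB hπ h'⟩

end GradedFree

namespace GradedMF

variable {f : A} {d : ℤ}

theorem baseChange_prodRight_symm {F G : GradedMF 𝓐 f d} (α : F.Total →ₗ[A] G.Total)
    (x : B ⊗[A] F.F0) (y : B ⊗[A] F.F1) :
    α.baseChange B ((TensorProduct.prodRight A B B F.F0 F.F1).symm (x, y)) =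
      (TensorProduct.prodRight A B B G.F0 G.F1).symm
        ((c00 α).baseChange B x + (c01 α).baseChange B y,
          (c10 α).baseChange B x + (c11 α).baseChange B y) := by
  rw [← LinearEquiv.symm_apply_eq, LinearEquiv.symm_symm]
  have e1 : (LinearMap.fst A G.F0 G.F1 ∘ₗ α) ∘ₗ LinearMap.inl A F.F0 F.F1 = c00 α := rfl
  have e2 : (LinearMap.fst A G.F0 G.F1 ∘ₗ α) ∘ₗ LinearMap.inr A F.F0 F.F1 = c01 α := rfl
  have e3 : (LinearMap.snd A G.F0 G.F1 ∘ₗ α) ∘ₗ LinearMap.inl A F.F0 F.F1 = c10 α := rfl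
  have e4 : (LinearMap.snd A G.F0 G.F1 ∘ₗ α) ∘ₗ LinearMap.inr A F.F0 F.F1 = c11 α := rfl
  refine Prod.ext ?_ ?_
  · rw [fst_prodRight_baseChange, prodRight_symm_apply_eq, ← LinearMap.comp_apply,
      ← LinearMap.baseChange_comp, map_add, ← LinearMap.comp_apply, ← LinearMap.comp_apply,
      ← LinearMap.baseChange_comp, ← LinearMap.baseChange_comp, e1, e2]
  · rw [snd_prodRight_baseChange, prodRight_symm_apply_eq, ← LinearMap.comp_apply,
      ← LinearMap.baseChange_comp, map_add, ← LinearMap.comp_apply, ← LinearMap.comp_apply,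
      ← LinearMap.baseChange_comp, ← LinearMap.baseChange_comp, e3, e4]

/-- The matrix factorization `A' ⇄ A'(l - d)` of `p * q`, given by multiplication by `p` and `q`. -/
def koszul (𝓐' : ℤ → Submodule k A') [SetLike.GradedMonoid 𝓐'] (d l : ℤ) {p q : A'}
    (hp : p ∈ 𝓐' l) (hq : q ∈ 𝓐' (d - l)) : GradedMF 𝓐' (p * q) d where
  F0 := GradedFree.self 𝓐'
  F1 := (GradedFree.self 𝓐').twist (l - d)
  s0 := p • LinearMap.id
  s1 := q • LinearMap.id
  s0_mem n x hx := by
    have h : p * x ∈ 𝓐' (l + n) := SetLike.mul_mem_graded hp hx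
    change p * x ∈ 𝓐' (n + d + (l - d))
    convert h using 2
    ring
  s1_mem n x hx := by
    have h : q * x ∈ 𝓐' (d - l + (n + (l - d))) := SetLike.mul_mem_graded hq hx
    change q * x ∈ 𝓐' (n + 0)
    convert h using 2
    ring
  s0_s1 := by
    rw [LinearMap.smul_comp, LinearMap.comp_smul, smul_smul]
    rfl
  s1_s0 := by
    rw [LinearMap.smul_comp, LinearMap.comp_smul, smul_smul, mul_comm]
    rfl

variable (hB : IsGradedAlgebraMap 𝓐 𝓑) (hB' : IsGradedAlgebraMap 𝓐' 𝓑) {l : ℤ} {p q : A'}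
  (hp : p ∈ 𝓐' l) (hq : q ∈ 𝓐' (d - l))

/-- The isomorphism of `M ⊗ X0` with the extension of scalars of `M`. -/
def extEven (M : GradedFree 𝓐) : ext hB hB' M (koszul 𝓐' d l hp hq).F0 ≃ₗ[B] B ⊗[A] M :=
  tensorUnitEquiv A A' B M

/-- The isomorphism of `M ⊗ X1` with the extension of scalars of `M`. -/
def extOdd (M : GradedFree 𝓐) : ext hB hB' M (koszul 𝓐' d l hp hq).F1 ≃ₗ[B] B ⊗[A] M :=
  tensorUnitEquiv A A' B M

theorem extEven_mem_iff {M : GradedFree 𝓐} (n : ℤ)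
    (z : ext hB hB' M (koszul 𝓐' d l hp hq).F0) :
    (extEven hB hB' hp hq M z : baseChange hB M) ∈ (baseChange hB M).deg n ↔
      z ∈ (ext hB hB' M (koszul 𝓐' d l hp hq).F0).deg n := by
  have h := tensorUnitEquiv_mem_iff (k := k) (A' := A') hB' (baseChange hB M).deg
    (fun _ _ _ _ => smul_mem_deg _) 0 𝓐' (fun _ => by rw [add_zero]) n z
  rw [add_zero] at h
  exact h.symm

theorem extOdd_mem_iff {M : GradedFree 𝓐} (n : ℤ)
    (z : ext hB hB' M (koszul 𝓐' d l hp hq).F1) :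
    (extOdd hB hB' hp hq M z : baseChange hB M) ∈ (baseChange hB M).deg (n + (l - d)) ↔
      z ∈ (ext hB hB' M (koszul 𝓐' d l hp hq).F1).deg n :=
  (tensorUnitEquiv_mem_iff (k := k) (A' := A') hB' (baseChange hB M).deg
    (fun _ _ _ _ => smul_mem_deg _) (l - d) (fun q => 𝓐' (q + (l - d))) (fun _ => rfl) n z).symm

section

variable {M N : GradedFree 𝓐} (g : M →ₗ[A] N)

theorem extEven_extMap (z : ext hB hB' M (koszul 𝓐' d l hp hq).F0) :
    extEven hB hB' hp hq N (extMap hB hB' g LinearMap.id z) =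
      g.baseChange B (extEven hB hB' hp hq M z) :=
  tensorUnitEquiv_map (A' := A') g z

theorem extOdd_extMap (z : ext hB hB' M (koszul 𝓐' d l hp hq).F1) :
    extOdd hB hB' hp hq N (extMap hB hB' g LinearMap.id z) =
      g.baseChange B (extOdd hB hB' hp hq M z) :=
  tensorUnitEquiv_map (A' := A') g z

theorem extOdd_s0 (z : ext hB hB' M (koszul 𝓐' d l hp hq).F0) :
    extOdd hB hB' hp hq M (extMap hB hB' LinearMap.id (koszul 𝓐' d l hp hq).s0 z) =
      algebraMap A' B p • extEven hB hB' hp hq M z := by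
  have h := extMap_smul_right hB hB' (M' := (koszul 𝓐' d l hp hq).F0)
    (N' := (koszul 𝓐' d l hp hq).F1) p (LinearMap.id : M →ₗ[A] M) (LinearMap.id : A' →ₗ[A'] A')
  refine (congrArg (extOdd hB hB' hp hq M) (LinearMap.congr_fun h z)).trans ?_
  rw [LinearMap.smul_apply, map_smul]
  refine congrArg (algebraMap A' B p • ·) ((tensorUnitEquiv_map (A' := A') LinearMap.id z).trans ?_)
  rw [LinearMap.baseChange_id]
  rfl

theorem extEven_s1 (z : ext hB hB' M (koszul 𝓐' d l hp hq).F1) :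
    extEven hB hB' hp hq M (extMap hB hB' LinearMap.id (koszul 𝓐' d l hp hq).s1 z) =
      algebraMap A' B q • extOdd hB hB' hp hq M z := by
  have h := extMap_smul_right hB hB' (M' := (koszul 𝓐' d l hp hq).F1)
    (N' := (koszul 𝓐' d l hp hq).F0) q (LinearMap.id : M →ₗ[A] M) (LinearMap.id : A' →ₗ[A'] A')
  refine (congrArg (extEven hB hB' hp hq M) (LinearMap.congr_fun h z)).trans ?_
  rw [LinearMap.smul_apply, map_smul]
  refine congrArg (algebraMap A' B q • ·) ((tensorUnitEquiv_map (A' := A') LinearMap.id z).trans ?_)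
  rw [LinearMap.baseChange_id]
  rfl

end

/-- The tensor product with the Koszul matrix factorization. -/
abbrev tensorKoszul (F : GradedMF 𝓐 f d) :
    GradedMF 𝓑 (algebraMap A B f + algebraMap A' B (p * q)) d :=
  tensor hB hB' F (koszul 𝓐' d l hp hq)

/-- The total module of the tensor product with a Koszul matrix factorization is the sum of two
copies of `B ⊗ F`. -/
def koszulEquiv (F : GradedMF 𝓐 f d) :
    (tensorKoszul hB hB' hp hq F).Total ≃ₗ[B] (B ⊗[A] F.Total) × (B ⊗[A] F.Total) :=
  -- The summands are regrouped by their factor of `X`: `((a, b), (c, e))` goes to `((a, e), (c,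
  -- b))`, with `X0` in the first pair and `X1` in the second.
  (LinearEquiv.refl B _).prodCongr (LinearEquiv.prodComm B _ _) ≪≫ₗ
    LinearEquiv.prodProdProdComm B _ _ _ _ ≪≫ₗ
    ((extEven hB hB' hp hq F.F0).prodCongr (extEven hB hB' hp hq F.F1) ≪≫ₗ
      (TensorProduct.prodRight A B B F.F0 F.F1).symm).prodCongr
    (LinearEquiv.prodComm B _ _ ≪≫ₗ
      (extOdd hB hB' hp hq F.F0).prodCongr (extOdd hB hB' hp hq F.F1) ≪≫ₗ
      (TensorProduct.prodRight A B B F.F0 F.F1).symm)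

variable {F G : GradedMF 𝓐 f d}

theorem koszulEquiv_fst (z : (tensorKoszul hB hB' hp hq F).Total) :
    (koszulEquiv hB hB' hp hq F z).1 = (TensorProduct.prodRight A B B F.F0 F.F1).symm
      (extEven hB hB' hp hq F.F0 z.1.1, extEven hB hB' hp hq F.F1 z.2.2) := rfl

theorem koszulEquiv_snd (z : (tensorKoszul hB hB' hp hq F).Total) :
    (koszulEquiv hB hB' hp hq F z).2 = (TensorProduct.prodRight A B B F.F0 F.F1).symm
      (extOdd hB hB' hp hq F.F0 z.2.1, extOdd hB hB' hp hq F.F1 z.1.2) := rfl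

/-- The generator of `X1 = A'(l - d)` has degree `d - l` and is odd, so it has bidegree `(1, -l)`.
This is the shift carried by the second copy. -/
theorem koszulEquiv_mem_iff (c n : ℤ) (z : (tensorKoszul hB hB' hp hq F).Total) :
    z ∈ superDeg d (tensorKoszul hB hB' hp hq F).F0 (tensorKoszul hB hB' hp hq F).F1 c n ↔
      MemBaseChange hB d F.F0 F.F1 c n (koszulEquiv hB hB' hp hq F z).1 ∧
        MemBaseChange hB d F.F0 F.F1 (c - 1) (n + l) (koszulEquiv hB hB' hp hq F z).2 := by
  rw [koszulEquiv_fst, koszulEquiv_snd]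
  obtain ⟨j, rfl | rfl⟩ := Int.even_or_odd' c
  · rw [show 2 * j - 1 = 2 * (j - 1) + 1 by ring, mem_superDeg_even,
      memBaseChange_symm_even, memBaseChange_symm_odd]
    have h1 := extEven_mem_iff hB hB' hp hq (n + j * d) z.1.1
    have h2 := extOdd_mem_iff hB hB' hp hq (n + j * d + d) z.1.2
    rw [show n + j * d + d + (l - d) = n + l + (j - 1 + 1) * d by ring] at h2
    constructor
    · rintro ⟨⟨ha, hb⟩, h0⟩
      rw [h0]
      exact ⟨⟨h1.2 ha, map_zero _⟩, map_zero _, h2.2 hb⟩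
    · rintro ⟨⟨ha, h0⟩, h0', hb⟩
      exact ⟨⟨h1.1 ha, h2.1 hb⟩, Prod.ext ((LinearEquiv.map_eq_zero_iff _).1 h0')
        ((LinearEquiv.map_eq_zero_iff _).1 h0)⟩
  · rw [show 2 * j + 1 - 1 = 2 * j by ring, mem_superDeg_odd,
      memBaseChange_symm_even, memBaseChange_symm_odd]
    have h1 := extEven_mem_iff hB hB' hp hq (n + (j + 1) * d) z.2.2
    have h2 := extOdd_mem_iff hB hB' hp hq (n + (j + 1) * d) z.2.1
    rw [show n + (j + 1) * d + (l - d) = n + l + j * d by ring] at h2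
    constructor
    · rintro ⟨h0, hx, he⟩
      rw [h0]
      exact ⟨⟨map_zero _, h1.2 he⟩, h2.2 hx, map_zero _⟩
    · rintro ⟨⟨h0, he⟩, hx, h0'⟩
      exact ⟨Prod.ext ((LinearEquiv.map_eq_zero_iff _).1 h0)
        ((LinearEquiv.map_eq_zero_iff _).1 h0'), h2.1 hx, h1.1 he⟩

theorem components_s (F : GradedMF 𝓐 f d) :
    c00 F.s = 0 ∧ c11 F.s = 0 ∧ c10 F.s = F.s0 ∧ c01 F.s = F.s1 :=
  ⟨by ext; simp [c00, s], by ext; simp [c11, s], rfl, rfl⟩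

/-- The tensor differential is `x ⊗ x' ↦ x ⊗ s'(x') - (-1)^|x'| s(x) ⊗ x'`, so `s` acts with sign
`-1` on the copy for `X0` and `+1` on the copy for `X1`. With `u`, `v` the images of `p`, `q`, this
is the block form `(-s, v; u, s)` of `koszul_exact`. -/
theorem koszulEquiv_s (z : (tensorKoszul hB hB' hp hq F).Total) :
    koszulEquiv hB hB' hp hq F ((tensorKoszul hB hB' hp hq F).s z) =
      (-F.s.baseChange B (koszulEquiv hB hB' hp hq F z).1 +
          algebraMap A' B q • (koszulEquiv hB hB' hp hq F z).2,
        algebraMap A' B p • (koszulEquiv hB hB' hp hq F z).1 +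
          F.s.baseChange B (koszulEquiv hB hB' hp hq F z).2) := by
  obtain ⟨f1, f2, f3, f4⟩ := components_s F
  have h1 : extEven hB hB' hp hq F.F0 ((tensorKoszul hB hB' hp hq F).s z).1.1 =
      algebraMap A' B q • extOdd hB hB' hp hq F.F0 z.2.1 +
        -F.s1.baseChange B (extEven hB hB' hp hq F.F1 z.2.2) := by
    rw [← extEven_s1, ← extEven_extMap, ← map_neg, ← map_add]
    rfl
  have h2 : extEven hB hB' hp hq F.F1 ((tensorKoszul hB hB' hp hq F).s z).2.2 =
      -F.s0.baseChange B (extEven hB hB' hp hq F.F0 z.1.1) +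
        algebraMap A' B q • extOdd hB hB' hp hq F.F1 z.1.2 := by
    rw [← extEven_s1, ← extEven_extMap, ← map_neg, ← map_add]
    rfl
  have h3 : extOdd hB hB' hp hq F.F0 ((tensorKoszul hB hB' hp hq F).s z).2.1 =
      algebraMap A' B p • extEven hB hB' hp hq F.F0 z.1.1 +
        F.s1.baseChange B (extOdd hB hB' hp hq F.F1 z.1.2) := by
    rw [← extOdd_s0, ← extOdd_extMap, ← map_add]
    rfl
  have h4 : extOdd hB hB' hp hq F.F1 ((tensorKoszul hB hB' hp hq F).s z).1.2 =
      F.s0.baseChange B (extOdd hB hB' hp hq F.F0 z.2.1) +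
        algebraMap A' B p • extEven hB hB' hp hq F.F1 z.2.2 := by
    rw [← extOdd_s0, ← extOdd_extMap, ← map_add]
    rfl
  refine Prod.ext ?_ ?_
  · rw [koszulEquiv_fst, h1, h2]
    simp only [koszulEquiv_fst, koszulEquiv_snd]
    rw [baseChange_prodRight_symm, f1, f2, f3, f4, LinearMap.baseChange_zero,
      LinearMap.baseChange_zero, ← map_smul (TensorProduct.prodRight A B B F.F0 F.F1).symm,
      ← map_neg (TensorProduct.prodRight A B B F.F0 F.F1).symm,
      ← map_add (TensorProduct.prodRight A B B F.F0 F.F1).symm]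
    refine congrArg _ (Prod.ext ?_ ?_)
    · simp [add_comm]
    · simp
  · rw [koszulEquiv_snd, h3, h4]
    simp only [koszulEquiv_fst, koszulEquiv_snd]
    rw [baseChange_prodRight_symm, f1, f2, f3, f4, LinearMap.baseChange_zero,
      LinearMap.baseChange_zero, ← map_smul (TensorProduct.prodRight A B B F.F0 F.F1).symm,
      ← map_add (TensorProduct.prodRight A B B F.F0 F.F1).symm]
    refine congrArg _ (Prod.ext ?_ ?_)
    · simp
    · simp [add_comm]

/-- The sign `(-1)^(|α|(i+1))` affects only `i = 0`. Hence the block of the second copy is `α`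
itself, and reading off that block recovers `α` without any sign. -/
theorem koszulEquiv_tensorMap (m : ℤ) (α : F.Total →ₗ[A] G.Total)
    (z : (tensorKoszul hB hB' hp hq F).Total) :
    koszulEquiv hB hB' hp hq G (tensorMap hB hB' (koszul 𝓐' d l hp hq) m α z) =
      (m.negOnePow • α.baseChange B (koszulEquiv hB hB' hp hq F z).1,
        α.baseChange B (koszulEquiv hB hB' hp hq F z).2) := by
  have hu : ∀ {X Y : Type u} [AddCommGroup X] [Module B X] [AddCommGroup Y] [Module B Y]
      (g : X ≃ₗ[B] Y) (x : X), g (m.negOnePow • x) = m.negOnePow • g x := fun g x => by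
    rw [Units.smul_def, Units.smul_def, map_zsmul]
  set W := tensorMap hB hB' (koszul 𝓐' d l hp hq) m α z with hW
  have h1 : extEven hB hB' hp hq G.F0 W.1.1 =
      m.negOnePow • (c00 α).baseChange B (extEven hB hB' hp hq F.F0 z.1.1) +
        m.negOnePow • (c01 α).baseChange B (extEven hB hB' hp hq F.F1 z.2.2) := by
    rw [← extEven_extMap, ← extEven_extMap, ← hu, ← hu, ← map_add]
    rfl
  have h2 : extEven hB hB' hp hq G.F1 W.2.2 =
      m.negOnePow • (c10 α).baseChange B (extEven hB hB' hp hq F.F0 z.1.1) +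
        m.negOnePow • (c11 α).baseChange B (extEven hB hB' hp hq F.F1 z.2.2) := by
    rw [← extEven_extMap, ← extEven_extMap, ← hu, ← hu, ← map_add]
    rfl
  have h3 : extOdd hB hB' hp hq G.F0 W.2.1 =
      (c01 α).baseChange B (extOdd hB hB' hp hq F.F1 z.1.2) +
        (c00 α).baseChange B (extOdd hB hB' hp hq F.F0 z.2.1) := by
    rw [← extOdd_extMap, ← extOdd_extMap, ← map_add]
    rfl
  have h4 : extOdd hB hB' hp hq G.F1 W.1.2 =
      (c11 α).baseChange B (extOdd hB hB' hp hq F.F1 z.1.2) +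
        (c10 α).baseChange B (extOdd hB hB' hp hq F.F0 z.2.1) := by
    rw [← extOdd_extMap, ← extOdd_extMap, ← map_add]
    rfl
  refine Prod.ext ?_ ?_
  · rw [koszulEquiv_fst, h1, h2]
    simp only [koszulEquiv_fst]
    rw [baseChange_prodRight_symm, ← hu]
    refine congrArg _ (Prod.ext ?_ ?_)
    · simp
    · simp
  · rw [koszulEquiv_snd, h3, h4]
    simp only [koszulEquiv_snd]
    rw [baseChange_prodRight_symm]
    refine congrArg _ (Prod.ext ?_ ?_)
    · simp [add_comm]
    · simp [add_comm]

end GradedMF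

end KoszulTensor

/-! ### Comparison of morphism complexes. -/

section KoszulHom

variable {k : Type u} [Field k] {A : Type u} [CommRing A] [Algebra k A]
  {𝓐 : ℤ → Submodule k A} [SetLike.GradedMonoid 𝓐]
  {A' : Type u} [CommRing A'] [Algebra k A'] {𝓐' : ℤ → Submodule k A'}
  [SetLike.GradedMonoid 𝓐']
  {B : Type u} [CommRing B] [Algebra k B] [Algebra A B] [IsScalarTower k A B]
  [Algebra A' B] [IsScalarTower k A' B] {𝓑 : ℤ → Submodule k B} [GradedAlgebra 𝓑]

open GradedFree

namespace GradedMF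

variable {f : A} {d : ℤ} (hB : IsGradedAlgebraMap 𝓐 𝓑) (hB' : IsGradedAlgebraMap 𝓐' 𝓑) {l : ℤ}
  {p q : A'} (hp : p ∈ 𝓐' l) (hq : q ∈ 𝓐' (d - l)) {F G : GradedMF 𝓐 f d}

/-- Signs are replaced by scalars of `B`, so that they can be handled as ring elements in linear
identities. -/
theorem intCast_units_smul {R M : Type*} [Ring R] [AddCommGroup M] [Module R M] (e : ℤˣ) (x : M) :
    ((e : ℤ) : R) • x = e • x := by
  rw [Int.cast_smul_eq_zsmul, Units.smul_def]

/-- A morphism of tensor products with a Koszul matrix factorization, as a `2 × 2` matrix. -/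
def koszulBlocks (Φ : (tensorKoszul hB hB' hp hq F).Total →ₗ[B] (tensorKoszul hB hB' hp hq G).Total) :
    (B ⊗[A] F.Total) × (B ⊗[A] F.Total) →ₗ[B] (B ⊗[A] G.Total) × (B ⊗[A] G.Total) :=
  (koszulEquiv hB hB' hp hq G).toLinearMap ∘ₗ Φ ∘ₗ (koszulEquiv hB hB' hp hq F).symm.toLinearMap

/-- The morphism with a given `2 × 2` matrix. -/
def ofKoszulBlocks
    (T : (B ⊗[A] F.Total) × (B ⊗[A] F.Total) →ₗ[B] (B ⊗[A] G.Total) × (B ⊗[A] G.Total)) :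
    (tensorKoszul hB hB' hp hq F).Total →ₗ[B] (tensorKoszul hB hB' hp hq G).Total :=
  (koszulEquiv hB hB' hp hq G).symm.toLinearMap ∘ₗ T ∘ₗ (koszulEquiv hB hB' hp hq F).toLinearMap

theorem koszulEquiv_apply (Φ : (tensorKoszul hB hB' hp hq F).Total →ₗ[B]
    (tensorKoszul hB hB' hp hq G).Total) (z : (tensorKoszul hB hB' hp hq F).Total) :
    koszulEquiv hB hB' hp hq G (Φ z) =
      koszulBlocks hB hB' hp hq Φ (koszulEquiv hB hB' hp hq F z) := by
  simp [koszulBlocks]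

theorem koszulBlocks_ofKoszulBlocks
    (T : (B ⊗[A] F.Total) × (B ⊗[A] F.Total) →ₗ[B] (B ⊗[A] G.Total) × (B ⊗[A] G.Total)) :
    koszulBlocks hB hB' hp hq (ofKoszulBlocks hB hB' hp hq T) = T := by
  refine LinearMap.ext fun x => ?_
  simp [koszulBlocks, ofKoszulBlocks]

theorem koszulBlocks_ext {Φ Ψ : (tensorKoszul hB hB' hp hq F).Total →ₗ[B]
    (tensorKoszul hB hB' hp hq G).Total}
    (h : ∀ x, koszulBlocks hB hB' hp hq Φ x = koszulBlocks hB hB' hp hq Ψ x) : Φ = Ψ := by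
  refine LinearMap.ext fun z => (koszulEquiv hB hB' hp hq G).injective ?_
  rw [koszulEquiv_apply, koszulEquiv_apply, h]

theorem koszulBlocks_tensorMap (m : ℤ) (α : F.Total →ₗ[A] G.Total)
    (x : (B ⊗[A] F.Total) × (B ⊗[A] F.Total)) :
    koszulBlocks hB hB' hp hq (tensorMap hB hB' (koszul 𝓐' d l hp hq) m α) x =
      (((m.negOnePow : ℤ) : B) • α.baseChange B x.1, α.baseChange B x.2) := by
  obtain ⟨z, rfl⟩ := (koszulEquiv hB hB' hp hq F).surjective x
  rw [← koszulEquiv_apply, koszulEquiv_tensorMap]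
  exact Prod.ext (intCast_units_smul _ _).symm rfl

theorem koszulBlocks_diff (m : ℤ) (Ψ : (tensorKoszul hB hB' hp hq F).Total →ₗ[B]
    (tensorKoszul hB hB' hp hq G).Total) (x : (B ⊗[A] F.Total) × (B ⊗[A] F.Total)) :
    koszulBlocks hB hB' hp hq ((tensorKoszul hB hB' hp hq G).s ∘ₗ Ψ -
        m.negOnePow • (Ψ ∘ₗ (tensorKoszul hB hB' hp hq F).s)) x =
      (-G.s.baseChange B (koszulBlocks hB hB' hp hq Ψ x).1 +
          algebraMap A' B q • (koszulBlocks hB hB' hp hq Ψ x).2,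
        algebraMap A' B p • (koszulBlocks hB hB' hp hq Ψ x).1 +
          G.s.baseChange B (koszulBlocks hB hB' hp hq Ψ x).2) -
      ((m.negOnePow : ℤ) : B) • koszulBlocks hB hB' hp hq Ψ
        (-F.s.baseChange B x.1 + algebraMap A' B q • x.2,
          algebraMap A' B p • x.1 + F.s.baseChange B x.2) := by
  obtain ⟨z, rfl⟩ := (koszulEquiv hB hB' hp hq F).surjective x
  rw [← koszulEquiv_apply, ← koszulEquiv_apply, ← koszulEquiv_s, ← koszulEquiv_s,
    ← koszulEquiv_apply, ← map_smul, ← map_sub]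
  exact congrArg (fun y => koszulEquiv hB hB' hp hq G ((tensorKoszul hB hB' hp hq G).s (Ψ z) - y))
    (intCast_units_smul _ _).symm

variable (π : B →ₐ[A] A)

/-- The constant term of the last entry of the `2 × 2` matrix of a morphism. -/
def koszulConst (Φ : (tensorKoszul hB hB' hp hq F).Total →ₗ[B] (tensorKoszul hB hB' hp hq G).Total) :
    F.Total →ₗ[A] G.Total :=
  tensorRetract π G.Total ∘ₗ
    (LinearMap.snd B _ _ ∘ₗ koszulBlocks hB hB' hp hq Φ ∘ₗ LinearMap.inr B _ _).restrictScalars A ∘ₗ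
    TensorProduct.mk A B F.Total 1

theorem koszulConst_apply (Φ : (tensorKoszul hB hB' hp hq F).Total →ₗ[B]
    (tensorKoszul hB hB' hp hq G).Total) (x : F.Total) :
    koszulConst hB hB' hp hq π Φ x =
      tensorRetract π G.Total (koszulBlocks hB hB' hp hq Φ (0, 1 ⊗ₜ x)).2 := rfl

theorem koszulConst_mem (hπ : ∀ i, ∀ c ∈ 𝓑 i, π c ∈ 𝓐 i) {m : ℤ}
    {Φ : (tensorKoszul hB hB' hp hq F).Total →ₗ[B] (tensorKoszul hB hB' hp hq G).Total}
    (hΦ : Φ ∈ homDeg (tensorKoszul hB hB' hp hq F) (tensorKoszul hB hB' hp hq G) m) :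
    koszulConst hB hB' hp hq π Φ ∈ homDeg F G m := by
  rw [mem_homDeg_iff_isBihom] at hΦ ⊢
  intro c n x hx
  rw [koszulConst_apply]
  obtain ⟨z, hz⟩ := (koszulEquiv hB hB' hp hq F).surjective (0, 1 ⊗ₜ x)
  -- The bidegree shift `(1, -l)` of the second copy is added at the source and removed at the
  -- target, so the constant term keeps the bidegree of `Φ`.
  have h1 : z ∈ superDeg d (tensorKoszul hB hB' hp hq F).F0 (tensorKoszul hB hB' hp hq F).F1
      (c + 1) (n - l) := by
    rw [koszulEquiv_mem_iff, hz]
    refine ⟨?_, ?_⟩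
    · rw [MemBaseChange, map_zero]
      exact zero_mem _
    · rw [add_sub_cancel_right, sub_add_cancel]
      exact memBaseChange_one_tmul hB hx
  have h2 := hΦ _ _ _ h1
  rw [koszulEquiv_mem_iff, koszulEquiv_apply, hz] at h2
  have h3 := h2.2.tensorRetract_mem hB hπ
  rwa [show c + 1 + m - 1 = c + m by ring, show n - l + 0 + l = n + 0 by ring] at h3

variable {π}

theorem koszulConst_tensorMap (m : ℤ) (α : F.Total →ₗ[A] G.Total) :
    koszulConst hB hB' hp hq π (tensorMap hB hB' (koszul 𝓐' d l hp hq) m α) = α := by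
  refine LinearMap.ext fun x => ?_
  rw [koszulConst_apply, koszulBlocks_tensorMap, LinearMap.baseChange_tmul, tensorRetract_tmul,
    map_one, one_smul]

/-- The differential sends `(0, 1 ⊗ x)` to `(v ⊗ x, 1 ⊗ s x)`, and the last row of the target
differential is `(u, s)`. The terms with a factor `u` or `v` die under `π`, and `s` is what remains
on either side. -/
theorem koszulConst_diff (hpi : IsKoszulRetract π (algebraMap A' B p) (algebraMap A' B q)) (m : ℤ)
    (Ψ : (tensorKoszul hB hB' hp hq F).Total →ₗ[B] (tensorKoszul hB hB' hp hq G).Total) :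
    koszulConst hB hB' hp hq π ((tensorKoszul hB hB' hp hq G).s ∘ₗ Ψ -
        m.negOnePow • (Ψ ∘ₗ (tensorKoszul hB hB' hp hq F).s)) =
      G.s ∘ₗ koszulConst hB hB' hp hq π Ψ -
        m.negOnePow • (koszulConst hB hB' hp hq π Ψ ∘ₗ F.s) := by
  refine LinearMap.ext fun x => ?_
  have h1 : koszulBlocks hB hB' hp hq Ψ (algebraMap A' B q • (1 ⊗ₜ x : B ⊗[A] F.Total),
      1 ⊗ₜ F.s x) = algebraMap A' B q • koszulBlocks hB hB' hp hq Ψ (1 ⊗ₜ x, 0) +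
        koszulBlocks hB hB' hp hq Ψ (0, 1 ⊗ₜ F.s x) := by
    rw [← map_smul, ← map_add]
    simp
  rw [koszulConst_apply, koszulBlocks_diff]
  simp only [map_zero, neg_zero, zero_add, smul_zero, LinearMap.baseChange_tmul]
  rw [h1]
  simp only [Prod.snd_sub, Prod.snd_add, Prod.smul_snd, map_sub, map_add, tensorRetract_smul,
    tensorRetract_baseChange, hpi.map_u, hpi.map_v, zero_smul, zero_add, map_intCast,
    Int.cast_smul_eq_zsmul]
  rfl

/-- Injectivity on cohomology: the chain-level left inverse turns a bounding morphism of `α ⊗ id`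
into one of `α`. The exponent `m'` may be arbitrary because the sign it controls is invisible in the
last block. -/
theorem exists_boundary_of_tensorMap
    (hpi : IsKoszulRetract π (algebraMap A' B p) (algebraMap A' B q))
    (hπ : ∀ i, ∀ c ∈ 𝓑 i, π c ∈ 𝓐 i) {m m' : ℤ} {α : F.Total →ₗ[A] G.Total}
    {Ψ : (tensorKoszul hB hB' hp hq F).Total →ₗ[B] (tensorKoszul hB hB' hp hq G).Total}
    (hΨ : Ψ ∈ homDeg (tensorKoszul hB hB' hp hq F) (tensorKoszul hB hB' hp hq G) m)
    (h : tensorMap hB hB' (koszul 𝓐' d l hp hq) m' α = (tensorKoszul hB hB' hp hq G).s ∘ₗ Ψ -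
      m.negOnePow • (Ψ ∘ₗ (tensorKoszul hB hB' hp hq F).s)) :
    ∃ ψ ∈ homDeg F G m, α = G.s ∘ₗ ψ - m.negOnePow • (ψ ∘ₗ F.s) :=
  ⟨koszulConst hB hB' hp hq π Ψ, koszulConst_mem hB hB' hp hq π hπ hΨ, by
    rw [← koszulConst_diff hB hB' hp hq hpi, ← h, koszulConst_tensorMap]⟩

theorem intCast_negOnePow_eq {R : Type*} [Ring R] (m : ℤ) :
    ((m.negOnePow : ℤ) : R) = 1 ∨ ((m.negOnePow : ℤ) : R) = -1 := by
  obtain h | h := Int.even_or_odd m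
  · left; simp [Int.negOnePow_even m h]
  · right; simp [Int.negOnePow_odd m h]

/-- Vanishing of the constant term puts the last block in `(u, v)`, which is the input of
`koszul_exact`. No homogeneity is claimed for `Ψ`; `exists_homDeg_boundary` restores it afterwards.
-/
theorem exists_boundary_of_koszulConst_eq_zero
    (hpi : IsKoszulRetract π (algebraMap A' B p) (algebraMap A' B q)) {m : ℤ}
    {Φ : (tensorKoszul hB hB' hp hq F).Total →ₗ[B] (tensorKoszul hB hB' hp hq G).Total}
    (hcl : (tensorKoszul hB hB' hp hq G).s ∘ₗ Φ -
      (m + 1).negOnePow • (Φ ∘ₗ (tensorKoszul hB hB' hp hq F).s) = 0)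
    (h0 : koszulConst hB hB' hp hq π Φ = 0) :
    ∃ Ψ : (tensorKoszul hB hB' hp hq F).Total →ₗ[B] (tensorKoszul hB hB' hp hq G).Total,
      Φ = (tensorKoszul hB hB' hp hq G).s ∘ₗ Ψ -
        m.negOnePow • (Ψ ∘ₗ (tensorKoszul hB hB' hp hq F).s) := by
  obtain ⟨ι, _, _, b, c, a, hb⟩ := exists_isBihomogeneousBasis d F.F0 F.F1
  obtain ⟨ι', _, _, b', c', a', hb'⟩ := exists_isBihomogeneousBasis d G.F0 G.F1
  set T := koszulBlocks hB hB' hp hq Φ with hT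
  set T00 := LinearMap.fst B _ _ ∘ₗ T ∘ₗ LinearMap.inl B _ _ with hT00
  set T01 := LinearMap.fst B _ _ ∘ₗ T ∘ₗ LinearMap.inr B _ _ with hT01
  set T10 := LinearMap.snd B _ _ ∘ₗ T ∘ₗ LinearMap.inl B _ _ with hT10
  set T11 := LinearMap.snd B _ _ ∘ₗ T ∘ₗ LinearMap.inr B _ _ with hT11
  have hTx : ∀ x y, T (x, y) = (T00 x + T01 y, T10 x + T11 y) := fun x y => by
    have : T (x, y) = T (x, 0) + T (0, y) := by rw [← map_add]; simp
    rw [this]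
    rfl
  obtain ⟨x, y, hxy⟩ := hpi.exists_linearMap_of_retract b' (b.baseChange B) T11 fun j => by
    rw [Module.Basis.baseChange_apply]
    exact LinearMap.congr_fun h0 (b j)
  have hsF : ∀ z : B ⊗[A] F.Total,
      F.s.baseChange B (F.s.baseChange B z) = algebraMap A B f • z := fun z => by
    rw [← LinearMap.comp_apply, ← LinearMap.baseChange_comp, F.s_comp_s, LinearMap.baseChange_smul,
      LinearMap.smul_apply, LinearMap.baseChange_id, LinearMap.id_apply, algebraMap_smul]
  have hsG : ∀ z : B ⊗[A] G.Total,
      G.s.baseChange B (G.s.baseChange B z) = algebraMap A B f • z := fun z => by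
    rw [← LinearMap.comp_apply, ← LinearMap.baseChange_comp, G.s_comp_s, LinearMap.baseChange_smul,
      LinearMap.smul_apply, LinearMap.baseChange_id, LinearMap.id_apply, algebraMap_smul]
  have he' : (((m + 1).negOnePow : ℤ) : B) = -((m.negOnePow : ℤ) : B) := by
    rw [Int.negOnePow_succ]; simp
  -- Closedness is needed only on the second copy: its two components are the two equations that
  -- `koszul_exact` requires.
  have hcl' : ∀ z, _ := fun z => (koszulBlocks_diff hB hB' hp hq (m + 1) Φ (0, z)).symm.trans
    (congrArg (fun Ψ => koszulBlocks hB hB' hp hq Ψ (0, z)) hcl)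
  have hz0 : ∀ z, koszulBlocks hB hB' hp hq (0 : (tensorKoszul hB hB' hp hq F).Total →ₗ[B]
      (tensorKoszul hB hB' hp hq G).Total) z = 0 := fun z => by simp [koszulBlocks]
  simp only [← hT, hTx, map_zero, neg_zero, zero_add, smul_zero, he', hz0] at hcl'
  obtain ⟨ψ00, ψ01, ψ10, ψ11, h00, h01, h10, h11⟩ := koszul_exact (φ00 := T00) (φ01 := T01)
    (φ10 := T10) hsF hsG (hpi.exists_linearMap_of_eq b' (b.baseChange B))
    (hpi.eq_zero_of_smul b' (b.baseChange B)) (intCast_negOnePow_eq (R := B) m) hxy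
    (fun n => by
      have := congrArg Prod.fst (hcl' n)
      simp only [Prod.fst_sub, Prod.smul_fst, Prod.fst_zero, map_smul] at this
      rw [← this]
      module)
    (fun n => by
      have := congrArg Prod.snd (hcl' n)
      simp only [Prod.snd_sub, Prod.smul_snd, Prod.snd_zero, map_smul] at this
      rw [← this]
      module)
  -- The regrouping of terms is isolated as an identity between arbitrary vectors, for the first and
  -- second components separately.
  have aux₀ : ∀ (e r : B) (s₁ s₂ y₁ y₂ t₁ t₂ x₁ x₂ : B ⊗[A] G.Total),
      -s₁ + r • y₁ - e • (-t₁ + x₁) + (-s₂ + r • y₂ - e • (x₂ + t₂)) =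
        -(s₁ + s₂) + r • (y₁ + y₂) - e • (-t₁ + x₂ + (x₁ + t₂)) := by
    intros
    module
  have aux₁ : ∀ (e r : B) (s₁ s₂ y₁ y₂ t₁ t₂ x₁ x₂ : B ⊗[A] G.Total),
      r • y₁ + s₁ - e • (-t₁ + x₁) + (r • y₂ + s₂ - e • (x₂ + t₂)) =
        r • (y₁ + y₂) + (s₁ + s₂) - e • (-t₁ + x₂ + (x₁ + t₂)) := by
    intros
    module
  refine ⟨ofKoszulBlocks hB hB' hp hq ((ψ00.coprod ψ01).prod (ψ10.coprod ψ11)),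
    koszulBlocks_ext hB hB' hp hq fun z => ?_⟩
  obtain ⟨z, w⟩ := z
  rw [koszulBlocks_diff, koszulBlocks_ofKoszulBlocks, ← hT, hTx]
  simp only [LinearMap.prod_apply, Function.prod, LinearMap.coprod_apply, map_add, map_smul, map_neg]
  refine Prod.ext ?_ ?_
  · simp only [Prod.fst_sub, Prod.smul_fst]
    rw [h00 z, h01 w]
    exact aux₀ _ _ _ _ _ _ _ _ _ _
  · simp only [Prod.snd_sub, Prod.smul_snd]
    rw [h10 z, h11 w]
    exact aux₁ _ _ _ _ _ _ _ _ _ _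

/-- Surjectivity on cohomology: with `α` the constant term of `Φ`, the difference `Φ - α ⊗ id` is
closed with zero constant term, hence a boundary, and the bounding map can be made homogeneous. -/
theorem exists_eq_tensorMap_add_boundary
    (hpi : IsKoszulRetract π (algebraMap A' B p) (algebraMap A' B q))
    (hπ : ∀ i, ∀ c ∈ 𝓑 i, π c ∈ 𝓐 i) {m : ℤ}
    {Φ : (tensorKoszul hB hB' hp hq F).Total →ₗ[B] (tensorKoszul hB hB' hp hq G).Total}
    (hΦ : Φ ∈ homDeg (tensorKoszul hB hB' hp hq F) (tensorKoszul hB hB' hp hq G) (m + 1))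
    (hcl : (tensorKoszul hB hB' hp hq G).s ∘ₗ Φ -
      (m + 1).negOnePow • (Φ ∘ₗ (tensorKoszul hB hB' hp hq F).s) = 0) :
    ∃ α ∈ homDeg F G (m + 1), G.s ∘ₗ α - (m + 1).negOnePow • (α ∘ₗ F.s) = 0 ∧
      ∃ Ψ ∈ homDeg (tensorKoszul hB hB' hp hq F) (tensorKoszul hB hB' hp hq G) m,
        Φ = tensorMap hB hB' (koszul 𝓐' d l hp hq) (m + 1) α +
          ((tensorKoszul hB hB' hp hq G).s ∘ₗ Ψ -
            m.negOnePow • (Ψ ∘ₗ (tensorKoszul hB hB' hp hq F).s)) := by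
  have h0 : koszulConst hB hB' hp hq π (0 : (tensorKoszul hB hB' hp hq F).Total →ₗ[B]
      (tensorKoszul hB hB' hp hq G).Total) = 0 := by
    refine LinearMap.ext fun x => ?_
    simp [koszulConst_apply, koszulBlocks]
  have hαm := koszulConst_mem hB hB' hp hq π hπ hΦ
  have hα : G.s ∘ₗ koszulConst hB hB' hp hq π Φ -
      (m + 1).negOnePow • (koszulConst hB hB' hp hq π Φ ∘ₗ F.s) = 0 := by
    rw [← koszulConst_diff hB hB' hp hq hpi, hcl, h0]
  have ht0 : tensorMap hB hB' (koszul 𝓐' d l hp hq) (m + 1 + 1) (0 : F.Total →ₗ[A] G.Total) = 0 := by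
    have := tensorMap_smul hB hB' (koszul 𝓐' d l hp hq) (m + 1 + 1) (0 : k)
      (0 : F.Total →ₗ[A] G.Total)
    rwa [zero_smul, zero_smul] at this
  have htm := tensorMap_diff hB hB' (koszul 𝓐' d l hp hq) (m := m + 1)
    (koszulConst hB hB' hp hq π Φ)
  rw [hα, ht0] at htm
  have hsub : Φ - tensorMap hB hB' (koszul 𝓐' d l hp hq) (m + 1)
      (koszulConst hB hB' hp hq π Φ) ∈
        homDeg (tensorKoszul hB hB' hp hq F) (tensorKoszul hB hB' hp hq G) (m + 1) :=
    sub_mem hΦ (tensorMap_mem_homDeg hB hB' _ hαm)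
  obtain ⟨Ψ, hΨ⟩ := exists_boundary_of_koszulConst_eq_zero hB hB' hp hq hpi (m := m)
    (Φ := Φ - tensorMap hB hB' (koszul 𝓐' d l hp hq) (m + 1) (koszulConst hB hB' hp hq π Φ))
    (by
      rw [LinearMap.comp_sub, LinearMap.sub_comp, smul_sub, sub_sub_sub_comm, hcl]
      exact (congrArg (0 - ·) htm).trans (sub_zero _))
    (LinearMap.ext fun x => by
      have h1 := LinearMap.congr_fun (koszulConst_tensorMap hB hB' hp hq (π := π) (m + 1)
        (koszulConst hB hB' hp hq π Φ)) x
      have h2 : koszulConst hB hB' hp hq π (Φ - tensorMap hB hB' (koszul 𝓐' d l hp hq) (m + 1)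
          (koszulConst hB hB' hp hq π Φ)) x = koszulConst hB hB' hp hq π Φ x -
          koszulConst hB hB' hp hq π (tensorMap hB hB' (koszul 𝓐' d l hp hq) (m + 1)
          (koszulConst hB hB' hp hq π Φ)) x := by
        simp [koszulConst_apply, koszulBlocks]
      rw [h2, h1, sub_self]
      rfl)
  obtain ⟨Ψ', hΨ', e⟩ := exists_homDeg_boundary hsub Ψ hΨ
  exact ⟨_, hαm, hα, Ψ', hΨ', by rw [← e, add_sub_cancel]⟩

end GradedMF

end KoszulHom

/-! ### Square roots of `f + u v` -/

/-- The properties of the endomorphisms `u ↦ 0` and `v ↦ 0` of a matrix ring over `A[u, v]`. -/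
structure IsKoszulEval {K R : Type*} [CommRing K] [Ring R] [Algebra K R] (u v : K)
    (εu εv : R →+* R) : Prop where
  u_smul : ∀ x, εu (u • x) = 0
  v_smul : ∀ x, εv (v • x) = 0
  u_smul_v : ∀ x, εu (v • x) = v • εu x
  v_smul_u : ∀ x, εv (u • x) = u • εv x
  u_reg : ∀ x : R, u • x = 0 → x = 0
  v_reg : ∀ x : R, v • x = 0 → x = 0
  exists_u : ∀ x, ∃ y, x = εu x + u • y
  exists_v : ∀ x, ∃ y, x = εv x + v • y
  comm : ∀ x, εu (εv x) = εv (εu x)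

namespace IsKoszulEval

variable {K R : Type*} [CommRing K] [Ring R] [Algebra K R] {u v f : K} {εu εv : R →+* R}
  (h : IsKoszulEval u v εu εv)

theorem symm (h : IsKoszulEval u v εu εv) : IsKoszulEval v u εv εu where
  u_smul := h.v_smul
  v_smul := h.u_smul
  u_smul_v := h.v_smul_u
  v_smul_u := h.u_smul_v
  u_reg := h.v_reg
  v_reg := h.u_reg
  exists_u := h.exists_v
  exists_v := h.exists_u
  comm x := (h.comm x).symm

variable {S X : R}

theorem εu_εu (h : IsKoszulEval u v εu εv) (x : R) : εu (εu x) = εu x := by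
  obtain ⟨y, hy⟩ := h.exists_u x
  have := congrArg εu hy
  rw [map_add, h.u_smul, add_zero] at this
  exact this.symm

theorem mul_self_εu (h : IsKoszulEval u v εu εv) (hf : εu (f • 1) = f • 1)
    (hS : S * S = (f + u * v) • (1 : R)) : εu S * εu S = f • 1 := by
  rw [← map_mul, hS, add_smul, mul_smul, map_add, h.u_smul, hf, add_zero]

/-- `X` is a noncommutative divided difference: with `S₀ = εu S` one has `S² - S₀² = u (S₀ X + X
S)`, while the left side is `u v`. Cancel `u`. The companion `mul_εu_add` expands the square in the
other order. -/
theorem εu_mul_add (h : IsKoszulEval u v εu εv) (hf : εu (f • 1) = f • 1)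
    (hS : S * S = (f + u * v) • (1 : R)) (hX : S = εu S + u • X) : εu S * X + X * S = v • 1 := by
  refine sub_eq_zero.1 (h.u_reg _ ?_)
  have h1 := h.mul_self_εu hf hS
  have h2 : εu S * S = εu S * εu S + u • (εu S * X) := by
    conv_lhs => rw [hX, map_add, h.u_smul, add_zero, h.εu_εu, mul_add, mul_smul_comm]
  have h3 : S * S = εu S * S + u • (X * S) := by
    conv_lhs => rw [hX, add_mul, ← hX, smul_mul_assoc]
  rw [h2, hS, h1] at h3
  linear_combination (norm := module) -h3

theorem mul_εu_add (h : IsKoszulEval u v εu εv) (hf : εu (f • 1) = f • 1)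
    (hS : S * S = (f + u * v) • (1 : R)) (hX : S = εu S + u • X) : X * εu S + S * X = v • 1 := by
  refine sub_eq_zero.1 (h.u_reg _ ?_)
  have h1 := h.mul_self_εu hf hS
  have h2 : S * εu S = εu S * εu S + u • (X * εu S) := by
    conv_lhs => rw [hX, map_add, h.u_smul, add_zero, h.εu_εu, add_mul, smul_mul_assoc]
  have h3 : S * S = S * εu S + u • (S * X) := by
    conv_lhs => rw [hX, mul_add, ← hX, mul_smul_comm]
  rw [h2, hS, h1] at h3
  linear_combination (norm := module) -h3

theorem εv_mul_eq (h : IsKoszulEval u v εu εv) (hf : εu (f • 1) = f • 1)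
    (hS : S * S = (f + u * v) • (1 : R)) (hX : S = εu S + u • X) :
    εv X * εv S = -(εv (εu S) * εv X) := by
  have := congrArg εv (h.εu_mul_add hf hS hX)
  rw [h.v_smul, map_add, map_mul, map_mul] at this
  exact eq_neg_of_add_eq_zero_right this

theorem mul_εv_eq (h : IsKoszulEval u v εu εv) (hf : εu (f • 1) = f • 1)
    (hS : S * S = (f + u * v) • (1 : R)) (hX : S = εu S + u • X) :
    εv S * εv X = -(εv X * εv (εu S)) := by
  have := congrArg εv (h.mul_εu_add hf hS hX)
  rw [h.v_smul, map_add, map_mul, map_mul] at this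
  exact eq_neg_of_add_eq_zero_right this

variable {Y : R}

/-- Together with the next three identities this says that the column `(εv X, εv X * Y)` and the row
`(εu Y, X * εu Y)` are closed maps between `S` and the block differential `(-T, v; u, T)`, where `T
= εu (εv S)`. -/
theorem into_fst (h : IsKoszulEval u v εu εv) (hf : εu (f • 1) = f • 1)
    (hS : S * S = (f + u * v) • (1 : R)) (hX : S = εu S + u • X) (hY : S = εv S + v • Y) :
    εv X * S = -(εu (εv S) * εv X) + v • (εv X * Y) := by
  conv_lhs => rw [hY, mul_add, mul_smul_comm, h.εv_mul_eq hf hS hX, ← h.comm]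

theorem into_snd (h : IsKoszulEval u v εu εv) (hf : εu (f • 1) = f • 1) (hf' : εv (f • 1) = f • 1)
    (hS : S * S = (f + u * v) • (1 : R)) (hX : S = εu S + u • X) (hY : S = εv S + v • Y) :
    εv X * Y * S = u • εv X + εu (εv S) * (εv X * Y) := by
  have h1 := h.symm.εu_mul_add hf' (by rwa [mul_comm v u]) hY
  have h2 := h.εv_mul_eq hf hS hX
  rw [mul_assoc, eq_sub_of_add_eq' h1, mul_sub, ← mul_assoc, h2, ← h.comm, mul_smul_comm, mul_one,
    neg_mul, sub_neg_eq_add, mul_assoc]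

theorem from_fst (h : IsKoszulEval u v εu εv) (hf' : εv (f • 1) = f • 1)
    (hS : S * S = (f + u * v) • (1 : R)) (hX : S = εu S + u • X) (hY : S = εv S + v • Y) :
    S * εu Y = -(εu Y * εu (εv S)) + u • (X * εu Y) := by
  have h1 := h.symm.mul_εv_eq hf' (by rwa [mul_comm v u]) hY
  conv_lhs => rw [hX, add_mul, smul_mul_assoc, h1]

theorem from_snd (h : IsKoszulEval u v εu εv) (hf : εu (f • 1) = f • 1) (hf' : εv (f • 1) = f • 1)
    (hS : S * S = (f + u * v) • (1 : R)) (hX : S = εu S + u • X) (hY : S = εv S + v • Y) :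
    S * (X * εu Y) = v • εu Y + X * εu Y * εu (εv S) := by
  have h1 := h.symm.mul_εv_eq hf' (by rwa [mul_comm v u]) hY
  have h2 := h.mul_εu_add hf hS hX
  rw [← mul_assoc, eq_sub_of_add_eq' h2, sub_mul, mul_assoc, h1, smul_mul_assoc, one_mul, mul_neg,
    sub_neg_eq_add, mul_assoc]

/-- The element is the composite of the row with the column, and a composite of closed maps is
closed. -/
theorem comp_commute (h : IsKoszulEval u v εu εv) (hf : εu (f • 1) = f • 1)
    (hf' : εv (f • 1) = f • 1)
    (hS : S * S = (f + u * v) • (1 : R)) (hX : S = εu S + u • X) (hY : S = εv S + v • Y) :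
    S * (εu Y * εv X + X * εu Y * (εv X * Y)) = (εu Y * εv X + X * εu Y * (εv X * Y)) * S := by
  have e1 := h.into_fst hf hS hX hY
  have e2 := h.into_snd hf hf' hS hX hY
  have e3 := h.from_fst hf' hS hX hY
  have e4 := h.from_snd hf hf' hS hX hY
  calc _ = S * εu Y * εv X + S * (X * εu Y) * (εv X * Y) := by noncomm_ring
    _ = εu Y * (εv X * S) + X * εu Y * (εv X * Y * S) := by
      rw [e1, e2, e3, e4]
      simp only [mul_add, add_mul, mul_neg, neg_mul, smul_mul_assoc, mul_smul_comm, mul_assoc]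
      abel
    _ = _ := by noncomm_ring

/-- An element commuting with `S` that lies in the ideal `(u, v)` is null-homotopic. -/
theorem exists_anticommutator_of_eval_eq_zero (h : IsKoszulEval u v εu εv) {c : K}
    (hS : S * S = c • (1 : R)) {α β : R} (hα : S * α + α * S = v • 1)
    (hβ : S * β + β * S = u • 1) {z : R} (hz : S * z = z * S) (hz0 : εu (εv z) = 0) :
    ∃ t, z = S * t + t * S := by
  obtain ⟨y₂, h₂⟩ := h.exists_v z
  obtain ⟨y₁, h₁⟩ := h.exists_u (εv z)
  rw [hz0, zero_add] at h₁
  rw [h₁] at h₂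
  -- In `z = u y₁ + v y₂` the coefficients need not commute with `S` separately. Since `z` does, `u`
  -- divides the commutator of `S` and `y₂`, after cancelling `v`.
  have h3 : v • (S * y₂ - y₂ * S) = -(u • (S * y₁ - y₁ * S)) := by
    rw [h₂] at hz
    simp only [mul_add, add_mul, smul_mul_assoc, mul_smul_comm] at hz
    linear_combination (norm := module) hz
  obtain ⟨w, hw⟩ := h.exists_u (S * y₂ - y₂ * S)
  have h4 : εu (S * y₂ - y₂ * S) = 0 := h.v_reg _ (by
    rw [← h.u_smul_v, h3, map_neg, h.u_smul, neg_zero])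
  rw [h4, zero_add] at hw
  -- Multiplying `S α + α S = v` by `y₂` makes `v y₂` a boundary up to the error `u α w`, which is
  -- absorbed into the part divisible by `u`.
  have h5 : v • y₂ = S * (α * y₂) + α * y₂ * S + u • (α * w) := by
    have e1 : v • y₂ = (S * α + α * S) * y₂ := by rw [hα, smul_mul_assoc, one_mul]
    have e2 : u • (α * w) = α * (S * y₂ - y₂ * S) := by rw [hw, mul_smul_comm]
    rw [e1, e2]
    noncomm_ring
  -- Both `z` and the boundary just removed commute with `S` (its square is scalar), so the new
  -- coefficient of `u` does too; then `β` bounds that last term.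
  have h6 : S * (y₁ + α * w) = (y₁ + α * w) * S := by
    refine sub_eq_zero.1 (h.u_reg _ ?_)
    have e1 : u • (y₁ + α * w) = z - (S * (α * y₂) + α * y₂ * S) := by
      rw [h₂, h5, smul_add]; abel
    rw [smul_sub, ← mul_smul_comm, ← smul_mul_assoc, e1]
    have e2 : S * S * (α * y₂) = α * y₂ * (S * S) := by
      rw [hS, smul_mul_assoc, mul_smul_comm, one_mul, mul_one]
    linear_combination (norm := noncomm_ring) hz - e2
  refine ⟨α * y₂ + β * (y₁ + α * w), ?_⟩
  have h7 : u • (y₁ + α * w) = S * (β * (y₁ + α * w)) + β * (y₁ + α * w) * S := by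
    rw [mul_assoc β, ← h6, ← mul_assoc, ← mul_assoc, ← add_mul, hβ, smul_mul_assoc, one_mul]
  rw [mul_add S, add_mul _ _ S, add_add_add_comm, ← h7, h₂, h5, smul_add]
  abel

/-- By `exists_anticommutator_of_eval_eq_zero` it is enough to find a boundary with the same
constant term as the closed element. With `T, a, b, c, e` the constant terms of `S, X, Y, C, b₁`,
that term is `ba + abab - 1`. Modulo anticommutators with `T` one has `ab + ba = 1` and `b² = 0`, so
`abab = ab - ab²a = ab` and the whole vanishes. -/
theorem exists_homotopy (h : IsKoszulEval u v εu εv) (hf : εu (f • 1) = f • 1)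
    (hf' : εv (f • 1) = f • 1) (hS : S * S = (f + u * v) • (1 : R)) (hX : S = εu S + u • X)
    (hY : S = εv S + v • Y) {α β : R} (hα : S * α + α * S = v • 1)
    (hβ : S * β + β * S = u • 1) :
    ∃ t, εu Y * εv X + X * εu Y * (εv X * Y) - 1 = S * t + t * S := by
  have hS' : S * S = (f + v * u) • (1 : R) := by rwa [mul_comm v u]
  set T := εu (εv S) with hT
  set a := εv X with ha
  set b := εu Y with hb
  have hSu : εv S = T + u • a := by
    conv_lhs => rw [hX, map_add, h.v_smul_u, ← h.comm]
  have hSv : εu S = T + v • b := by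
    conv_lhs => rw [hY, map_add, h.u_smul_v]
  have hTu : εu T = T := h.εu_εu _
  have hTv : εv T = T := by rw [hT, h.comm, h.symm.εu_εu]
  obtain ⟨C, hC⟩ := h.exists_u Y
  obtain ⟨b₁, hb₁⟩ := h.exists_v b
  have hbT : εu S * b = -(b * T) := h.symm.mul_εv_eq hf' hS' hY
  have hTb : b * εu S = -(T * b) := h.symm.εv_mul_eq hf' hS' hY
  have hTa : a * εv S = -(T * a) := by rw [hT, h.comm]; exact h.εv_mul_eq hf hS hX
  -- The constant term of this identity is the coefficient of `u v` in `S² = f + u v`; `C` is the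
  -- mixed divided difference of `S`.
  have hC' : X * b + b * a + S * C + C * εv S = 1 := by
    refine sub_eq_zero.1 (h.u_reg _ ?_)
    have h1 := h.symm.mul_εu_add hf' hS' hY
    have h2 : S * b = -(b * T) + u • (X * b) := h.from_fst hf' hS hX hY
    have h3 : b * εv S = b * T + u • (b * a) := by rw [hSu, mul_add, mul_smul_comm]
    rw [hC, ← hb] at h1
    simp only [add_mul, mul_add, smul_mul_assoc, mul_smul_comm, h2, h3] at h1
    linear_combination (norm := module) h1
  -- At the level of constant terms this is the coefficient of `v²` in `S²`, which is zero.
  have hb₁' : T * b₁ + b₁ * T + b * b = 0 := by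
    rw [hSv, add_mul, smul_mul_assoc] at hbT
    have h1 := congrArg εv hbT
    rw [map_add, h.v_smul, map_neg, map_mul, map_mul, hTv, add_zero] at h1
    refine h.v_reg _ ?_
    have h2 : T * b = T * εv b + v • (T * b₁) := by
      conv_lhs => rw [hb₁, mul_add, mul_smul_comm]
    have h3 : b * T = εv b * T + v • (b₁ * T) := by
      conv_lhs => rw [hb₁, add_mul, smul_mul_assoc]
    rw [h2, h3] at hbT
    linear_combination (norm := module) hbT - h1
  -- The witness follows the reduction: `-C` from `ab + ba = 1 - (Tc + cT)`, `-a b₁ a` from `b² =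
  -- -(Te + eT)`, and `-a b C` from multiplying the first relation by `ab`. Since `a` and `b`
  -- anticommute with `T`, multiplying by them preserves anticommutators up to sign.
  have key : εu (εv (b * a + X * b * (a * Y) - 1 -
      (S * (-C - a * b₁ * a - a * b * C) + (-C - a * b₁ * a - a * b * C) * S))) = 0 := by
    have hX0 : εu (εv X) = εu (εv a) := by rw [ha, h.symm.εu_εu]
    have hY0 : εu (εv Y) = εu (εv b) := by rw [hb, h.comm, h.comm, h.εu_εu]
    have hS0 : εu (εv (εv S)) = T := by rw [h.symm.εu_εu]
    have hS1 : εu (εv (εu S)) = T := by rw [← h.comm, h.εu_εu]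
    have hT0 : εu (εv T) = T := by rw [hTv, hTu]
    have F1 := congrArg (fun x => εu (εv x)) hC'
    have F2 := congrArg (fun x => εu (εv x)) hb₁'
    have F3 := congrArg (fun x => εu (εv x)) (eq_neg_iff_add_eq_zero.1 hTa)
    have F4 := congrArg (fun x => εu (εv x)) (eq_neg_iff_add_eq_zero.1 hbT)
    simp only [map_add, map_mul, map_sub, map_neg, map_one, map_zero, hX0, hY0, hS0, hS1, hT0,
      ← hT] at F1 F2 F3 F4 ⊢
    generalize εu (εv a) = a at *
    generalize εu (εv b) = b at *
    generalize εu (εv C) = c at *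
    generalize εu (εv b₁) = e at *
    linear_combination (norm := noncomm_ring) F1 + a * b * F1 - a * F2 * a + F3 * (e * a) +
      a * e * F3 + F3 * (b * c) - a * F4 * c
  have hcomm := h.comp_commute hf hf' hS hX hY
  rw [← ha, ← hb] at hcomm
  obtain ⟨t, ht⟩ := h.exists_anticommutator_of_eval_eq_zero hS hα hβ (by
    set t := -C - a * b₁ * a - a * b * C
    have e2 : S * S * t = t * (S * S) := by
      rw [hS, smul_mul_assoc, mul_smul_comm, one_mul, mul_one]
    linear_combination (norm := noncomm_ring) hcomm - e2) key
  refine ⟨(-C - a * b₁ * a - a * b * C) + t, ?_⟩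
  rw [mul_add S _ t, add_mul _ t S, add_add_add_comm, ← ht]
  abel

end IsKoszulEval

/-! ### Matrix factorizations from matrices -/

section OfMatrix

variable {k : Type u} [Field k] {A : Type u} [CommRing A] [Algebra k A]
  {𝓐 : ℤ → Submodule k A}

open GradedFree

theorem bideg_add_two_mul (𝓐 : ℤ → Submodule k A) (d c j n : ℤ) :
    bideg 𝓐 d (c + 2 * j) n = bideg 𝓐 d c (n + j * d) := by
  obtain ⟨i, rfl | rfl⟩ := Int.even_or_odd' c
  · rw [← mul_add, bideg_two_mul, bideg_two_mul]
    ring_nf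
  · rw [add_right_comm, ← mul_add, bideg_two_mul_add_one, bideg_two_mul_add_one]

/-- The graded free module with a basis of elements of given degrees. -/
def GradedFree.free {ι : Type} [Finite ι] (𝓐 : ℤ → Submodule k A) (a : ι → ℤ) :
    GradedFree 𝓐 where
  carrier := ι → A
  deg n := Submodule.pi Set.univ fun i => 𝓐 (n - a i)
  exists_basis := ⟨ι, inferInstance, Pi.basisFun A ι, a, fun n x => by simp⟩

/-- The standard basis of a graded free module. -/
def GradedFree.freeBasis {ι : Type} [Finite ι] (𝓐 : ℤ → Submodule k A) (a : ι → ℤ) :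
    Module.Basis ι A (GradedFree.free 𝓐 a) :=
  Pi.basisFun A ι

theorem GradedFree.isHomogeneousBasis_freeBasis {ι : Type} [Finite ι] (𝓐 : ℤ → Submodule k A)
    (a : ι → ℤ) : (GradedFree.free 𝓐 a).IsHomogeneousBasis (GradedFree.freeBasis 𝓐 a) a :=
  fun _ _ => ⟨fun h i => h i trivial, fun h i _ => h i⟩

/-- For any bidegrees there is a pair of graded free modules with a basis in these bidegrees. -/
theorem exists_isBihomogeneousBasis_of_bidegrees {κ : Type} [Finite κ] (𝓐 : ℤ → Submodule k A)
    (d : ℤ) (c a : κ → ℤ) : ∃ (M0 M1 : GradedFree 𝓐) (b : Module.Basis κ A (M0 × M1)),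
      IsBihomogeneousBasis d M0 M1 b c a := by
  classical
  -- By periodicity the bidegree `(2j, a)` is `(0, a + j d)`, realized in `M0` in degree `a + j d`,
  -- and `(2j + 1, a)` is `(1, a + j d)`, realized in `M1` in degree `a + (j + 1) d`.
  let a0 : {i // Even (c i)} → ℤ := fun i => a i + c i / 2 * d
  let a1 : {i // ¬Even (c i)} → ℤ := fun i => a i + (c i / 2 + 1) * d
  have h := (isHomogeneousBasis_freeBasis 𝓐 a0).prod (isHomogeneousBasis_freeBasis 𝓐 a1) d
  refine ⟨free 𝓐 a0, free 𝓐 a1, ((freeBasis 𝓐 a0).prod (freeBasis 𝓐 a1)).reindex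
    (Equiv.sumCompl fun i => Even (c i)), ?_⟩
  intro p n x
  rw [h]
  refine (Equiv.sumCompl fun i => Even (c i)).forall_congr fun i => ?_
  rw [Module.Basis.repr_reindex_apply, Equiv.symm_apply_apply]
  obtain ⟨i, hi⟩ | ⟨i, hi⟩ := i
  · have e1 : p - (0 : ℤ) = p - c i + 2 * (c i / 2) := by
      rw [Int.two_mul_ediv_two_of_even hi]; ring
    have e2 : n - (a i + c i / 2 * d) + c i / 2 * d = n - a i := by ring
    simp only [Sum.elim_inl, a0, Equiv.sumCompl_apply_inl]
    rw [e1, bideg_add_two_mul, e2]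
  · have h2 : c i = 2 * (c i / 2) + 1 := by
      have := Int.two_mul_ediv_two_add_one_of_odd (Int.not_even_iff_odd.1 hi)
      omega
    have e1 : p - (1 : ℤ) = p - c i + 2 * (c i / 2) := by omega
    have e2 : n - (a i + (c i / 2 + 1) * d - d) + c i / 2 * d = n - a i := by ring
    simp only [Sum.elim_inr, a1, Equiv.sumCompl_apply_inr]
    rw [e1, bideg_add_two_mul, e2]

/-- A map of odd cohomological degree exchanges the two summands; this and `snd_inr` are the
vanishing of the diagonal blocks. -/
theorem GradedFree.IsBihom.fst_inl [SetLike.GradedMonoid 𝓐] {d : ℤ} {M0 M1 : GradedFree 𝓐}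
    {D : M0 × M1 →ₗ[A] M0 × M1} (hD : IsBihom d M0 M1 M0 M1 1 0 D) (x : M0) : (D (x, 0)).1 = 0 := by
  refine LinearMap.congr_fun (f := LinearMap.fst A M0 M1 ∘ₗ D ∘ₗ LinearMap.inl A M0 M1) (g := 0)
    (hom_ext_deg fun n x hx => ?_) x
  have := hD (2 * 0) n (x, 0) (mem_superDeg_even.2 ⟨by simpa using hx, rfl⟩)
  rw [mem_superDeg_odd] at this
  exact this.1

theorem GradedFree.IsBihom.snd_inr [SetLike.GradedMonoid 𝓐] {d : ℤ} {M0 M1 : GradedFree 𝓐}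
    {D : M0 × M1 →ₗ[A] M0 × M1} (hD : IsBihom d M0 M1 M0 M1 1 0 D) (x : M1) : (D (0, x)).2 = 0 := by
  refine LinearMap.congr_fun (f := LinearMap.snd A M0 M1 ∘ₗ D ∘ₗ LinearMap.inr A M0 M1) (g := 0)
    (hom_ext_deg fun n x hx => ?_) x
  have := hD (2 * (-1) + 1) n (0, x) (mem_superDeg_odd.2 ⟨rfl, by simpa using hx⟩)
  rw [show (2 * (-1) + 1 + 1 : ℤ) = 2 * 0 by norm_num, mem_superDeg_even] at this
  exact this.2

namespace GradedMF

variable [SetLike.GradedMonoid 𝓐] {f : A} {d : ℤ}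

/-- The matrix factorization given by an endomorphism of bidegree `(1, 0)` with square `f`. -/
def ofTotal (M0 M1 : GradedFree 𝓐) (D : M0 × M1 →ₗ[A] M0 × M1)
    (hD : IsBihom d M0 M1 M0 M1 1 0 D) (hDD : D ∘ₗ D = f • LinearMap.id) : GradedMF 𝓐 f d where
  F0 := M0
  F1 := M1
  s0 := LinearMap.snd A M0 M1 ∘ₗ D ∘ₗ LinearMap.inl A M0 M1
  s1 := LinearMap.fst A M0 M1 ∘ₗ D ∘ₗ LinearMap.inr A M0 M1
  s0_mem n x hx := by
    have := hD (2 * 0) n (x, 0) (mem_superDeg_even.2 ⟨by simpa using hx, rfl⟩)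
    rw [mem_superDeg_odd] at this
    simpa using this.2
  s1_mem n x hx := by
    have := hD (2 * (-1) + 1) n (0, x) (mem_superDeg_odd.2 ⟨rfl, by simpa using hx⟩)
    rw [show (2 * (-1) + 1 + 1 : ℤ) = 2 * 0 by norm_num, mem_superDeg_even] at this
    simpa using this.1
  s0_s1 := by
    refine LinearMap.ext fun x => ?_
    have h := congrArg Prod.snd (LinearMap.congr_fun hDD (0, x))
    have h1 : D (0, x) = ((D (0, x)).1, 0) := Prod.ext rfl (hD.snd_inr x)
    rw [LinearMap.comp_apply, h1] at h
    exact h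
  s1_s0 := by
    refine LinearMap.ext fun x => ?_
    have h := congrArg Prod.fst (LinearMap.congr_fun hDD (x, 0))
    have h1 : D (x, 0) = (0, (D (x, 0)).2) := Prod.ext (hD.fst_inl x) rfl
    rw [LinearMap.comp_apply, h1] at h
    exact h

theorem ofTotal_s (M0 M1 : GradedFree 𝓐) (D : M0 × M1 →ₗ[A] M0 × M1)
    (hD : IsBihom d M0 M1 M0 M1 1 0 D) (hDD : D ∘ₗ D = f • LinearMap.id) :
    (ofTotal M0 M1 D hD hDD).s = D := by
  have h : ∀ x, D x = ((D (0, x.2)).1, (D (x.1, 0)).2) := fun x => by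
    have h : D x = D (x.1, 0) + D (0, x.2) := by rw [← map_add]; simp
    rw [h]
    refine Prod.ext ?_ ?_
    · rw [Prod.fst_add, hD.fst_inl, zero_add]
    · rw [Prod.snd_add, hD.snd_inr, add_zero]
  exact LinearMap.ext fun x => (h x).symm

/-- A homogeneous square root of `f` is the matrix of a matrix factorization. -/
theorem exists_toMatrix_s_eq {κ : Type} [Fintype κ] [DecidableEq κ] {c a : κ → ℤ}
    {T : Matrix κ κ A} (hT : IsBihomMatrix 𝓐 d c a c a 1 0 T) (hTT : T * T = f • 1) :
    ∃ (F : GradedMF 𝓐 f d) (b : Module.Basis κ A F.Total),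
      IsBihomogeneousBasis d F.F0 F.F1 b c a ∧ LinearMap.toMatrix b b F.s = T := by
  obtain ⟨M0, M1, b, hb⟩ := exists_isBihomogeneousBasis_of_bidegrees 𝓐 d c a
  have hD : IsBihom d M0 M1 M0 M1 1 0 (Matrix.toLin b b T) := by
    rwa [isBihom_iff hb hb, LinearMap.toMatrix_toLin]
  refine ⟨ofTotal M0 M1 (Matrix.toLin b b T) hD ?_, b, hb, ?_⟩
  · have h := Matrix.toLin_mul b b b T T
    rw [hTT, map_smul, Matrix.toLin_one] at h
    exact h.symm
  · exact (congrArg (LinearMap.toMatrix b b) (ofTotal_s M0 M1 _ hD _)).trans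
      (LinearMap.toMatrix_toLin b b T)

end GradedMF

end OfMatrix

/-! ### Homogeneous matrices and extension of scalars. -/

section Bihom

variable {k : Type u} [Field k] {A : Type u} [CommRing A] [Algebra k A]
  {𝓐 : ℤ → Submodule k A} {B : Type u} [CommRing B] [Algebra k B] {𝓑 : ℤ → Submodule k B}

open GradedFree

theorem GradedFree.IsBihomMatrix.map {ι ι' : Type*} {d : ℤ} {c a : ι → ℤ}
    {c' a' : ι' → ℤ} {m e : ℤ} {X : Matrix ι' ι A} (hX : IsBihomMatrix 𝓐 d c a c' a' m e X)
    {g : A → B} (hg : ∀ c n x, x ∈ bideg 𝓐 d c n → g x ∈ bideg 𝓑 d c n) :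
    IsBihomMatrix 𝓑 d c a c' a' m e (X.map g) :=
  fun i j => hg _ _ _ (hX i j)

theorem algebraMap_mem_bideg [Algebra A B] (hB : IsGradedAlgebraMap 𝓐 𝓑) {d c n : ℤ} {x : A}
    (hx : x ∈ bideg 𝓐 d c n) : algebraMap A B x ∈ bideg 𝓑 d c n := by
  obtain ⟨j, rfl | rfl⟩ := Int.even_or_odd' c
  · rw [bideg_two_mul] at hx ⊢
    exact hB _ _ hx
  · rw [bideg_two_mul_add_one, Submodule.mem_bot] at hx
    rw [hx, map_zero]
    exact zero_mem _

variable [SetLike.GradedMonoid 𝓐]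

theorem GradedFree.IsBihomMatrix.mulVec_mem {ι ι' : Type*} [Fintype ι] {d : ℤ} {c a : ι → ℤ}
    {c' a' : ι' → ℤ} {m e : ℤ} {X : Matrix ι' ι A} (hX : IsBihomMatrix 𝓐 d c a c' a' m e X)
    {x : ι → A} {p n p' n' : ℤ} (hx : ∀ j, x j ∈ bideg 𝓐 d (p - c j) (n - a j))
    (hp : m + p = p') (hn : e + n = n') (i : ι') :
    X.mulVec x i ∈ bideg 𝓐 d (p' - c' i) (n' - a' i) := by
  subst hp hn
  refine Submodule.sum_mem _ fun j _ => ?_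
  have := mul_mem_bideg (hX i j) (hx j)
  convert this using 2 <;> ring

theorem GradedFree.IsBihomMatrix.mul {ι ι' ι'' : Type*} [Fintype ι'] {d : ℤ} {c a : ι → ℤ}
    {c' a' : ι' → ℤ} {c'' a'' : ι'' → ℤ} {m e m' e' : ℤ} {X : Matrix ι' ι A}
    {Y : Matrix ι'' ι' A} (hY : IsBihomMatrix 𝓐 d c' a' c'' a'' m' e' Y)
    (hX : IsBihomMatrix 𝓐 d c a c' a' m e X) :
    IsBihomMatrix 𝓐 d c a c'' a'' (m' + m) (e' + e) (Y * X) := by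
  intro i j
  rw [Matrix.mul_apply]
  refine Submodule.sum_mem _ fun l _ => ?_
  have := mul_mem_bideg (hY i l) (hX l j)
  convert this using 2 <;> ring

end Bihom

theorem LinearMap.toMatrix_baseChange_eq {A B M N ι κ : Type*} [CommRing A] [CommRing B]
    [Algebra A B] [AddCommGroup M] [Module A M] [AddCommGroup N] [Module A N] [Fintype ι]
    [DecidableEq ι] [Finite κ] (b : Module.Basis ι A M) (b' : Module.Basis κ A N) (φ : M →ₗ[A] N) :
    LinearMap.toMatrix (b.baseChange B) (b'.baseChange B) (φ.baseChange B) =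
      (LinearMap.toMatrix b b' φ).map (algebraMap A B) := by
  ext i j
  rw [LinearMap.toMatrix_apply, Module.Basis.baseChange_apply, LinearMap.baseChange_tmul,
    Module.Basis.baseChange_repr_tmul, Matrix.map_apply, LinearMap.toMatrix_apply,
    Algebra.smul_def, mul_one]

section BaseChangeBasis

variable {k : Type u} [Field k] {A : Type u} [CommRing A] [Algebra k A]
  {𝓐 : ℤ → Submodule k A} [SetLike.GradedMonoid 𝓐]
  {B : Type u} [CommRing B] [Algebra k B] [Algebra A B] [IsScalarTower k A B]
  {𝓑 : ℤ → Submodule k B} [SetLike.GradedMonoid 𝓑]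

open GradedFree

variable (hB : IsGradedAlgebraMap 𝓐 𝓑) {d : ℤ} {M0 M1 : GradedFree 𝓐}

theorem GradedFree.IsHomogeneousBasis.memBaseChange_iff {ι ι' : Type*} [Finite ι] [Finite ι']
    {b : Module.Basis ι A M0} {a : ι → ℤ} {b' : Module.Basis ι' A M1} {a' : ι' → ℤ}
    (h : M0.IsHomogeneousBasis b a) (h' : M1.IsHomogeneousBasis b' a') (p n : ℤ)
    (z : B ⊗[A] (M0 × M1)) :
    MemBaseChange hB d M0 M1 p n z ↔ ∀ i, ((b.prod b').baseChange B).repr z i ∈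
      bideg 𝓑 d (p - Sum.elim (fun _ => 0) (fun _ => 1) i)
        (n - Sum.elim a (fun i => a' i - d) i) := by
  have key : ∀ i, ((b.baseChange B).prod (b'.baseChange B)).repr
      (TensorProduct.prodRight A B B M0 M1 z) i = ((b.prod b').baseChange B).repr z i := by
    intro i
    induction z using TensorProduct.induction_on with
    | zero => simp
    | tmul c x => obtain i | i := i <;> simp
    | add x y hx hy => simp only [map_add, Finsupp.add_apply, hx, hy]
  refine ((h.baseChange hB).prod (h'.baseChange hB) d p n _).trans (forall_congr' fun i => ?_)
  rw [← key i]
  rfl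

/-- The degrees on `B ⊗ (M0 ⊕ M1)` are computed directly only for a product basis. Any other basis
is reached by the change of basis matrices, which represent the identity and so are homogeneous of
bidegree `(0, 0)`, also after extension of scalars. -/
theorem GradedFree.IsBihomogeneousBasis.memBaseChange_iff {ι : Type*} [Fintype ι] [DecidableEq ι]
    {b : Module.Basis ι A (M0 × M1)} {c a : ι → ℤ} (h : IsBihomogeneousBasis d M0 M1 b c a)
    (p n : ℤ) (z : B ⊗[A] (M0 × M1)) :
    MemBaseChange hB d M0 M1 p n z ↔
      ∀ i, (b.baseChange B).repr z i ∈ bideg 𝓑 d (p - c i) (n - a i) := by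
  obtain ⟨ι0, _, _, b0, a0, h0⟩ := M0.exists_isHomogeneousBasis
  obtain ⟨ι1, _, _, b1, a1, h1⟩ := M1.exists_isHomogeneousBasis
  rw [h0.memBaseChange_iff hB h1]
  have hid : IsBihom d M0 M1 M0 M1 0 0 LinearMap.id := fun c n x hx => by simpa using hx
  have m1 := ((isBihom_iff h (h0.prod h1 d) 0 0 _).1 hid).map (𝓑 := 𝓑) (g := algebraMap A B)
    fun _ _ _ => algebraMap_mem_bideg hB
  have m2 := ((isBihom_iff (h0.prod h1 d) h 0 0 _).1 hid).map (𝓑 := 𝓑) (g := algebraMap A B)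
    fun _ _ _ => algebraMap_mem_bideg hB
  rw [← LinearMap.toMatrix_baseChange_eq] at m1 m2
  constructor
  · intro hz i
    have := m2.mulVec_mem hz (zero_add p) (zero_add n) i
    rwa [LinearMap.toMatrix_mulVec_repr, LinearMap.baseChange_id] at this
  · intro hz i
    have := m1.mulVec_mem hz (zero_add p) (zero_add n) i
    rwa [LinearMap.toMatrix_mulVec_repr, LinearMap.baseChange_id] at this

end BaseChangeBasis

/-! ### Every matrix factorization of `f + u v` is a homotopy retract of a tensor product -/

theorem IsKoszulEval.mapMatrix {B ι : Type*} [CommRing B] [Fintype ι] [DecidableEq ι] {u v : B}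
    {εu εv : B →+* B} (h : IsKoszulEval u v εu εv) :
    IsKoszulEval (R := Matrix ι ι B) u v εu.mapMatrix εv.mapMatrix where
  u_smul x := Matrix.ext fun i j => h.u_smul (x i j)
  v_smul x := Matrix.ext fun i j => h.v_smul (x i j)
  u_smul_v x := Matrix.ext fun i j => h.u_smul_v (x i j)
  v_smul_u x := Matrix.ext fun i j => h.v_smul_u (x i j)
  u_reg x hx := Matrix.ext fun i j => h.u_reg (x i j) (congrFun (congrFun hx i) j)
  v_reg x hx := Matrix.ext fun i j => h.v_reg (x i j) (congrFun (congrFun hx i) j)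
  exists_u x := by
    choose y hy using fun i j => h.exists_u (x i j)
    exact ⟨.of y, Matrix.ext hy⟩
  exists_v x := by
    choose y hy using fun i j => h.exists_v (x i j)
    exact ⟨.of y, Matrix.ext hy⟩
  comm x := Matrix.ext fun i j => h.comm (x i j)

/-- The Leibniz rule for the derivative of a square. -/
theorem Derivation.map_mul_self_matrix {A B ι : Type*} [CommRing A] [CommRing B] [Algebra A B]
    [Fintype ι] [DecidableEq ι] (D : Derivation A B B) {S : Matrix ι ι B} {c : B}
    (hS : S * S = c • (1 : Matrix ι ι B)) : S * S.map D + S.map D * S = D c • 1 := by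
  ext i j
  have h := congrArg D (congrFun (congrFun hS i) j)
  rw [Matrix.mul_apply, map_sum] at h
  simp only [Derivation.leibniz, smul_eq_mul, Finset.sum_add_distrib] at h
  rw [Matrix.add_apply, Matrix.mul_apply, Matrix.mul_apply]
  simp only [Matrix.map_apply]
  rw [show D ((c • (1 : Matrix ι ι B)) i j) = (D c • (1 : Matrix ι ι B)) i j by
    by_cases hij : i = j <;> simp [Matrix.smul_apply, hij]] at h
  rw [← h]
  exact congrArg _ (Finset.sum_congr rfl fun l _ => mul_comm _ _)

/-- The properties of the graded algebra `B = A[u, v]` that are used for essential surjectivity: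
`π` is the retraction onto `A`, and `εu`, `εv` are the endomorphisms `u ↦ 0` and `v ↦ 0`. -/
structure IsGradedKoszulEval {k A B : Type*} [Field k] [CommRing A] [CommRing B] [Algebra k A]
    [Algebra k B] [Algebra A B] (𝓐 : ℤ → Submodule k A) (𝓑 : ℤ → Submodule k B) (π : B →ₐ[A] A)
    (u v : B) (εu εv : B →+* B) : Prop extends IsKoszulEval u v εu εv where
  εu_algebraMap : ∀ x, εu (algebraMap A B x) = algebraMap A B x
  εv_algebraMap : ∀ x, εv (algebraMap A B x) = algebraMap A B x
  algebraMap_π : ∀ x, algebraMap A B (π x) = εu (εv x)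
  π_mem : ∀ i, ∀ x ∈ 𝓑 i, π x ∈ 𝓐 i
  εu_mem : ∀ i, ∀ x ∈ 𝓑 i, εu x ∈ 𝓑 i
  εv_mem : ∀ i, ∀ x ∈ 𝓑 i, εv x ∈ 𝓑 i
  exists_derivation_u : ∃ D : Derivation A B B, D u = 1 ∧ D v = 0
  exists_derivation_v : ∃ D : Derivation A B B, D u = 0 ∧ D v = 1

section

variable {k : Type u} [Field k] {B : Type u} [CommRing B] [Algebra k B] {𝓑 : ℤ → Submodule k B}

theorem mem_bideg_zero {d l : ℤ} {u : B} (hu : u ∈ 𝓑 l) : u ∈ bideg 𝓑 d 0 l := by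
  have := bideg_two_mul 𝓑 d 0 l
  rw [mul_zero, zero_mul, add_zero] at this
  rwa [this]

theorem map_mem_bideg {C : Type u} [CommRing C] [Algebra k C] {𝓒 : ℤ → Submodule k C}
    {g : B →+* C} (hg : ∀ i, ∀ x ∈ 𝓑 i, g x ∈ 𝓒 i) {d c n : ℤ} {x : B}
    (hx : x ∈ bideg 𝓑 d c n) : g x ∈ bideg 𝓒 d c n := by
  obtain ⟨j, rfl | rfl⟩ := Int.even_or_odd' c
  · rw [bideg_two_mul] at hx ⊢
    exact hg _ _ hx
  · rw [bideg_two_mul_add_one, Submodule.mem_bot] at hx ⊢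
    rw [hx, map_zero]

/-- `x` and its component of bidegree `(c, n - l)` have the same product with `u`, and `u` is
regular. -/
theorem mem_bideg_of_mul_mem [GradedAlgebra 𝓑] {d l c n : ℤ} {u x : B} (hu : u ∈ 𝓑 l)
    (hreg : ∀ y, u * y = 0 → y = 0) (hx : u * x ∈ bideg 𝓑 d c n) : x ∈ bideg 𝓑 d c (n - l) := by
  have h := bidegProj_mul_left (mem_bideg_zero (d := d) hu) c (n - l) x
  rw [zero_add, add_sub_cancel, bidegProj_of_mem hx] at h
  have h1 := hreg (x - bidegProj 𝓑 d c (n - l) x) (by rw [mul_sub, ← h, sub_self])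
  rw [sub_eq_zero.1 h1]
  exact bidegProj_mem _ _ _ _ _

open GradedFree

/-- The quotient of a homogeneous matrix by a regular homogeneous element is homogeneous. -/
theorem isBihomMatrix_of_eq_add_smul [GradedAlgebra 𝓑] {ι ι' : Type*} {d l m e : ℤ}
    {c a : ι → ℤ} {c' a' : ι' → ℤ} {u : B} (hu : u ∈ 𝓑 l) (hreg : ∀ y, u * y = 0 → y = 0)
    {X Y Z : Matrix ι' ι B} (hX : IsBihomMatrix 𝓑 d c a c' a' m e X)
    (hY : IsBihomMatrix 𝓑 d c a c' a' m e Y) (h : X = Y + u • Z) :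
    IsBihomMatrix 𝓑 d c a c' a' m (e - l) Z := by
  intro i j
  have h1 : u * Z i j ∈ bideg 𝓑 d (m + c j - c' i) (e + a j - a' i) := by
    have := sub_mem (hX i j) (hY i j)
    rwa [h, Matrix.add_apply, add_sub_cancel_left] at this
  have := mem_bideg_of_mul_mem hu hreg h1
  convert this using 2
  ring

end

section Maps

variable {B N N' κ : Type*} [CommRing B] [AddCommGroup N] [Module B N] [AddCommGroup N'] [Module B N']
  [Fintype κ] [DecidableEq κ]

theorem RingHom.mapMatrix_smul_one {g : B →+* B} {f : B} (hf : g f = f) :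
    g.mapMatrix (f • (1 : Matrix κ κ B)) = f • 1 := by
  rw [← Algebra.algebraMap_eq_smul_one, Matrix.algebraMap_eq_diagonal]
  ext i j
  by_cases hij : i = j
  · subst hij; simpa using hf
  · simp [hij]

/-- The maps to and from the tensor product, in terms of matrices. -/
theorem IsKoszulEval.exists_toLin_comp {u v f : B} {εu εv : B →+* B}
    (h : IsKoszulEval u v εu εv) (hfu : εu f = f) (hfv : εv f = f) (e : Module.Basis κ B N)
    (e' : Module.Basis κ B N') {s : N →ₗ[B] N} {s' : N' →ₗ[B] N'} {S X Y : Matrix κ κ B}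
    (hs : LinearMap.toMatrix e e s = S)
    (hs' : LinearMap.toMatrix e' e' s' = εu.mapMatrix (εv.mapMatrix S))
    (hS : S * S = (f + u * v) • 1) (hX : S = εu.mapMatrix S + u • X)
    (hY : S = εv.mapMatrix S + v • Y) {P Q : Matrix κ κ B} (hP : S * P + P * S = v • 1)
    (hQ : S * Q + Q * S = u • 1) :
    ∃ (i₀ i₁ : N →ₗ[B] N') (r₀ r₁ : N' →ₗ[B] N) (t : N →ₗ[B] N),
      LinearMap.toMatrix e e' i₀ = εv.mapMatrix X ∧
      LinearMap.toMatrix e e' i₁ = εv.mapMatrix X * Y ∧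
      LinearMap.toMatrix e' e r₀ = εu.mapMatrix Y ∧
      LinearMap.toMatrix e' e r₁ = X * εu.mapMatrix Y ∧
      i₀ ∘ₗ s = -(s' ∘ₗ i₀) + v • i₁ ∧ i₁ ∘ₗ s = u • i₀ + s' ∘ₗ i₁ ∧
      s ∘ₗ r₀ = -(r₀ ∘ₗ s') + u • r₁ ∧ s ∘ₗ r₁ = v • r₀ + r₁ ∘ₗ s' ∧
      r₀ ∘ₗ i₀ + r₁ ∘ₗ i₁ - LinearMap.id = s ∘ₗ t + t ∘ₗ s := by
  have hM := h.mapMatrix (ι := κ)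
  have hfu := RingHom.mapMatrix_smul_one (κ := κ) hfu
  have hfv := RingHom.mapMatrix_smul_one (κ := κ) hfv
  obtain ⟨t, ht⟩ := hM.exists_homotopy hfu hfv hS hX hY hP hQ
  refine ⟨Matrix.toLin e e' (εv.mapMatrix X), Matrix.toLin e e' (εv.mapMatrix X * Y),
    Matrix.toLin e' e (εu.mapMatrix Y), Matrix.toLin e' e (X * εu.mapMatrix Y), Matrix.toLin e e t,
    LinearMap.toMatrix_toLin _ _ _, LinearMap.toMatrix_toLin _ _ _, LinearMap.toMatrix_toLin _ _ _,
    LinearMap.toMatrix_toLin _ _ _, (LinearMap.toMatrix e e').injective ?_,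
    (LinearMap.toMatrix e e').injective ?_, (LinearMap.toMatrix e' e).injective ?_,
    (LinearMap.toMatrix e' e).injective ?_, (LinearMap.toMatrix e e).injective ?_⟩
  · rw [LinearMap.toMatrix_comp e e e', map_add, map_neg, map_smul, LinearMap.toMatrix_comp e e' e',
      LinearMap.toMatrix_toLin, LinearMap.toMatrix_toLin, hs, hs']
    exact hM.into_fst hfu hS hX hY
  · rw [LinearMap.toMatrix_comp e e e', map_add, map_smul, LinearMap.toMatrix_comp e e' e',
      LinearMap.toMatrix_toLin, LinearMap.toMatrix_toLin, hs, hs']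
    exact hM.into_snd hfu hfv hS hX hY
  · rw [LinearMap.toMatrix_comp e' e e, map_add, map_neg, map_smul, LinearMap.toMatrix_comp e' e' e,
      LinearMap.toMatrix_toLin, LinearMap.toMatrix_toLin, hs, hs']
    exact hM.from_fst hfv hS hX hY
  · rw [LinearMap.toMatrix_comp e' e e, map_add, map_smul, LinearMap.toMatrix_comp e' e' e,
      LinearMap.toMatrix_toLin, LinearMap.toMatrix_toLin, hs, hs']
    exact hM.from_snd hfu hfv hS hX hY
  · rw [map_sub, map_add, map_add, LinearMap.toMatrix_comp e e' e, LinearMap.toMatrix_comp e e' e,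
      LinearMap.toMatrix_comp e e e, LinearMap.toMatrix_comp e e e, LinearMap.toMatrix_id]
    simp only [LinearMap.toMatrix_toLin, hs]
    exact ht

end Maps

section Retract

variable {k : Type u} [Field k] {A : Type u} [CommRing A] [Algebra k A]
  {𝓐 : ℤ → Submodule k A} [SetLike.GradedMonoid 𝓐]
  {A' : Type u} [CommRing A'] [Algebra k A'] {𝓐' : ℤ → Submodule k A'}
  [SetLike.GradedMonoid 𝓐']
  {B : Type u} [CommRing B] [Algebra k B] [Algebra A B] [IsScalarTower k A B]
  [Algebra A' B] [IsScalarTower k A' B] {𝓑 : ℤ → Submodule k B} [GradedAlgebra 𝓑]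

open GradedFree

namespace GradedMF

variable {f : A} {d : ℤ} (hB : IsGradedAlgebraMap 𝓐 𝓑) (hB' : IsGradedAlgebraMap 𝓐' 𝓑) {l : ℤ}
  {p q : A'} (hp : p ∈ 𝓐' l) (hq : q ∈ 𝓐' (d - l)) {κ : Type} [Fintype κ] [DecidableEq κ]
  {c a : κ → ℤ} {F : GradedMF 𝓐 f d} {b : Module.Basis κ A F.Total}
  {E : GradedMF 𝓑 (algebraMap A B f + algebraMap A' B (p * q)) d} {e : Module.Basis κ B E.Total}

/-- With `F` in bidegrees `(c - 1, a + l)`, the second copy in `K(F)`, shifted by `(1, -l)`, has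
exactly the bidegrees `(c, a)` of `E`. So a matrix of bidegree `(1, -l)` has degree `0` into the
first copy, and one of bidegree `(2, -d)`, equivalent to `(0, 0)` by periodicity, has degree `0`
into the second. -/
theorem into_mem_homDeg
    (hb : IsBihomogeneousBasis d F.F0 F.F1 b (fun i => c i - 1) fun i => a i + l)
    (he : IsBihomogeneousBasis d E.F0 E.F1 e c a) {i₀ i₁ : E.Total →ₗ[B] B ⊗[A] F.Total}
    (h₀ : IsBihomMatrix 𝓑 d c a c a 1 (-l) (LinearMap.toMatrix e (b.baseChange B) i₀))
    (h₁ : IsBihomMatrix 𝓑 d c a c a 2 (-d) (LinearMap.toMatrix e (b.baseChange B) i₁)) :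
    (koszulEquiv hB hB' hp hq F).symm.toLinearMap ∘ₗ i₀.prod i₁ ∈
      homDeg E (tensorKoszul hB hB' hp hq F) 0 := by
  rw [mem_homDeg_iff_isBihom]
  intro m n x hx
  rw [he] at hx
  rw [koszulEquiv_mem_iff, hb.memBaseChange_iff, hb.memBaseChange_iff]
  have e0 : koszulEquiv hB hB' hp hq F
      (((koszulEquiv hB hB' hp hq F).symm.toLinearMap ∘ₗ i₀.prod i₁) x) = (i₀ x, i₁ x) :=
    LinearEquiv.apply_symm_apply _ _
  rw [e0]
  refine ⟨fun i => ?_, fun i => ?_⟩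
  · have h := h₀.mulVec_mem hx rfl rfl i
    rw [LinearMap.toMatrix_mulVec_repr] at h
    convert h using 2 <;> ring
  · have h := h₁.mulVec_mem hx rfl rfl i
    rw [LinearMap.toMatrix_mulVec_repr, show 2 + m - c i = m - c i + 2 by ring, bideg_add_two] at h
    convert h using 2 <;> ring

/-- As for `into_mem_homDeg`; out of the first copy a matrix of bidegree `(1, l - d)` becomes one of
bidegree `(2, -d)`. -/
theorem from_mem_homDeg
    (hb : IsBihomogeneousBasis d F.F0 F.F1 b (fun i => c i - 1) fun i => a i + l)
    (he : IsBihomogeneousBasis d E.F0 E.F1 e c a) {r₀ r₁ : B ⊗[A] F.Total →ₗ[B] E.Total}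
    (h₀ : IsBihomMatrix 𝓑 d c a c a 1 (l - d) (LinearMap.toMatrix (b.baseChange B) e r₀))
    (h₁ : IsBihomMatrix 𝓑 d c a c a 2 (-d) (LinearMap.toMatrix (b.baseChange B) e r₁)) :
    r₀.coprod r₁ ∘ₗ (koszulEquiv hB hB' hp hq F).toLinearMap ∈
      homDeg (tensorKoszul hB hB' hp hq F) E 0 := by
  rw [mem_homDeg_iff_isBihom]
  intro m n x hx
  rw [koszulEquiv_mem_iff, hb.memBaseChange_iff, hb.memBaseChange_iff] at hx
  obtain ⟨hx₀, hx₁⟩ := hx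
  rw [he]
  intro i
  have e0 : (r₀.coprod r₁ ∘ₗ (koszulEquiv hB hB' hp hq F).toLinearMap) x =
    r₀ (koszulEquiv hB hB' hp hq F x).1 + r₁ (koszulEquiv hB hB' hp hq F x).2 := rfl
  rw [e0, map_add, Finsupp.add_apply]
  have g₀ := h₀.mulVec_mem (p := m + 1) (n := n - l)
    (fun j => by convert hx₀ j using 2 <;> ring) rfl rfl i
  have g₁ := h₁.mulVec_mem (p := m) (n := n)
    (fun j => by convert hx₁ j using 2 <;> ring) rfl rfl i
  rw [LinearMap.toMatrix_mulVec_repr, show 1 + (m + 1) - c i = m - c i + 2 by ring,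
    bideg_add_two] at g₀
  rw [LinearMap.toMatrix_mulVec_repr, show 2 + m - c i = m - c i + 2 by ring, bideg_add_two] at g₁
  refine add_mem ?_ ?_
  · convert g₀ using 2 <;> ring
  · convert g₁ using 2 <;> ring

variable {π : B →ₐ[A] A} {εu εv : B →+* B}

/-- `F` has as differential the matrix of `E` at `u = v = 0`, with all bidegrees shifted by `(-1,
l)`. The maps are those of `IsKoszulEval.exists_toLin_comp`; what is added is homogeneity. -/
theorem exists_retract (hinj : Function.Injective (algebraMap A B))
    (h : IsGradedKoszulEval 𝓐 𝓑 π (algebraMap A' B p) (algebraMap A' B q) εu εv)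
    (E : GradedMF 𝓑 (algebraMap A B f + algebraMap A' B (p * q)) d) :
    ∃ (F : GradedMF 𝓐 f d) (i : E.Total →ₗ[B] (tensorKoszul hB hB' hp hq F).Total)
      (r : (tensorKoszul hB hB' hp hq F).Total →ₗ[B] E.Total),
      i ∈ homDeg E (tensorKoszul hB hB' hp hq F) 0 ∧
      r ∈ homDeg (tensorKoszul hB hB' hp hq F) E 0 ∧
      (tensorKoszul hB hB' hp hq F).s ∘ₗ i = i ∘ₗ E.s ∧
      E.s ∘ₗ r = r ∘ₗ (tensorKoszul hB hB' hp hq F).s ∧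
      ∃ ψ ∈ homDeg E E (-1), r ∘ₗ i - LinearMap.id = E.s ∘ₗ ψ + ψ ∘ₗ E.s := by
  obtain ⟨κ, _, _, e, c, a, he⟩ := exists_isBihomogeneousBasis d E.F0 E.F1
  have hul : algebraMap A' B p ∈ 𝓑 l := hB' _ _ hp
  have hvl : algebraMap A' B q ∈ 𝓑 (d - l) := hB' _ _ hq
  have hpi0 : π (algebraMap A' B p) = 0 := hinj (by
    rw [h.algebraMap_π, h.comm, ← mul_one (algebraMap A' B p), ← smul_eq_mul, h.u_smul, map_zero,
      map_zero])
  obtain ⟨S, hs⟩ : ∃ S, LinearMap.toMatrix e e E.s = S := ⟨_, rfl⟩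
  have hSm : IsBihomMatrix 𝓑 d c a c a 1 0 S :=
    hs ▸ (isBihom_iff he he 1 0 E.s).1 ((mem_homDeg_iff_isBihom _ _).1 E.s_mem_homDeg)
  have hS : S * S = (algebraMap A B f + algebraMap A' B p * algebraMap A' B q) •
      (1 : Matrix κ κ B) := by
    have := congrArg (LinearMap.toMatrix e e) E.s_comp_s
    rw [LinearMap.toMatrix_comp e e e, map_smul, LinearMap.toMatrix_id, hs] at this
    rw [← map_mul (algebraMap A' B)]
    exact this
  obtain ⟨X, hX⟩ := h.mapMatrix.exists_u S
  obtain ⟨Y, hY⟩ := h.mapMatrix.exists_v S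
  -- Dividing by `u` and `v` lowers the internal degree, so `X` and `Y` have bidegrees `(1, -l)` and
  -- `(1, l - d)`; the products `εv X * Y` and `X * εu Y` then have bidegree `(2, -d)`.
  have hXm := isBihomMatrix_of_eq_add_smul hul h.u_reg hSm
    (hSm.map fun _ _ _ => map_mem_bideg h.εu_mem) hX
  have hYm := isBihomMatrix_of_eq_add_smul hvl h.v_reg hSm
    (hSm.map fun _ _ _ => map_mem_bideg h.εv_mem) hY
  have hαm : IsBihomMatrix 𝓑 d c a c a 1 (0 - l) (εv.mapMatrix X) :=
    hXm.map fun _ _ _ => map_mem_bideg h.εv_mem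
  have hβm : IsBihomMatrix 𝓑 d c a c a 1 (0 - (d - l)) (εu.mapMatrix Y) :=
    hYm.map fun _ _ _ => map_mem_bideg h.εu_mem
  -- A common shift of all basis bidegrees does not change which matrices are homogeneous; this
  -- shift is the one for which the maps to and from `K(F)` have degree `0`.
  have hTm : IsBihomMatrix 𝓐 d (fun i => c i - 1) (fun i => a i + l) (fun i => c i - 1)
      (fun i => a i + l) 1 0 (S.map π) := by
    intro i j
    have := (hSm.map (𝓑 := 𝓐) (g := π) fun _ _ _ => map_mem_bideg (g := π.toRingHom) h.π_mem) i j
    convert this using 2 <;> ring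
  have hTT : S.map π * S.map π = f • 1 := by
    have := congrArg (fun M : Matrix κ κ B => M.map π) hS
    simp only [Matrix.map_mul] at this
    rw [this, ← Algebra.algebraMap_eq_smul_one, ← Algebra.algebraMap_eq_smul_one,
      Matrix.algebraMap_eq_diagonal, Matrix.algebraMap_eq_diagonal]
    ext i j
    by_cases hij : i = j
    · subst hij; simp [hpi0]
    · simp [hij]
  obtain ⟨F, b, hb, hbT⟩ := exists_toMatrix_s_eq hTm hTT
  have hsF : LinearMap.toMatrix (b.baseChange B) (b.baseChange B) (F.s.baseChange B) =
      εu.mapMatrix (εv.mapMatrix S) := by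
    rw [LinearMap.toMatrix_baseChange_eq]
    refine (congrArg (fun M : Matrix κ κ A => M.map (algebraMap A B)) hbT).trans ?_
    exact Matrix.ext fun i j => h.algebraMap_π (S i j)
  -- Differentiating `S² = f + u v` by `u` gives `v`, and by `v` gives `u`: the derivatives of `S`
  -- are the required null-homotopies.
  obtain ⟨Du, hDu, hDu'⟩ := h.exists_derivation_u
  obtain ⟨Dv, hDv, hDv'⟩ := h.exists_derivation_v
  obtain ⟨i₀, i₁, r₀, r₁, t, hi₀, hi₁, hr₀, hr₁, e1, e2, e3, e4, e5⟩ :=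
    h.toIsKoszulEval.exists_toLin_comp (h.εu_algebraMap f) (h.εv_algebraMap f) e (b.baseChange B)
      hs hsF hS hX hY (P := S.map Du) (Q := S.map Dv)
      (by rw [Du.map_mul_self_matrix hS]; simp [hDu, hDu'])
      (by rw [Dv.map_mul_self_matrix hS]; simp [hDv, hDv'])
  have him := into_mem_homDeg hB hB' hp hq hb he (i₀ := i₀) (i₁ := i₁)
    (by rw [hi₀, ← zero_sub]; exact hαm)
    (by
      rw [hi₁, show (2 : ℤ) = 1 + 1 by norm_num, show -d = 0 - l + (0 - (d - l)) by ring]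
      exact hαm.mul hYm)
  have hrm := from_mem_homDeg hB hB' hp hq hb he (r₀ := r₀) (r₁ := r₁)
    (by rw [hr₀, show l - d = 0 - (d - l) by ring]; exact hβm)
    (by
      rw [hr₁, show (2 : ℤ) = 1 + 1 by norm_num, show -d = 0 - l + (0 - (d - l)) by ring]
      exact hXm.mul hβm)
  set w := koszulEquiv hB hB' hp hq F with hw
  have hri : (r₀.coprod r₁ ∘ₗ w.toLinearMap) ∘ₗ (w.symm.toLinearMap ∘ₗ i₀.prod i₁) =
      r₀ ∘ₗ i₀ + r₁ ∘ₗ i₁ := LinearMap.ext fun x => by simp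
  have hid : r₀ ∘ₗ i₀ + r₁ ∘ₗ i₁ - LinearMap.id ∈ homDeg E E (-1 + 1) := by
    rw [← hri]
    exact sub_mem (comp_mem_homDeg (by norm_num) hrm him) E.id_mem_homDeg
  have hodd : ∀ ψ : E.Total →ₗ[B] E.Total, E.s ∘ₗ ψ - (-1 : ℤ).negOnePow • (ψ ∘ₗ E.s) =
      E.s ∘ₗ ψ + ψ ∘ₗ E.s := fun ψ => by
    rw [Int.negOnePow_odd (-1) (by decide), Units.neg_smul, one_smul, sub_neg_eq_add]
  obtain ⟨ψ, hψ, hψ'⟩ := exists_homDeg_boundary hid t (by rw [hodd, e5])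
  refine ⟨F, w.symm.toLinearMap ∘ₗ i₀.prod i₁, r₀.coprod r₁ ∘ₗ w.toLinearMap, him, hrm, ?_, ?_,
    ψ, hψ, ?_⟩
  · refine LinearMap.ext fun x => w.injective ?_
    have h1 := LinearMap.congr_fun e1 x
    have h2 := LinearMap.congr_fun e2 x
    rw [LinearMap.comp_apply, hw, koszulEquiv_s]
    simp only [LinearMap.comp_apply, LinearEquiv.coe_coe, LinearEquiv.apply_symm_apply,
      LinearMap.prod_apply, Function.prod] at h1 h2 ⊢
    rw [h1, h2]
    rfl
  · refine LinearMap.ext fun x => ?_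
    obtain ⟨⟨y, z⟩, rfl⟩ := w.symm.surjective x
    have h3 := LinearMap.congr_fun e3 y
    have h4 := LinearMap.congr_fun e4 z
    simp only [LinearMap.comp_apply, LinearEquiv.coe_coe, LinearEquiv.apply_symm_apply,
      LinearMap.coprod_apply, LinearMap.add_apply, LinearMap.neg_apply, LinearMap.smul_apply]
      at h3 h4 ⊢
    rw [hw, koszulEquiv_s, LinearEquiv.apply_symm_apply, map_add, h3, h4]
    simp only [map_add, map_neg, map_smul]
    abel
  · rw [hri, hψ', hodd]

end GradedMF

end Retract

/-! ### Splitting homotopy idempotents -/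

section Splitting

open Polynomial in
/-- For a nonzero polynomial `g`, there is an idempotent modulo `g` which is congruent to `X`
modulo `X ^ 2 - X`. -/
theorem Polynomial.exists_idempotent_lift {k : Type*} [Field k] {g : k[X]} (hg : g ≠ 0) :
    ∃ q : k[X], g ∣ q * q - q ∧ X * X - X ∣ q - X := by
  have hX1 : (X - C (1 : k)) ≠ 0 := X_sub_C_ne_zero 1
  -- The extra factor makes both `0` and `1` roots: it forces `n ≥ 1` and `X ∣ m`, which is what
  -- ties the idempotent to `X`.
  have hg' : g * (X * (X - C 1)) ≠ 0 := mul_ne_zero hg (mul_ne_zero X_ne_zero hX1)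
  obtain ⟨m, hm, hmd⟩ := exists_eq_pow_rootMultiplicity_mul_and_not_dvd _ hg' 1
  set n := rootMultiplicity 1 (g * (X * (X - C 1))) with hn
  have hirr : Irreducible (X - C (1 : k)) := irreducible_X_sub_C 1
  have hcop : IsCoprime ((X - C (1 : k)) ^ n) m :=
    IsCoprime.pow_left ((hirr.coprime_iff_not_dvd).2 hmd)
  have hXc : IsCoprime (X : k[X]) (X - C 1) := ⟨1, -1, by simp⟩
  have hXm : X ∣ m := by
    refine (hXc.pow_right (n := n)).dvd_of_dvd_mul_left ?_
    rw [← hm]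
    exact ⟨g * (X - C 1), by ring⟩
  have hn0 : n ≠ 0 := by
    intro h0
    rw [h0, pow_zero, one_mul] at hm
    exact hmd (hm ▸ ⟨g * X, by ring⟩)
  obtain ⟨r, t, hrt⟩ := hcop
  -- Chinese remainder theorem: `t * m` is `1` modulo `(X - 1)^n` and `0` modulo `m`, hence
  -- idempotent modulo their product, a multiple of `g`. It agrees with `X` modulo `X` and modulo `X
  -- - 1`.
  refine ⟨t * m, ?_, ?_⟩
  · refine (Dvd.intro _ rfl : g ∣ g * (X * (X - C 1))).trans ?_
    rw [hm]
    refine ⟨-(t * r), ?_⟩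
    linear_combination t * m * hrt
  · rw [show (X * X - X : k[X]) = X * (X - C 1) by rw [C_1]; ring]
    refine hXc.mul_dvd (dvd_sub (hXm.mul_left t) dvd_rfl) ?_
    rw [show t * m - X = -(r * (X - C 1) ^ n) - (X - C 1) by rw [C_1] at *; linear_combination hrt]
    exact dvd_sub (dvd_neg.2 ((dvd_pow_self _ hn0).mul_left r)) dvd_rfl

/-- An idempotent matrix over a field splits through a selection of its columns. -/
theorem Matrix.exists_split_columns {k : Type*} {κ : Type} [Field k] [Fintype κ] [DecidableEq κ]
    {P : Matrix κ κ k} (hP : P * P = P) :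
    ∃ (J : Type) (_ : Fintype J) (_ : DecidableEq J) (g : J → κ) (R : Matrix J κ k),
      R * P.submatrix id g = 1 ∧ P.submatrix id g * R = P := by
  obtain ⟨J, g, hg, hspan, hli⟩ := exists_linearIndependent' k P.col
  have : Finite J := Finite.of_injective g hg
  cases nonempty_fintype J
  classical
  have hmem : ∀ j, ∃ r : J → k, ∑ i, r i • P.col (g i) = P.col j := fun j =>
    (Submodule.mem_span_range_iff_exists_fun k).1 (hspan ▸ Submodule.subset_span ⟨j, rfl⟩)
  choose r hr using hmem
  have h1 : P.submatrix id g * (Matrix.of fun i j => r j i) = P := by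
    ext i j
    have := congrFun (hr j) i
    rw [Finset.sum_apply] at this
    rw [Matrix.mul_apply]
    refine Eq.trans (Finset.sum_congr rfl fun l _ => ?_) this
    exact mul_comm _ _
  refine ⟨J, inferInstance, inferInstance, g, .of fun i j => r j i, ?_, h1⟩
  -- The chosen columns are independent, so they can be cancelled on the left; `P * P = P` says that
  -- `P` fixes them.
  have hinj : Function.Injective (P.submatrix id g).mulVec := Matrix.mulVec_injective_iff.2 hli
  have h2 : P.submatrix id g * ((Matrix.of fun i j => r j i) * P.submatrix id g) =
      P.submatrix id g * (1 : Matrix J J k) := by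
    rw [← Matrix.mul_assoc, h1, Matrix.mul_one]
    conv_rhs => rw [← hP]
    rfl
  refine Matrix.ext_of_mulVec_single fun j => hinj ?_
  rw [Matrix.mulVec_mulVec, Matrix.mulVec_mulVec, h2]

variable {k : Type u} [Field k] {A : Type u} [CommRing A] [Algebra k A]
  {𝓐 : ℤ → Submodule k A}

open GradedFree

theorem prod_mem_bideg [SetLike.GradedMonoid 𝓐] {κ : Type*} {d : ℤ} (s : Finset κ) (c n : κ → ℤ)
    (x : κ → A) (hx : ∀ i, x i ∈ bideg 𝓐 d (c i) (n i)) :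
    ∏ i ∈ s, x i ∈ bideg 𝓐 d (∑ i ∈ s, c i) (∑ i ∈ s, n i) := by
  classical
  induction s using Finset.induction_on with
  | empty => simpa using one_mem_bideg 𝓐 d
  | insert i s hi ih =>
    rw [Finset.prod_insert hi, Finset.sum_insert hi, Finset.sum_insert hi]
    exact mul_mem_bideg (hx i) ih

theorem bideg_zero_zero (𝓐 : ℤ → Submodule k A) (d : ℤ) : bideg 𝓐 d 0 0 = 𝓐 0 := by
  have := bideg_two_mul 𝓐 d 0 0
  rwa [mul_zero, zero_mul, add_zero] at this

/-- In each term of the Leibniz expansion the degree shifts `y i - y (σ i)` cancel along the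
permutation. -/
theorem GradedFree.IsBihomMatrix.det_mem [SetLike.GradedMonoid 𝓐] {κ : Type*} [Fintype κ]
    [DecidableEq κ] {d : ℤ} {c a : κ → ℤ} {X : Matrix κ κ A}
    (hX : IsBihomMatrix 𝓐 d c a c a 0 0 X) : X.det ∈ 𝓐 0 := by
  rw [Matrix.det_apply, ← bideg_zero_zero 𝓐 d]
  refine Submodule.sum_mem _ fun σ _ => ?_
  have h := prod_mem_bideg Finset.univ _ _ (fun i => X (σ i) i) fun i => hX (σ i) i
  have h1 : ∀ y : κ → ℤ, ∑ i, (0 + y i - y (σ i)) = 0 := fun y => by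
    simp only [zero_add, Finset.sum_sub_distrib, Equiv.sum_comp σ, sub_self]
  rw [h1, h1] at h
  obtain h' | h' := Int.units_eq_one_or (Equiv.Perm.sign σ) <;> rw [h']
  · rwa [one_smul]
  · rw [Units.neg_smul, one_smul]
    exact neg_mem h

/-- The augmentation of a connected positively graded algebra. -/
structure IsAugmentation (𝓐 : ℤ → Submodule k A) (ε : A →ₐ[k] k) : Prop where
  eq_zero : ∀ n ≠ 0, ∀ x ∈ 𝓐 n, ε x = 0
  algebraMap_eq : ∀ x ∈ 𝓐 0, algebraMap k A (ε x) = x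

theorem IsAugmentation.mem_bideg {ε : A →ₐ[k] k} (hε : IsAugmentation 𝓐 ε) {d c n : ℤ} {x : A}
    (hx : x ∈ bideg 𝓐 d c n) : algebraMap k A (ε x) ∈ bideg 𝓐 d c n := by
  obtain ⟨j, rfl | rfl⟩ := Int.even_or_odd' c
  · rw [bideg_two_mul] at hx ⊢
    by_cases h : n + j * d = 0
    · rw [h] at hx ⊢
      rwa [hε.algebraMap_eq x hx]
    · rw [hε.eq_zero _ h x hx, map_zero]
      exact zero_mem _
  · rw [bideg_two_mul_add_one, Submodule.mem_bot] at hx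
    rw [hx, map_zero, map_zero]
    exact zero_mem _

/-- A homogeneous idempotent matrix over a connected positively graded algebra splits through a
graded free module. -/
theorem GradedFree.IsBihomMatrix.exists_split [GradedAlgebra 𝓐] {ε : A →ₐ[k] k}
    (hε : IsAugmentation 𝓐 ε) {κ : Type} [Fintype κ] [DecidableEq κ] {d : ℤ} {c a : κ → ℤ}
    {E : Matrix κ κ A} (hE : IsBihomMatrix 𝓐 d c a c a 0 0 E) (hEE : E * E = E) :
    ∃ (J : Type) (_ : Fintype J) (_ : DecidableEq J) (c' a' : J → ℤ) (I : Matrix κ J A)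
      (R : Matrix J κ A), IsBihomMatrix 𝓐 d c' a' c a 0 0 I ∧ IsBihomMatrix 𝓐 d c a c' a' 0 0 R ∧
        R * I = 1 ∧ I * R = E := by
  have hP : E.map ε * E.map ε = E.map ε := by rw [← Matrix.map_mul, hEE]
  obtain ⟨J, _, _, g, R, hR, hR'⟩ := Matrix.exists_split_columns hP
  set Ea : Matrix κ κ A := (E.map ε).map (algebraMap k A) with hEa
  have hEam : IsBihomMatrix 𝓐 d c a c a 0 0 Ea := fun i j => hε.mem_bideg (hE i j)
  have hEaa : Ea * Ea = Ea := by rw [hEa, ← Matrix.map_mul, hP]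
  have hone : IsBihomMatrix 𝓐 d c a c a 0 0 (1 : Matrix κ κ A) := fun i j => by
    by_cases hij : i = j
    · subst hij
      simpa using one_mem_bideg 𝓐 d
    · rw [Matrix.one_apply_ne hij]
      exact zero_mem _
  -- The standard intertwiner of two idempotents, `E φ = φ Ea`. It reduces to the identity under
  -- `ε`, since `E` and `Ea` have the same reduction.
  set φ := E * Ea + (1 - E) * (1 - Ea) with hφ
  have hφm : IsBihomMatrix 𝓐 d c a c a 0 0 φ := fun i j =>
    add_mem ((hE.mul hEam) i j) (IsBihomMatrix.mul (X := 1 - Ea) (Y := 1 - E) (m := 0) (e := 0)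
      (m' := 0) (e' := 0) (fun i j => sub_mem (hone i j) (hE i j))
      (fun i j => sub_mem (hone i j) (hEam i j)) i j)
  have hφ1 : φ.map ε = 1 := by
    have h1 : Ea.map ε = E.map ε := by
      ext i j
      simp [hEa]
    have h2 : φ.map ε = E.map ε * Ea.map ε + (1 - E.map ε) * (1 - Ea.map ε) := by
      change ε.toRingHom.mapMatrix φ = ε.toRingHom.mapMatrix E * ε.toRingHom.mapMatrix Ea +
        (1 - ε.toRingHom.mapMatrix E) * (1 - ε.toRingHom.mapMatrix Ea)
      rw [hφ]
      simp only [map_add, map_mul, map_sub, map_one]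
    rw [h2, h1]
    linear_combination (norm := noncomm_ring) 2 • hP
  -- The determinant has degree `0`, hence is a constant and equals its augmentation. So `φ` is
  -- invertible and conjugates `E` into the scalar idempotent `Ea`, which splits by linear algebra
  -- over `k`.
  have hdet : φ.det = 1 := by
    rw [← hε.algebraMap_eq _ hφm.det_mem]
    have : ε φ.det = (φ.map ε).det := ε.map_det φ
    rw [this, hφ1, Matrix.det_one, map_one]
  have hφu : IsUnit φ.det := hdet ▸ isUnit_one
  have hEφ : E * φ = φ * Ea := by
    rw [hφ]
    linear_combination (norm := noncomm_ring) 2 • (hEE * Ea) - hEE -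
      2 • (E * hEaa) + hEaa
  set I₀ := Ea.submatrix id g with hI₀
  set R₀ := R.map (algebraMap k A) with hR₀
  have h1 : R₀ * I₀ = 1 := by
    have := congrArg (fun M : Matrix J J k => M.map (algebraMap k A)) hR
    simp only [Matrix.map_mul] at this
    exact this.trans (Matrix.map_one _ (map_zero _) (map_one _))
  have h2 : I₀ * R₀ = Ea := by
    have := congrArg (fun M : Matrix κ κ k => M.map (algebraMap k A)) hR'
    simp only [Matrix.map_mul] at this
    exact this
  have hIm : IsBihomMatrix 𝓐 d (c ∘ g) (a ∘ g) c a 0 0 (φ * I₀) := by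
    have := hφm.mul (X := I₀) (c := c ∘ g) (a := a ∘ g) (m := 0) (e := 0) fun i j => hEam i (g j)
    simpa using this
  have hRI : R₀ * φ⁻¹ * (φ * I₀) = 1 := by
    rw [Matrix.mul_assoc, ← Matrix.mul_assoc φ⁻¹, Matrix.nonsing_inv_mul _ hφu, Matrix.one_mul, h1]
  have hIR : φ * I₀ * (R₀ * φ⁻¹) = E := by
    rw [Matrix.mul_assoc, ← Matrix.mul_assoc I₀, h2, ← Matrix.mul_assoc, ← hEφ, Matrix.mul_assoc,
      Matrix.mul_nonsing_inv _ hφu, Matrix.mul_one]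
  have hproj : φ * I₀ * bihomProj 𝓐 d c a (c ∘ g) (a ∘ g) 0 (R₀ * φ⁻¹) = E := by
    rw [← bihomProj_mul_left hIm, hIR, zero_add, bihomProj_of_isBihomMatrix hE]
  -- Homogeneity of `φ⁻¹` is not checked directly: the homogeneous component of `R₀ φ⁻¹` has the
  -- same product with `φ I₀`, which has a left inverse.
  have hRR : bihomProj 𝓐 d c a (c ∘ g) (a ∘ g) 0 (R₀ * φ⁻¹) = R₀ * φ⁻¹ := by
    have h3 : ∀ Z : Matrix J κ A, R₀ * φ⁻¹ * (φ * I₀ * Z) = Z := fun Z => by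
      rw [← Matrix.mul_assoc (R₀ * φ⁻¹) (φ * I₀), hRI, Matrix.one_mul]
    rw [← h3 (bihomProj 𝓐 d c a (c ∘ g) (a ∘ g) 0 (R₀ * φ⁻¹)), hproj, ← hIR, h3]
  exact ⟨J, _, _, c ∘ g, a ∘ g, φ * I₀, R₀ * φ⁻¹, hIm, hRR ▸ isBihomMatrix_bihomProj _, hRI, hIR⟩

end Splitting

/-! ### Rectifying and splitting homotopy idempotents. -/

section HomotopyIdempotent

variable {k : Type u} [Field k] {A : Type u} [CommRing A] [Algebra k A]
  {𝓐 : ℤ → Submodule k A}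

open GradedFree

/-- The algebra of matrices of bidegree `(0, 0)`. -/
def bihomSubalgebra (𝓐 : ℤ → Submodule k A) [SetLike.GradedMonoid 𝓐] {κ : Type*} [Fintype κ]
    [DecidableEq κ] (d : ℤ) (c a : κ → ℤ) : Subalgebra k (Matrix κ κ A) where
  carrier := {X | IsBihomMatrix 𝓐 d c a c a 0 0 X}
  mul_mem' {X Y} hX hY := by
    have h := IsBihomMatrix.mul hX hY
    rwa [add_zero] at h
  add_mem' {X Y} hX hY i j := add_mem (hX i j) (hY i j)
  algebraMap_mem' r i j := by
    rw [Matrix.algebraMap_matrix_apply]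
    split_ifs with hij
    · subst hij
      rw [Algebra.algebraMap_eq_smul_one]
      refine Submodule.smul_mem _ r ?_
      simpa using one_mem_bideg 𝓐 d
    · exact zero_mem _

theorem finite_bideg (hfin : ∀ n, Module.Finite k (𝓐 n)) (d c n : ℤ) :
    Module.Finite k (bideg 𝓐 d c n) := by
  obtain ⟨j, rfl | rfl⟩ := Int.even_or_odd' c
  · rw [bideg_two_mul]
    exact hfin _
  · rw [bideg_two_mul_add_one]
    infer_instance

theorem finite_bihomSubalgebra [SetLike.GradedMonoid 𝓐] (hfin : ∀ n, Module.Finite k (𝓐 n))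
    {κ : Type*} [Fintype κ] [DecidableEq κ] (d : ℤ) (c a : κ → ℤ) :
    Module.Finite k (bihomSubalgebra 𝓐 d c a) := by
  have := fun c n => finite_bideg hfin d c n
  let g : bihomSubalgebra 𝓐 d c a →ₗ[k]
      ∀ i j : κ, bideg 𝓐 d (0 + c j - c i) (0 + a j - a i) :=
    { toFun := fun X i j => ⟨X.1 i j, X.2 i j⟩
      map_add' := fun _ _ => rfl
      map_smul' := fun _ _ => rfl }
  refine Module.Finite.of_injective g fun X Y h => Subtype.ext (Matrix.ext fun i j => ?_)
  exact congrArg Subtype.val (congrFun (congrFun h i) j)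

theorem Subalgebra.aeval_mem {R : Type*} [Ring R] [Algebra k R] (T : Subalgebra k R) {x : R}
    (hx : x ∈ T) (q : Polynomial k) : Polynomial.aeval x q ∈ T := by
  rw [← Polynomial.aeval_subalgebra_coe q T ⟨x, hx⟩]
  exact SetLike.coe_mem _

/-- A homotopy idempotent matrix is homotopic to an idempotent. -/
theorem exists_idempotent_of_homotopy [SetLike.GradedMonoid 𝓐]
    (hfin : ∀ n, Module.Finite k (𝓐 n)) {κ : Type*} [Fintype κ] [DecidableEq κ] {d : ℤ}
    {c a : κ → ℤ} {S X H : Matrix κ κ A} (hX : IsBihomMatrix 𝓐 d c a c a 0 0 X)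
    (hSX : S * X = X * S) (hH : X * X - X = S * H + H * S) :
    ∃ E, IsBihomMatrix 𝓐 d c a c a 0 0 E ∧ E * E = E ∧ S * E = E * S ∧
      ∃ H', E - X = S * H' + H' * S := by
  have := finite_bihomSubalgebra hfin d c a
  -- The matrices of bidegree `(0, 0)` form a finite-dimensional algebra, so `X` is a root of a
  -- monic polynomial.
  obtain ⟨g, hg, hgX⟩ := IsIntegral.of_mem_of_fg (bihomSubalgebra 𝓐 d c a)
    (Module.Finite.iff_fg.1 this) X hX
  obtain ⟨q, ⟨r, hr⟩, t, ht⟩ := Polynomial.exists_idempotent_lift hg.ne_zero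
  have hgX' : Polynomial.aeval X g = 0 := hgX
  have hcomm : ∀ t : Polynomial k, S * Polynomial.aeval X t = Polynomial.aeval X t * S := fun t =>
    Subalgebra.mem_centralizer_iff k |>.1 (Subalgebra.aeval_mem (Subalgebra.centralizer k {S})
      (Subalgebra.mem_centralizer_iff k |>.2 (by simpa using hSX)) t) S rfl
  refine ⟨Polynomial.aeval X q, Subalgebra.aeval_mem (bihomSubalgebra 𝓐 d c a) hX q, ?_, hcomm q,
    H * Polynomial.aeval X t, ?_⟩
  · have := congrArg (Polynomial.aeval X) hr
    rw [map_sub, map_mul, map_mul, hgX', zero_mul] at this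
    exact sub_eq_zero.1 this
  -- `q(X) - X` is `(X² - X) t(X)`, a boundary times an element commuting with `S`, hence a
  -- boundary.
  · have := congrArg (Polynomial.aeval X) ht
    rw [map_sub, map_mul, map_sub, map_mul, Polynomial.aeval_X, hH] at this
    rw [this, add_mul, Matrix.mul_assoc, Matrix.mul_assoc, Matrix.mul_assoc, hcomm]

namespace GradedMF

variable [GradedAlgebra 𝓐] {f : A} {d : ℤ}

/-- Homotopy idempotents of graded matrix factorizations over a connected positively graded algebra
split up to homotopy. -/
theorem exists_split (hfin : ∀ n, Module.Finite k (𝓐 n)) {ε : A →ₐ[k] k}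
    (hε : IsAugmentation 𝓐 ε) (F : GradedMF 𝓐 f d) {x : F.Total →ₗ[A] F.Total}
    (hx : x ∈ homDeg F F 0) (hsx : F.s ∘ₗ x = x ∘ₗ F.s) {h : F.Total →ₗ[A] F.Total}
    (hxx : x ∘ₗ x - x = F.s ∘ₗ h + h ∘ₗ F.s) :
    ∃ (G : GradedMF 𝓐 f d) (i : G.Total →ₗ[A] F.Total) (r : F.Total →ₗ[A] G.Total),
      i ∈ homDeg G F 0 ∧ r ∈ homDeg F G 0 ∧ F.s ∘ₗ i = i ∘ₗ G.s ∧ G.s ∘ₗ r = r ∘ₗ F.s ∧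
      r ∘ₗ i = LinearMap.id ∧ ∃ ψ ∈ homDeg F F (-1), i ∘ₗ r - x = F.s ∘ₗ ψ + ψ ∘ₗ F.s := by
  obtain ⟨κ, _, _, b, c, a, hb⟩ := exists_isBihomogeneousBasis d F.F0 F.F1
  obtain ⟨S, hS⟩ : ∃ S, LinearMap.toMatrix b b F.s = S := ⟨_, rfl⟩
  obtain ⟨X, hX⟩ : ∃ X, LinearMap.toMatrix b b x = X := ⟨_, rfl⟩
  obtain ⟨H, hH⟩ : ∃ H, LinearMap.toMatrix b b h = H := ⟨_, rfl⟩
  have hSm : IsBihomMatrix 𝓐 d c a c a 1 0 S :=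
    hS ▸ (isBihom_iff hb hb 1 0 F.s).1 ((mem_homDeg_iff_isBihom _ _).1 F.s_mem_homDeg)
  have hXm : IsBihomMatrix 𝓐 d c a c a 0 0 X :=
    hX ▸ (isBihom_iff hb hb 0 0 x).1 ((mem_homDeg_iff_isBihom _ _).1 hx)
  have hSS : S * S = f • (1 : Matrix κ κ A) := by
    have := congrArg (LinearMap.toMatrix b b) F.s_comp_s
    rwa [LinearMap.toMatrix_comp b b b, map_smul, LinearMap.toMatrix_id, hS] at this
  have hSX : S * X = X * S := by
    have := congrArg (LinearMap.toMatrix b b) hsx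
    rwa [LinearMap.toMatrix_comp b b b, LinearMap.toMatrix_comp b b b, hS, hX] at this
  have hXX : X * X - X = S * H + H * S := by
    have := congrArg (LinearMap.toMatrix b b) hxx
    rwa [map_sub, map_add, LinearMap.toMatrix_comp b b b, LinearMap.toMatrix_comp b b b,
      LinearMap.toMatrix_comp b b b, hS, hX, hH] at this
  obtain ⟨E, hEm, hEE, hSE, H', hH'⟩ := exists_idempotent_of_homotopy hfin hXm hSX hXX
  obtain ⟨J, _, _, c', a', I, R, hIm, hRm, hRI, hIR⟩ := hEm.exists_split hε hEE
  -- `R S I` is the differential induced on the image of the idempotent. Because `E = I R` commutes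
  -- with `S`, the maps `I` and `R` are closed and its square is again `f`.
  have hTm : IsBihomMatrix 𝓐 d c' a' c' a' 1 0 (R * (S * I)) := by
    have := hRm.mul (hSm.mul hIm)
    simpa using this
  have hIT : I * (R * (S * I)) = S * I := by
    rw [← Matrix.mul_assoc, hIR, ← Matrix.mul_assoc, ← hSE, Matrix.mul_assoc, ← hIR,
      Matrix.mul_assoc, hRI, Matrix.mul_one]
  have hTR : R * (S * I) * R = R * S := by
    rw [Matrix.mul_assoc, Matrix.mul_assoc, hIR, hSE, ← hIR, Matrix.mul_assoc, ← Matrix.mul_assoc,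
      hRI, Matrix.one_mul]
  have hTT : R * (S * I) * (R * (S * I)) = f • (1 : Matrix J J A) := by
    rw [Matrix.mul_assoc R, Matrix.mul_assoc S, hIT, ← Matrix.mul_assoc S, hSS, Matrix.smul_mul,
      Matrix.one_mul, Matrix.mul_smul, hRI]
  obtain ⟨G, b', hb', hG⟩ := exists_toMatrix_s_eq hTm hTT
  have him : Matrix.toLin b' b I ∈ homDeg G F 0 := by
    rwa [mem_homDeg_iff_isBihom, isBihom_iff hb' hb, LinearMap.toMatrix_toLin]
  have hrm : Matrix.toLin b b' R ∈ homDeg F G 0 := by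
    rwa [mem_homDeg_iff_isBihom, isBihom_iff hb hb', LinearMap.toMatrix_toLin]
  have hid : Matrix.toLin b' b I ∘ₗ Matrix.toLin b b' R - x ∈ homDeg F F (-1 + 1) :=
    sub_mem (comp_mem_homDeg (by norm_num) him hrm) hx
  have hodd : ∀ ψ : F.Total →ₗ[A] F.Total, F.s ∘ₗ ψ - (-1 : ℤ).negOnePow • (ψ ∘ₗ F.s) =
      F.s ∘ₗ ψ + ψ ∘ₗ F.s := fun ψ => by
    rw [Int.negOnePow_odd (-1) (by decide), Units.neg_smul, one_smul, sub_neg_eq_add]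
  obtain ⟨ψ, hψ, hψ'⟩ := exists_homDeg_boundary hid (Matrix.toLin b b H') (by
    rw [hodd]
    refine (LinearMap.toMatrix b b).injective ?_
    rw [map_sub, map_add, LinearMap.toMatrix_comp b b' b, LinearMap.toMatrix_comp b b b,
      LinearMap.toMatrix_comp b b b, LinearMap.toMatrix_toLin, LinearMap.toMatrix_toLin,
      LinearMap.toMatrix_toLin, hS, hX, hIR]
    exact hH')
  refine ⟨G, Matrix.toLin b' b I, Matrix.toLin b b' R, him, hrm, ?_, ?_, ?_, ψ, hψ, ?_⟩
  · refine (LinearMap.toMatrix b' b).injective ?_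
    rw [LinearMap.toMatrix_comp b' b b, LinearMap.toMatrix_comp b' b' b, LinearMap.toMatrix_toLin,
      hS, hG, hIT]
  · refine (LinearMap.toMatrix b b').injective ?_
    rw [LinearMap.toMatrix_comp b b' b', LinearMap.toMatrix_comp b b b', LinearMap.toMatrix_toLin,
      hS, hG, hTR]
  · refine (LinearMap.toMatrix b' b').injective ?_
    rw [LinearMap.toMatrix_comp b' b b', LinearMap.toMatrix_toLin, LinearMap.toMatrix_toLin,
      LinearMap.toMatrix_id, hRI]
  · rw [hψ', hodd]

end GradedMF

end HomotopyIdempotent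

/-! ### Closed morphisms and their homotopy classes. -/

section HomotopyCategory

variable {k : Type u} [Field k] {A : Type u} [CommRing A] [Algebra k A]
  {𝓐 : ℤ → Submodule k A} {f : A} {d : ℤ} {F G H : GradedMF 𝓐 f d}

open GradedFree DGCategory GradedMF

theorem GradedMF.homComplex_d_eq_zero_iff {m n : ℤ} (h : m + 1 = n) (x : homDeg F G m) :
    (homComplex F G).d m n x = 0 ↔ G.s ∘ₗ x.1 - m.negOnePow • (x.1 ∘ₗ F.s) = 0 := by
  rw [homComplex_d_apply F G m n h x]
  exact Subtype.ext_iff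

theorem GradedMF.eq_homComplex_d_iff {m n : ℤ} (h : m + 1 = n) (x : homDeg F G n)
    (y : homDeg F G m) :
    x = (homComplex F G).d m n y ↔ x.1 = G.s ∘ₗ y.1 - m.negOnePow • (y.1 ∘ₗ F.s) := by
  rw [homComplex_d_apply F G m n h y]
  exact Subtype.ext_iff

namespace GradedMF

theorem mem_cocycles_iff (x : homDeg F G 0) :
    x ∈ (dgCategory 𝓐 f d).cocycles F G ↔ G.s ∘ₗ x.1 = x.1 ∘ₗ F.s := by
  refine (homComplex_d_eq_zero_iff (zero_add 1) x).trans ?_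
  rw [Int.negOnePow_zero, one_smul, sub_eq_zero]

/-- The class of a closed morphism of degree `0` in the homotopy category. -/
def homClass (x : F.Total →ₗ[A] G.Total) (hx : x ∈ homDeg F G 0) (hs : G.s ∘ₗ x = x ∘ₗ F.s) :
    (⟨F⟩ : H0 (dgCategory 𝓐 f d)) ⟶ ⟨G⟩ :=
  H0.homMk (C := dgCategory 𝓐 f d) (⟨x, hx⟩ : homDeg F G 0) ((mem_cocycles_iff _).2 hs)

theorem homClass_surjective (φ : (⟨F⟩ : H0 (dgCategory 𝓐 f d)) ⟶ ⟨G⟩) :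
    ∃ x hx hs, φ = homClass (F := F) (G := G) x hx hs := by
  obtain ⟨x, hx, rfl⟩ := H0.homMk_surjective φ
  exact ⟨x.1, x.2, (mem_cocycles_iff x).1 hx, rfl⟩

/-- In degree `-1` the sign of the differential is negative, so boundaries are anticommutators with
`s`. -/
theorem homClass_eq_iff {x y : F.Total →ₗ[A] G.Total} {hx : x ∈ homDeg F G 0}
    {hs : G.s ∘ₗ x = x ∘ₗ F.s} {hy : y ∈ homDeg F G 0} {ht : G.s ∘ₗ y = y ∘ₗ F.s} :
    homClass x hx hs = homClass y hy ht ↔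
      ∃ ψ ∈ homDeg F G (-1), x - y = G.s ∘ₗ ψ + ψ ∘ₗ F.s := by
  have hodd : ∀ ψ : F.Total →ₗ[A] G.Total, G.s ∘ₗ ψ - (-1 : ℤ).negOnePow • (ψ ∘ₗ F.s) =
      G.s ∘ₗ ψ + ψ ∘ₗ F.s := fun ψ => by
    rw [Int.negOnePow_odd (-1) (by decide), Units.neg_smul, one_smul, sub_neg_eq_add]
  refine H0.homMk_eq_iff.trans ?_
  constructor
  · rintro ⟨ψ, h⟩
    refine ⟨ψ.1, ψ.2, ?_⟩
    rw [← hodd]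
    exact (eq_homComplex_d_iff (show (-1 : ℤ) + 1 = 0 by norm_num) _ ψ).1 h
  · rintro ⟨ψ, hψ, h⟩
    rw [← hodd] at h
    exact ⟨(⟨ψ, hψ⟩ : homDeg F G (-1)), (eq_homComplex_d_iff
      (show (-1 : ℤ) + 1 = 0 by norm_num) (⟨x - y, sub_mem hx hy⟩ : homDeg F G 0) ⟨ψ, hψ⟩).2 h⟩

theorem homClass_comp {x : F.Total →ₗ[A] G.Total} {y : G.Total →ₗ[A] H.Total}
    (hx : x ∈ homDeg F G 0) (hs : G.s ∘ₗ x = x ∘ₗ F.s) (hy : y ∈ homDeg G H 0)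
    (ht : H.s ∘ₗ y = y ∘ₗ G.s) :
    homClass x hx hs ≫ homClass y hy ht =
      homClass (y ∘ₗ x) (comp_mem_homDeg (add_zero 0) hy hx)
        (by rw [← LinearMap.comp_assoc, ht, LinearMap.comp_assoc, hs, LinearMap.comp_assoc]) := rfl

end GradedMF

end HomotopyCategory

/-! ### Assembly of the quasi-equivalence for abstract `A` and `B = A[u, v]`. -/

section QuasiEquivalence

variable {k : Type u} [Field k] {A : Type u} [CommRing A] [Algebra k A]
  {𝓐 : ℤ → Submodule k A} [GradedAlgebra 𝓐] {f : A} {d : ℤ}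

open GradedFree DGCategory

namespace GradedMF

theorem isIdempotentComplete (hfin : ∀ n, Module.Finite k (𝓐 n)) {ε : A →ₐ[k] k}
    (hε : IsAugmentation 𝓐 ε) : IsIdempotentComplete (H0 (dgCategory 𝓐 f d)) := by
  refine ⟨fun X φ hφ => ?_⟩
  obtain ⟨F⟩ := X
  obtain ⟨x, hx, hs, rfl⟩ := homClass_surjective (F := F) (G := F) φ
  obtain ⟨h, -, hh⟩ := homClass_eq_iff.1 ((homClass_comp hx hs hx hs).symm.trans hφ)
  obtain ⟨G, i, r, hi, hr, hsi, hsr, hri, hir⟩ := exists_split hfin hε F hx hs hh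
  refine ⟨⟨G⟩, homClass i hi hsi, homClass r hr hsr, ?_, ?_⟩
  · refine (homClass_comp hi hsi hr hsr).trans
      ((homClass_eq_iff (F := G) (G := G) (x := r ∘ₗ i) (y := LinearMap.id) (hy := G.id_mem_homDeg)
        (ht := rfl)).2 ⟨0, zero_mem _, ?_⟩)
    rw [hri, sub_self, LinearMap.comp_zero, LinearMap.zero_comp, add_zero]
  · exact (homClass_comp hr hsr hi hsi).trans (homClass_eq_iff.2 hir)

variable {A' : Type u} [CommRing A'] [Algebra k A'] {𝓐' : ℤ → Submodule k A'}
  [SetLike.GradedMonoid 𝓐']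
  {B : Type u} [CommRing B] [Algebra k B] [Algebra A B] [IsScalarTower k A B]
  [Algebra A' B] [IsScalarTower k A' B] {𝓑 : ℤ → Submodule k B} [GradedAlgebra 𝓑]
  (hB : IsGradedAlgebraMap 𝓐 𝓑) (hB' : IsGradedAlgebraMap 𝓐' 𝓑) {l : ℤ}
  {p q : A'} (hp : p ∈ 𝓐' l) (hq : q ∈ 𝓐' (d - l)) {π : B →ₐ[A] A} {εu εv : B →+* B}

/-- The degrees are linked by an equation rather than written as `m`, `m + 1`, so that the result
applies both to general degrees and to the pair `-1`, `0` of the homotopy category. -/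
theorem exists_eq_d_of_tensorMap
    (hpi : IsKoszulRetract π (algebraMap A' B p) (algebraMap A' B q))
    (hπ : ∀ i, ∀ c ∈ 𝓑 i, π c ∈ 𝓐 i) (F G : GradedMF 𝓐 f d) {m n : ℤ} (h : m + 1 = n)
    (x : homDeg F G n) (y : homDeg (tensorKoszul hB hB' hp hq F) (tensorKoszul hB hB' hp hq G) m)
    (hxy : tensorMapₗ hB hB' (koszul 𝓐' d l hp hq) F G n x =
      (homComplex (tensorKoszul hB hB' hp hq F) (tensorKoszul hB hB' hp hq G)).d m n y) :
    ∃ z : homDeg F G m, x = (homComplex F G).d m n z := by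
  have h1 := (eq_homComplex_d_iff h (tensorMapₗ hB hB' (koszul 𝓐' d l hp hq) F G n x) y).1 hxy
  obtain ⟨ψ, hψ, e⟩ := exists_boundary_of_tensorMap (m' := n) (α := x.1) hB hB' hp hq hpi hπ
    y.2 h1
  exact ⟨⟨ψ, hψ⟩, (eq_homComplex_d_iff h x ⟨ψ, hψ⟩).2 e⟩

/-- Naming the boundary `w` keeps the sum inside `homDeg`, where `exists_eq_tensorMap_add_boundary`
lives. -/
theorem exists_eq_tensorMap_add_d
    (hpi : IsKoszulRetract π (algebraMap A' B p) (algebraMap A' B q))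
    (hπ : ∀ i, ∀ c ∈ 𝓑 i, π c ∈ 𝓐 i) (F G : GradedMF 𝓐 f d) {m n r : ℤ} (h : m + 1 = n)
    (h' : n + 1 = r) (y : homDeg (tensorKoszul hB hB' hp hq F) (tensorKoszul hB hB' hp hq G) n)
    (hy : (homComplex (tensorKoszul hB hB' hp hq F) (tensorKoszul hB hB' hp hq G)).d n r y = 0) :
    ∃ (x : homDeg F G n)
      (z : homDeg (tensorKoszul hB hB' hp hq F) (tensorKoszul hB hB' hp hq G) m),
      (homComplex F G).d n r x = 0 ∧
        ∃ w : homDeg (tensorKoszul hB hB' hp hq F) (tensorKoszul hB hB' hp hq G) n,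
          w = (homComplex (tensorKoszul hB hB' hp hq F) (tensorKoszul hB hB' hp hq G)).d m n z ∧
            y = tensorMapₗ hB hB' (koszul 𝓐' d l hp hq) F G n x + w := by
  subst h
  obtain ⟨α, hα, hα', Ψ, hΨ, e⟩ := exists_eq_tensorMap_add_boundary hB hB' hp hq hpi hπ
    y.2 ((homComplex_d_eq_zero_iff h' y).1 hy)
  let t : homDeg (tensorKoszul hB hB' hp hq F) (tensorKoszul hB hB' hp hq G) (m + 1) :=
    tensorMapₗ hB hB' (koszul 𝓐' d l hp hq) F G (m + 1) ⟨α, hα⟩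
  refine ⟨⟨α, hα⟩, ⟨Ψ, hΨ⟩, (homComplex_d_eq_zero_iff h' ⟨α, hα⟩).2 hα', y - t, ?_,
    (add_sub_cancel t y).symm⟩
  exact (eq_homComplex_d_iff rfl _ ⟨Ψ, hΨ⟩).2 (sub_eq_iff_eq_add'.2 e)

theorem quasiIso_tensorRight_koszul
    (hpi : IsKoszulRetract π (algebraMap A' B p) (algebraMap A' B q))
    (hπ : ∀ i, ∀ c ∈ 𝓑 i, π c ∈ 𝓐 i) (F G : GradedMF 𝓐 f d) :
    QuasiIso ((tensorRight (f := f) hB hB' (koszul 𝓐' d l hp hq)).map F G) := by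
  refine quasiIso_of_elements (K := homComplex F G)
    (L := homComplex (tensorKoszul hB hB' hp hq F) (tensorKoszul hB hB' hp hq G)) _
    (fun m x y _ hxy => ?_) fun m y hy => ?_
  · exact exists_eq_d_of_tensorMap hB hB' hp hq hpi hπ F G rfl x y hxy
  · obtain ⟨x, z, hx, _, rfl, e⟩ :=
      exists_eq_tensorMap_add_d hB hB' hp hq hpi hπ F G rfl rfl y hy
    exact ⟨x, z, hx, e⟩

theorem full_mapH0_tensorRight_koszul
    (hpi : IsKoszulRetract π (algebraMap A' B p) (algebraMap A' B q))
    (hπ : ∀ i, ∀ c ∈ 𝓑 i, π c ∈ 𝓐 i) :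
    (tensorRight (f := f) hB hB' (koszul 𝓐' d l hp hq)).mapH0.Full := by
  refine DGFunctor.mapH0_full _ ?_
  intro F G y hy
  have key : ∃ (x : homDeg F G 0)
      (z : homDeg (tensorKoszul hB hB' hp hq F) (tensorKoszul hB hB' hp hq G) (-1)),
      (homComplex F G).d 0 1 x = 0 ∧
        ∃ w : homDeg (tensorKoszul hB hB' hp hq F) (tensorKoszul hB hB' hp hq G) 0,
          w = (homComplex (tensorKoszul hB hB' hp hq F) (tensorKoszul hB hB' hp hq G)).d (-1) 0 z ∧
            y = tensorMapₗ hB hB' (koszul 𝓐' d l hp hq) F G 0 x + w :=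
    exists_eq_tensorMap_add_d hB hB' hp hq hpi hπ F G
      (show (-1 : ℤ) + 1 = 0 by norm_num) (zero_add 1) y hy
  obtain ⟨x, z, hx, w, hw, e⟩ := key
  refine ⟨x, z, hx, e.trans ?_⟩
  rw [hw]
  rfl

theorem faithful_mapH0_tensorRight_koszul
    (hpi : IsKoszulRetract π (algebraMap A' B p) (algebraMap A' B q))
    (hπ : ∀ i, ∀ c ∈ 𝓑 i, π c ∈ 𝓐 i) :
    (tensorRight (f := f) hB hB' (koszul 𝓐' d l hp hq)).mapH0.Faithful := by
  refine DGFunctor.mapH0_faithful _ fun F G x y _ hxy => ?_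
  exact exists_eq_d_of_tensorMap hB hB' hp hq hpi hπ F G
    (show (-1 : ℤ) + 1 = 0 by norm_num) x y hxy

/-- Tensoring with the Koszul matrix factorization of `p q` is a quasi-equivalence if `B = A[p, q]`
and `A` is a connected positively graded algebra. -/
theorem isQuasiEquivalence_tensorRight_koszul (hfin : ∀ n, Module.Finite k (𝓐 n)) {ε : A →ₐ[k] k}
    (hε : IsAugmentation 𝓐 ε) (hinj : Function.Injective (algebraMap A B))
    (hpi : IsKoszulRetract π (algebraMap A' B p) (algebraMap A' B q))
    (h : IsGradedKoszulEval 𝓐 𝓑 π (algebraMap A' B p) (algebraMap A' B q) εu εv) :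
    (tensorRight (f := f) hB hB' (koszul 𝓐' d l hp hq)).IsQuasiEquivalence := by
  refine ⟨quasiIso_tensorRight_koszul hB hB' hp hq hpi h.π_mem, ?_⟩
  have := isIdempotentComplete (f := f) (d := d) hfin hε
  have := full_mapH0_tensorRight_koszul (f := f) hB hB' hp hq hpi h.π_mem
  have := faithful_mapH0_tensorRight_koszul (f := f) hB hB' hp hq hpi h.π_mem
  refine Functor.essSurj_of_retract _ ?_
  rintro ⟨E⟩
  obtain ⟨F, i, r, hi, hr, hsi, hsr, hri⟩ := exists_retract hB hB' hp hq hinj h E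
  exact ⟨⟨F⟩, homClass i hi hsi, homClass r hr hsr,
    (homClass_comp hi hsi hr hsr).trans
      ((homClass_eq_iff (x := r ∘ₗ i) (y := LinearMap.id) (hy := GradedMF.id_mem_homDeg E)
        (ht := rfl)).2 hri)⟩

end GradedMF

end QuasiEquivalence

/-! ### Setting variables to zero, and positivity of the weights. -/

namespace MvPolynomial

variable {k : Type u} [Field k] {σ τ : Type}

theorem IsWeightedHomogeneous.aeval {w : σ → ℤ} {w' : τ → ℤ} {g : σ → MvPolynomial τ k}
    (hg : ∀ i, IsWeightedHomogeneous w' (g i) (w i)) {p : MvPolynomial σ k} {m : ℤ}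
    (hp : IsWeightedHomogeneous w p m) : IsWeightedHomogeneous w' (MvPolynomial.aeval g p) m := by
  rw [p.as_sum, map_sum]
  refine IsWeightedHomogeneous.sum _ _ _ fun s hs => ?_
  rw [aeval_monomial, algebraMap_eq]
  refine IsWeightedHomogeneous.C_mul ?_ _
  rw [← hp (mem_support_iff.1 hs), Finsupp.weight_apply]
  exact IsWeightedHomogeneous.prod _ _ _ fun i _ => (hg i).pow _

/-- The endomorphism that sets the variable `i` to `0`. -/
def killVar (k : Type u) [Field k] (i : σ) : MvPolynomial σ k →ₐ[k] MvPolynomial σ k :=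
  open Classical in aeval fun j => if j = i then 0 else X j

@[simp]
theorem killVar_X_self (i : σ) : killVar k i (X i) = 0 := by simp [killVar]

@[simp]
theorem killVar_X_of_ne {i j : σ} (h : j ≠ i) : killVar k i (X j) = X j := by simp [killVar, h]

theorem killVar_mem (i : σ) (w : σ → ℤ) (m : ℤ) (p : MvPolynomial σ k)
    (hp : p ∈ weightedHomogeneousSubmodule k w m) :
    killVar k i p ∈ weightedHomogeneousSubmodule k w m := by
  refine IsWeightedHomogeneous.aeval (fun j => ?_) hp
  split
  · exact isWeightedHomogeneous_zero k w _
  · exact isWeightedHomogeneous_X k w j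

theorem exists_eq_killVar_add (i : σ) (p : MvPolynomial σ k) :
    ∃ q, p = killVar k i p + X i * q := by
  induction p using MvPolynomial.induction_on with
  | C a => exact ⟨0, by simp [← algebraMap_eq]⟩
  | add p q hp hq =>
    obtain ⟨p', hp⟩ := hp
    obtain ⟨q', hq⟩ := hq
    refine ⟨p' + q', ?_⟩
    rw [map_add]
    linear_combination hp + hq
  | mul_X p j hp =>
    obtain ⟨p', hp⟩ := hp
    rw [map_mul]
    by_cases h : j = i
    · subst h
      exact ⟨p, by rw [killVar_X_self]; ring⟩
    · refine ⟨p' * X j, ?_⟩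
      rw [killVar_X_of_ne h]
      linear_combination X j * hp

theorem killVar_comm (i j : σ) (p : MvPolynomial σ k) :
    killVar k i (killVar k j p) = killVar k j (killVar k i p) := by
  suffices h : (killVar k i).comp (killVar k j) = (killVar k j).comp (killVar k i) from
    DFunLike.congr_fun h p
  refine algHom_ext fun m => ?_
  by_cases hi : m = i <;> by_cases hj : m = j
  all_goals simp_all [killVar]

theorem isKoszulEval_killVar {i j : σ} (hij : i ≠ j) :
    IsKoszulEval (X i : MvPolynomial σ k) (X j) (killVar k i).toRingHom
      (killVar k j).toRingHom where
  u_smul x := by simp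
  v_smul x := by simp
  u_smul_v x := by simp [hij.symm]
  v_smul_u x := by simp [hij]
  u_reg x hx := (mul_eq_zero.1 hx).resolve_left (X_ne_zero i)
  v_reg x hx := (mul_eq_zero.1 hx).resolve_left (X_ne_zero j)
  exists_u := exists_eq_killVar_add i
  exists_v := exists_eq_killVar_add j
  comm := killVar_comm i j

/-- For positive weights the only monomial of weight `0` is `1`. -/
theorem isAugmentation_aeval_zero {w : σ → ℤ} (hw : ∀ i, 0 < w i) :
    IsAugmentation (weightedHomogeneousSubmodule k w) (aeval (0 : σ → k)) where
  eq_zero m hm p hp := by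
    rw [aeval_zero, Algebra.algebraMap_self, RingHom.id_apply, constantCoeff_eq]
    by_contra h
    exact hm ((hp h).symm.trans (map_zero _))
  algebraMap_eq p hp := by
    rw [aeval_zero, Algebra.algebraMap_self, RingHom.id_apply, algebraMap_eq]
    classical
    ext s
    rw [coeff_C, constantCoeff_eq]
    split_ifs with h
    · rw [h]
    · by_contra hs
      have h0 := hp (Ne.symm hs)
      rw [Finsupp.weight_apply, Finsupp.sum, Finset.sum_eq_zero_iff_of_nonneg
        fun i _ => smul_nonneg (Nat.zero_le _) (hw i).le] at h0
      refine h (Finsupp.ext fun i => ?_).symm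
      by_contra hi
      exact smul_ne_zero hi (hw i).ne' (h0 i (Finsupp.mem_support_iff.2 hi))

theorem finite_weightedHomogeneousSubmodule [Finite σ] {w : σ → ℤ} (hw : ∀ i, 0 < w i) (m : ℤ) :
    Module.Finite k (weightedHomogeneousSubmodule k w m) := by
  -- Positive weights leave only finitely many monomials of each weight; this is deduced from the
  -- case of weights in `ℕ`.
  have hfin : {s : σ →₀ ℕ | Finsupp.weight w s = m}.Finite := by
    refine (Finsupp.finite_of_nat_weight_eq (fun i => (w i).toNat)
      (fun i => by have := hw i; omega) m.toNat).subset fun s hs => ?_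
    have h : ((Finsupp.weight (fun i => (w i).toNat) s : ℕ) : ℤ) = m := by
      rw [← show Finsupp.weight w s = m from hs, Finsupp.weight_apply, Finsupp.weight_apply,
        Finsupp.sum, Finsupp.sum, Nat.cast_sum]
      refine Finset.sum_congr rfl fun i _ => ?_
      rw [smul_eq_mul, Nat.cast_mul, Int.toNat_of_nonneg (hw i).le, nsmul_eq_mul]
    change Finsupp.weight (fun i => (w i).toNat) s = m.toNat
    omega
  rw [weightedHomogeneousSubmodule_eq_finsupp_supported]
  have := hfin.to_subtype
  exact Module.Finite.of_basis (basisRestrictSupport k {s : σ →₀ ℕ | Finsupp.weight w s = m})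

end MvPolynomial

/-! ### The case of polynomial rings. -/

section Knorrer

open MvPolynomial

variable {k : Type u} [Field k] {σ : Type}

attribute [local instance] inlAlgebra inrAlgebra

theorem algebraMap_inlAlgebra {τ : Type} (p : MvPolynomial σ k) :
    algebraMap (MvPolynomial σ k) (MvPolynomial (σ ⊕ τ) k) p = rename Sum.inl p := rfl

/-- The retraction `k[xᵢ, yⱼ] → k[xᵢ]` that sets all `yⱼ` to `0`. -/
def inlRetract (k : Type u) [Field k] (σ τ : Type) :
    MvPolynomial (σ ⊕ τ) k →ₐ[MvPolynomial σ k] MvPolynomial σ k where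
  __ := (aeval (Sum.elim X 0) : MvPolynomial (σ ⊕ τ) k →ₐ[k] MvPolynomial σ k)
  commutes' p := by
    change aeval (Sum.elim X 0) (rename Sum.inl p) = p
    rw [aeval_rename, Sum.elim_comp_inl, aeval_X_left_apply]

theorem inlRetract_apply {τ : Type} (p : MvPolynomial (σ ⊕ τ) k) :
    inlRetract k σ τ p = aeval (Sum.elim X 0) p := rfl

theorem rename_inlRetract (p : MvPolynomial (σ ⊕ Fin 2) k) :
    rename Sum.inl (inlRetract k σ (Fin 2) p) =
      killVar k (Sum.inr 0) (killVar k (Sum.inr (1 : Fin 2)) p) := by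
  suffices h : (rename Sum.inl).comp (aeval (Sum.elim X 0) : _ →ₐ[k] MvPolynomial σ k) =
      (killVar k (Sum.inr (0 : Fin 2))).comp (killVar k (Sum.inr 1)) from DFunLike.congr_fun h p
  refine algHom_ext fun m => ?_
  rcases m with m | m
  · simp
  · fin_cases m <;> simp

theorem killVar_inr_rename_inl {τ : Type} (i : τ) (p : MvPolynomial σ k) :
    killVar k (Sum.inr i) (rename Sum.inl p) = rename Sum.inl p := by
  suffices h : (killVar k (Sum.inr i)).comp (rename Sum.inl) =
      (rename Sum.inl : _ →ₐ[k] MvPolynomial (σ ⊕ τ) k) from DFunLike.congr_fun h p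
  refine algHom_ext fun m => ?_
  simp

/-- The partial derivative by one of the variables `yⱼ`, as a derivation over `k[xᵢ]`. -/
def inrPDeriv (k : Type u) [Field k] (σ : Type) {τ : Type} (i : τ) :
    Derivation (MvPolynomial σ k) (MvPolynomial (σ ⊕ τ) k) (MvPolynomial (σ ⊕ τ) k) where
  toFun := pderiv (Sum.inr i)
  map_add' := map_add _
  map_smul' p q := by
    rw [Algebra.smul_def, algebraMap_inlAlgebra, pderiv_mul]
    have h : pderiv (Sum.inr i) (rename Sum.inl p : MvPolynomial (σ ⊕ τ) k) = 0 := by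
      classical
      refine pderiv_eq_zero_of_notMem_vars fun h => ?_
      have := vars_rename _ _ h
      simp at this
    rw [h, zero_mul, zero_add]
    rfl
  map_one_eq_zero' := pderiv_one
  leibniz' := Derivation.leibniz _

theorem isKoszulRetract_inlRetract :
    IsKoszulRetract (inlRetract k σ (Fin 2)) (X (Sum.inr 0)) (X (Sum.inr 1)) where
  map_u := by simp [inlRetract_apply]
  map_v := by simp [inlRetract_apply]
  -- First the multiple of `v` is split off, then the multiple of `u`; the remainder is the image of
  -- the constant term `π p = 0`.
  exists_of_map_eq_zero p hp := by
    obtain ⟨z, hz⟩ := exists_eq_killVar_add (Sum.inr 1) p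
    obtain ⟨y, hy⟩ := exists_eq_killVar_add (Sum.inr 0) (killVar k (Sum.inr (1 : Fin 2)) p)
    rw [← rename_inlRetract, hp, map_zero, zero_add] at hy
    exact ⟨y, z, by rw [← hy, ← hz]⟩
  -- The variable `v` is prime and does not divide `u`.
  dvd_of_eq x y h := (X_dvd_mul_iff.1 (Dvd.intro y h.symm)).resolve_left fun h' => by
    simp [X_dvd_X] at h'
  eq_zero_of_mul x hx := (mul_eq_zero.1 hx).resolve_left (X_ne_zero _)

theorem isGradedKoszulEval_killVar (w : σ → ℤ) (w' : Fin 2 → ℤ) :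
    IsGradedKoszulEval (weightedHomogeneousSubmodule k w)
      (weightedHomogeneousSubmodule k (Sum.elim w w')) (inlRetract k σ (Fin 2)) (X (Sum.inr 0))
      (X (Sum.inr 1)) (killVar k (Sum.inr 0)).toRingHom (killVar k (Sum.inr 1)).toRingHom where
  toIsKoszulEval := isKoszulEval_killVar (by simp)
  εu_algebraMap := killVar_inr_rename_inl 0
  εv_algebraMap := killVar_inr_rename_inl 1
  algebraMap_π := rename_inlRetract
  π_mem m p hp := IsWeightedHomogeneous.aeval (fun i => by
    rcases i with i | i
    · exact isWeightedHomogeneous_X k w i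
    · exact isWeightedHomogeneous_zero k w _) hp
  εu_mem := killVar_mem (Sum.inr 0) (Sum.elim w w')
  εv_mem := killVar_mem (Sum.inr 1) (Sum.elim w w')
  exists_derivation_u := ⟨inrPDeriv k σ 0, pderiv_X_self _, pderiv_X_of_ne (by simp)⟩
  exists_derivation_v := ⟨inrPDeriv k σ 1, pderiv_X_of_ne (by simp), pderiv_X_self _⟩

theorem isQuasiEquivalence_knorrerFunctor {n : ℕ} {w : Fin n → ℤ} (hw : ∀ i, 0 < w i) (d l : ℤ)
    (f : MvPolynomial (Fin n) k) : (knorrerFunctor w d l f).IsQuasiEquivalence := by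
  have h1 : IsScalarTower k (MvPolynomial (Fin n) k) (MvPolynomial (Fin n ⊕ Fin 2) k) :=
    .of_algebraMap_eq fun c => (rename Sum.inl).commutes c |>.symm
  have h2 : IsScalarTower k (MvPolynomial (Fin 2) k) (MvPolynomial (Fin n ⊕ Fin 2) k) :=
    .of_algebraMap_eq fun c => (rename Sum.inr).commutes c |>.symm
  let := weightedGradedAlgebra k w
  let := weightedGradedAlgebra k (Sum.elim w ![l, d - l])
  have hX (i : Fin 2) : algebraMap (MvPolynomial (Fin 2) k) (MvPolynomial (Fin n ⊕ Fin 2) k) (X i) =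
    X (Sum.inr i) := rename_X _ _
  -- `knorrerMF` agrees definitionally with `koszul` for `p = X 0` and `q = X 1`, so the abstract
  -- theorem applies directly to `knorrerFunctor`.
  refine GradedMF.isQuasiEquivalence_tensorRight_koszul (f := f)
    (𝓐 := weightedHomogeneousSubmodule k w)
    (𝓐' := weightedHomogeneousSubmodule k (![l, d - l] : Fin 2 → ℤ))
    (𝓑 := weightedHomogeneousSubmodule k (Sum.elim w ![l, d - l]))
    (fun i p hp => rename_mem_weightedHomogeneousSubmodule Sum.inl (Sum.elim w ![l, d - l]) i p hp)
    (fun i p hp => rename_mem_weightedHomogeneousSubmodule Sum.inr (Sum.elim w ![l, d - l]) i p hp)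
    (isWeightedHomogeneous_X k ![l, d - l] 0) (isWeightedHomogeneous_X k ![l, d - l] 1)
    (π := inlRetract k (Fin n) (Fin 2)) (εu := (killVar k (Sum.inr 0)).toRingHom)
    (εv := (killVar k (Sum.inr 1)).toRingHom) (finite_weightedHomogeneousSubmodule hw)
    (isAugmentation_aeval_zero hw) (rename_injective _ Sum.inl_injective) ?_ ?_
  · rw [hX, hX]
    exact isKoszulRetract_inlRetract
  · rw [hX, hX]
    exact isGradedKoszulEval_killVar w _

end Knorrer

end

/-- Graded Knörrer periodicity: tensoring with `k[u,v] ⇄ k[u,v](l - d)` is a quasi-equivalence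
`MF^ℤ(f) → MF^ℤ(f + uv)`. -/
theorem mainTheorem4 {k : Type u} [Field k] (n : ℕ) (w : Fin n → ℤ) (hw : ∀ i, 0 < w i)
    (d l : ℤ) (hl : 1 ≤ l) (hld : l ≤ d) (f : MvPolynomial (Fin n) k) (hf0 : f ≠ 0)
    (hf : MvPolynomial.IsWeightedHomogeneous w f d) :
    (knorrerFunctor w d l f).IsQuasiEquivalence := by
  exact isQuasiEquivalence_knorrerFunctor hw d l f
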